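/- Let $J:\mathbb{R}^N\times\mathbb{R}^N\to[0,\infty)$ be a measurable kernel with $J(x,y)=J(y,x)$ for $x\neq y$ and $\sup_x\int_{\mathbb{R}^N} J(x,y)\min\{1,|x-y|^2\}\,dy<\infty$. Put $\mathcal{E}(f,g)=\frac12\iint (f(x)-f(y))(g(x)-g(y))J(x,y)\,dx\,dy$, $H_{\mathcal{L}}=\{f\in L^2(\mathbb{R}^N):\mathcal{E}(f,f)<\infty\}$, and let $\mathcal{L}$ be the operator given by $\langle\mathcal{L}f,g\rangle=\mathcal{E}(f,g)$ for $f,g\in H_{\mathcal L}$. For $u_0\in L^2$, a mild solution of $\partial_tu+\mathcal{L}u=0$, $u(0)=u_0$, is a function $u\in C([0,\infty);L^2)\cap C^1((0,\infty);L^2)\cap C((0,\infty);H_{\mathcal{L}})$ satisfying the equation for all $t>0$ together with the initial condition; for $u_0\in L^p$, a solution is an $L^p$-limit, at each time, of mild solutions with data in $L^2\cap L^p$ converging to $u_0$ in $L^p$. $\mathcal{L}$ is *strongly $p$-hypercontractive* with time $t_\infty\in(0,\infty)$, exponents $q$ and coefficients $A_p\ge0$ if $q:[0,t_\infty)\to[p,\infty)$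 is nondecreasing, $q(0)=p$, $q(t)\to\infty$ as $t\to t_\infty$, and $\|u(t)\|_{q(t)}\le A_p(t)\|u_0\|_p$ for all $0<t<t_\infty$ and all solutions $u$ with datum $u_0\in L^p$. With $\Phi(s)=s\log s$ and $\mathrm{Ent}(f)=\int\Phi(|f|)-\Phi(\int|f|)$, the *$p$-logarithmic Sobolev inequality* with constants $C\in\mathbb{R}$, $D>0$ is: $\mathrm{Ent}(|f|^p)\le C\|f\|_p^p+D\,\mathcal{E}(|f|^{p-2}f,f)$ for every measurable $f$ with $|f|^{p/2}\in H_{\mathcal{L}}$ (where $\mathrm{Ent}(|f|^p)\in[-\infty,\infty)$ is well defined and $\mathcal{E}(|f|^{p-2}f,f)\in[0,\infty]$). Let $p\ge2$. (i) Let $h:[p,\infty)\to(0,\infty)$ be continuous, and let $q$ solve $q'=h(q)$, $q(0)=p$ on $[0,t_\infty)$ and blow up at $t_\infty<\infty$. Suppose that $\mathcal{L}$ is strongly $p$-hypercontractive with this $t_\infty$, these exponents $q$ and coefficients $A_p$ such that $A_p(0)=\lim_{s\to0^+}A_p(s)=1$ and $A_p'(0)=\lim_{s\to0^+}\frac{A_p(s)-1}{s}$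 exists in $[-\infty,\infty)$. Then, with $D(\alpha)=\alpha^2/h(\alpha)$, the $p$-logarithmic Sobolev inequality holds with $D=D(p)$ and $C=p^2A_p'(0)/h(p)$ (with every real $C$ if $A_p'(0)=-\infty$), and $$t_\infty=\int_p^\infty\frac{D(\alpha)}{\alpha^2}\,d\alpha<\infty.$$ (ii) Conversely, let $D:[p,\infty)\to(0,\infty)$ be continuous with $t_\infty:=\int_p^\infty\frac{D(\alpha)}{\alpha^2}\,d\alpha<\infty$, let $C:[p,\infty)\to\mathbb{R}$ be locally integrable, and suppose that for every $r\ge p$ the $r$-logarithmic Sobolev inequality holds with constants $C(r)$, $D(r)$. Then $\mathcal{L}$ is strongly $p$-hypercontractive with this $t_\infty$, with exponents $q$ solving $q'=q^2/D(q)$, $q(0)=p$ on $[0,t_\infty)$, and coefficients $A_p(t)=\exp\left(\int_p^{q(t)}\frac{C(\alpha)}{\alpha^2}\,d\alpha\right)$. -/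

import Mathlib

open MeasureTheory Set Filter
open scoped ENNReal Topology

namespace StrongHyper

/-- The Euclidean space `ℝ^N` (with Lebesgue measure `volume`). -/
abbrev RN (N : ℕ) : Type := EuclideanSpace ℝ (Fin N)

/-- A nonnegative symmetric Lévy kernel on `ℝ^N`. -/
structure IsLevyKernel {N : ℕ} (J : RN N → RN N → ℝ) : Prop where
  measurable : Measurable (Function.uncurry J)
  nonneg : ∀ x y, 0 ≤ J x y
  symm : ∀ x y, x ≠ y → J x y = J y x
  levy : (⨆ x : RN N, ∫⁻ y, ENNReal.ofReal (J x y * min 1 (‖x - y‖ ^ 2))) < ∞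

/-- The Dirichlet form
`𝓔(f, g) = ½ ∬ (f x - f y) (g x - g y) J(x, y) dx dy`, with values in `[-∞, ∞]`:
the integral of the positive part of the integrand minus that of its negative part. -/
noncomputable def dirichletForm {N : ℕ} (J : RN N → RN N → ℝ) (f g : RN N → ℝ) : EReal :=
  ((2⁻¹ * ∫⁻ z : RN N × RN N,
      ENNReal.ofReal ((f z.1 - f z.2) * (g z.1 - g z.2) * J z.1 z.2)
        ∂((volume : Measure (RN N)).prod volume) : ℝ≥0∞) : EReal)
    - ((2⁻¹ * ∫⁻ z : RN N × RN N,
      ENNReal.ofReal (-((f z.1 - f z.2) * (g z.1 - g z.2) * J z.1 z.2))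
        ∂((volume : Measure (RN N)).prod volume) : ℝ≥0∞) : EReal)

/-- The energy `½ ∬ (f x - f y)² J(x, y) dx dy ∈ [0, ∞]`. -/
noncomputable def energy {N : ℕ} (J : RN N → RN N → ℝ) (f : RN N → ℝ) : ℝ≥0∞ :=
  2⁻¹ * ∫⁻ z : RN N × RN N, ENNReal.ofReal ((f z.1 - f z.2) ^ 2 * J z.1 z.2)
    ∂((volume : Measure (RN N)).prod volume)

/-- The energy is the Dirichlet form on the diagonal. -/
theorem dirichletForm_self {N : ℕ} {J : RN N → RN N → ℝ} (hJ : IsLevyKernel J)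
    (f : RN N → ℝ) : dirichletForm J f f = (energy J f : EReal) := by
  have h0 : ∀ z : RN N × RN N,
      ENNReal.ofReal (-((f z.1 - f z.2) * (f z.1 - f z.2) * J z.1 z.2)) = 0 := fun z =>
    ENNReal.ofReal_of_nonpos
      (neg_nonpos.mpr (mul_nonneg (mul_self_nonneg _) (hJ.nonneg _ _)))
  simp [dirichletForm, energy, h0, pow_two]

/-- Membership in `H_𝓛(ℝ^N) = {f ∈ L² : energy of f is finite}`. -/
def MemEnergySpace {N : ℕ} (J : RN N → RN N → ℝ) (f : RN N → ℝ) : Prop :=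
  MemLp f 2 volume ∧ energy J f < ∞

/-- Mild solutions of `∂ₜu + 𝓛u = 0`, `u(0) = u₀ ∈ L²(ℝ^N)`:
`u ∈ C([0,∞); L²) ∩ C¹((0,∞); L²) ∩ C((0,∞); H_𝓛)` and the equation holds for every `t > 0`,
where `𝓛` is understood through `⟨𝓛f, g⟩ = 𝓔(f, g)` for `f, g ∈ H_𝓛`. -/
structure IsMildSolution {N : ℕ} (J : RN N → RN N → ℝ)
    (u₀ : Lp ℝ 2 (volume : Measure (RN N))) (u : ℝ → Lp ℝ 2 (volume : Measure (RN N))) :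
    Prop where
  continuousOn : ContinuousOn u (Ici 0)
  contDiffOn : ContDiffOn ℝ 1 u (Ioi 0)
  memEnergySpace : ∀ t, 0 < t → MemEnergySpace J (u t)
  continuous_energy : ∀ t, 0 < t →
    Tendsto (fun s => energy J (⇑(u s) - ⇑(u t))) (𝓝 t) (𝓝 0)
  equation : ∀ t, 0 < t → ∀ g : Lp ℝ 2 (volume : Measure (RN N)), MemEnergySpace J g →
    dirichletForm J (u t) g = ((-inner ℝ (deriv u t) g : ℝ) : EReal)
  initial : u 0 = u₀

/-- Solutions `u(t)` with initial datum `u₀ ∈ L^p(ℝ^N)`: limits in `L^p`, at every time, of mild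
solutions whose initial data lie in `L² ∩ L^p` and converge to `u₀` in `L^p`. For
`u₀ ∈ L² ∩ L^p` this is the mild solution. -/
def IsSolution {N : ℕ} (J : RN N → RN N → ℝ) (p : ℝ) (u₀ : RN N → ℝ) (u : ℝ → RN N → ℝ) :
    Prop :=
  MemLp u₀ (ENNReal.ofReal p) volume ∧
  (∀ t, 0 ≤ t → MemLp (u t) (ENNReal.ofReal p) volume) ∧
  ∃ (v₀ : ℕ → Lp ℝ 2 (volume : Measure (RN N)))
    (v : ℕ → ℝ → Lp ℝ 2 (volume : Measure (RN N))),
    (∀ n, IsMildSolution J (v₀ n) (v n)) ∧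
    (∀ n, MemLp (v₀ n) (ENNReal.ofReal p) volume) ∧
    Tendsto (fun n => eLpNorm (⇑(v₀ n) - u₀) (ENNReal.ofReal p) volume) atTop (𝓝 0) ∧
    ∀ t, 0 ≤ t →
      Tendsto (fun n => eLpNorm (⇑(v n t) - u t) (ENNReal.ofReal p) volume) atTop (𝓝 0)

/-- `𝓛` is strongly `p`-hypercontractive with blow-up time `T < ∞`, exponents
`q : [0, T) → [p, ∞)` and coefficients `A ≥ 0`. -/
structure IsStronglyHypercontractiveWith {N : ℕ} (J : RN N → RN N → ℝ) (p T : ℝ)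
    (q A : ℝ → ℝ) : Prop where
  one_le : 1 ≤ p
  time_pos : 0 < T
  mapsTo : MapsTo q (Ico 0 T) (Ici p)
  monotoneOn : MonotoneOn q (Ico 0 T)
  initial : q 0 = p
  tendsto : Tendsto q (𝓝[<] T) atTop
  coeff_nonneg : ∀ t ∈ Ico 0 T, 0 ≤ A t
  bound : ∀ (u₀ : RN N → ℝ) (u : ℝ → RN N → ℝ), IsSolution J p u₀ u → ∀ t ∈ Ioo 0 T,
    eLpNorm (u t) (ENNReal.ofReal (q t)) volume
      ≤ ENNReal.ofReal (A t) * eLpNorm u₀ (ENNReal.ofReal p) volume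

/-- `Φ(s) = s log s` (with `Φ(0) = 0`). -/
noncomputable def entFun (s : ℝ) : ℝ := s * Real.log s

/-- The entropy `Ent(f) = ∫ Φ(|f|) - Φ(∫ |f|)` of an integrable function `f`. The integral of
`Φ(|f|)` is that of the positive part minus that of the negative part, since on a space of infinite
measure the latter may be infinite. -/
noncomputable def entropy {N : ℕ} (f : RN N → ℝ) : EReal :=
  ((∫⁻ x, ENNReal.ofReal (entFun |f x|) : ℝ≥0∞) : EReal)
    - ((∫⁻ x, ENNReal.ofReal (-entFun |f x|) : ℝ≥0∞) : EReal)
    - ((entFun (∫ x, |f x|) : ℝ) : EReal)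

/-- The `p`-logarithmic Sobolev inequality with constants `C` and `D > 0`:
`Ent(|f|^p) ≤ C ‖f‖_p^p + D 𝓔(|f|^{p-2} f, f)` for every `f` with `|f|^{p/2} ∈ H_𝓛`. It is part of
the inequality that the entropy is well defined in `[-∞, ∞)`. -/
def LogSobolev {N : ℕ} (J : RN N → RN N → ℝ) (p C D : ℝ) : Prop :=
  0 < D ∧ ∀ f : RN N → ℝ, AEStronglyMeasurable f volume →
    MemEnergySpace J (fun x => |f x| ^ (p / 2)) →
    (∫⁻ x, ENNReal.ofReal (entFun (|f x| ^ p))) < ∞ ∧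
    entropy (fun x => |f x| ^ p) ≤
      ((C * ∫ x, |f x| ^ p : ℝ) : EReal)
        + (D : EReal) * dirichletForm J (fun x => |f x| ^ (p - 2) * f x) f

end StrongHyper

/-! Both directions rest on one computation. Along a solution `u`, the time derivative of `∫
|u(t)|^q(t)` is `(q'/q) ∫ Φ(|u|^q) - q 𝓔(|u|^(q-2) u, u)`: the exponent produces the entropy, the
equation produces the form. When `q' = q²/D(q)` the two terms are in the ratio in which they occur
in the `q`-logarithmic Sobolev inequality with constant `D(q)`.

From hypercontractivity to the inequality, the bound is an equality at `t = 0` and is differentiated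
there from the right. Only a one-sided estimate is needed, and convexity supplies it: `|u|^q ≥ f^q +
q f^(q-1) (u - f)` and `f^q ≥ f^p + (q-p) f^p log f`. This requires a solution starting at `f` whose
energy is continuous up to time zero (`exists_isMildSolution`). It is obtained by spectral calculus:
on the graph space of `f ↦ incr f`, with inner product `⟨f, g⟩ + 𝓔(f, g)`, the embedding `P` into
`L²` gives a positive injective contraction `S = P*P`, formally `(1 + 𝓛)⁻¹`, and the flow is `exp(-t
(S⁻¹ - 1))`. The calculus is run on complex functions and real parts are taken at the end. The
derivative argument is carried out for bounded functions with support of finite measure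
(`entFun_integral_le_of_hypercontractive`) and extended by truncation
(`logSobolev_of_isTestFunction`). The formula for the blow-up time is separation of variables in `q'
= h(q)`.

Conversely, time is replaced by the exponent: with `H(r) = ∫_p^r D(α)/α² dα`, the function `G(r) =
r⁻¹ log ∫ |u(H r)|^r` satisfies `G' ≤ C(r)/r²`, and integration gives the bound for bounded data
(`IsMildSolution.integral_rpow_le`). Boundedness is propagated by the `L^∞` contraction property and
makes the power functionals differentiable along `L²` curves. General data are reached by
approximation and Fatou's lemma (`IsSolution.eLpNorm_le`), and inverting `H` gives the exponents
`q`. -/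

namespace StrongHyper

/-! ### The Dirichlet form as an `L²` pairing of increments. -/

section Form

variable {N : ℕ} {J : RN N → RN N → ℝ}

/-- The measure `½ J(x, y) dx dy`. -/
noncomputable def jumpMeasure (J : RN N → RN N → ℝ) : Measure (RN N × RN N) :=
  ((volume : Measure (RN N)).prod volume).withDensity fun z => ENNReal.ofReal (2⁻¹ * J z.1 z.2)

/-- The increments of a function. -/
def incr {E : Type*} [Sub E] (f : RN N → E) : RN N × RN N → E := fun z => f z.1 - f z.2

/-- The bilinear form `½ ∬ (f x - f y) (g x - g y) J(x, y) dx dy`. -/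
noncomputable def realForm (J : RN N → RN N → ℝ) (f g : RN N → ℝ) : ℝ :=
  ∫ z, incr f z * incr g z ∂jumpMeasure J

/-- The jump measure is absolutely continuous with respect to the product measure, and coordinate
projections pull null sets back to null sets. This is why energies and forms depend only on almost
everywhere classes. -/
theorem ae_jump_of_ae {P : RN N → Prop} (h : ∀ᵐ x, P x) :
    ∀ᵐ z ∂jumpMeasure J, P z.1 ∧ P z.2 := by
  refine (withDensity_absolutelyContinuous _ _).ae_le ?_
  filter_upwards [Measure.quasiMeasurePreserving_fst.ae h,
    Measure.quasiMeasurePreserving_snd.ae h] with z h1 h2 using ⟨h1, h2⟩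

theorem incr_congr {E : Type*} [Sub E] {f g : RN N → E} (h : f =ᵐ[volume] g) :
    incr f =ᵐ[jumpMeasure J] incr g := by
  filter_upwards [ae_jump_of_ae h] with z hz
  simp [incr, hz.1, hz.2]

theorem aestronglyMeasurable_incr {E : Type*} [NormedAddCommGroup E] {f : RN N → E}
    (h : AEStronglyMeasurable f volume) : AEStronglyMeasurable (incr f) (jumpMeasure J) := by
  refine AEStronglyMeasurable.mono_ac (withDensity_absolutelyContinuous _ _) ?_
  exact (h.comp_quasiMeasurePreserving Measure.quasiMeasurePreserving_fst).sub
    (h.comp_quasiMeasurePreserving Measure.quasiMeasurePreserving_snd)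

/-- Since the density is measurable and everywhere finite, the formula needs no measurability of
`F`; the forms can therefore be rewritten for arbitrary functions. -/
theorem half_mul_lintegral_eq (hJ : IsLevyKernel J) (F : RN N × RN N → ℝ) :
    2⁻¹ * ∫⁻ z : RN N × RN N, ENNReal.ofReal (F z * J z.1 z.2)
      ∂((volume : Measure (RN N)).prod volume) = ∫⁻ z, ENNReal.ofReal (F z) ∂jumpMeasure J := by
  have hm : Measurable fun z : RN N × RN N => ENNReal.ofReal (2⁻¹ * J z.1 z.2) :=
    (hJ.measurable.const_mul _).ennreal_ofReal
  rw [jumpMeasure, lintegral_withDensity_eq_lintegral_mul_non_measurable _ hm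
    (Eventually.of_forall fun _ => ENNReal.ofReal_lt_top),
    ← lintegral_const_mul' _ _ (by simp)]
  refine lintegral_congr fun z => ?_
  have h2 : (2⁻¹ : ℝ≥0∞) = ENNReal.ofReal 2⁻¹ := by
    rw [ENNReal.ofReal_inv_of_pos (by norm_num)]; simp
  rw [Pi.mul_apply, ENNReal.ofReal_mul (p := 2⁻¹) (by norm_num), ENNReal.ofReal_mul' (hJ.nonneg _ _), h2]
  ring

theorem energy_eq_lintegral (hJ : IsLevyKernel J) (f : RN N → ℝ) :
    energy J f = ∫⁻ z, ENNReal.ofReal (incr f z ^ 2) ∂jumpMeasure J :=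
  half_mul_lintegral_eq hJ fun z => incr f z ^ 2

theorem eLpNorm_two_sq {α : Type*} [MeasurableSpace α] (μ : Measure α) (F : α → ℝ) :
    eLpNorm F 2 μ ^ 2 = ∫⁻ z, ENNReal.ofReal (F z ^ 2) ∂μ := by
  rw [eLpNorm_eq_lintegral_rpow_enorm_toReal (by norm_num) (by norm_num), ← ENNReal.rpow_natCast,
    ← ENNReal.rpow_mul]
  simp only [ENNReal.toReal_ofNat, Nat.cast_ofNat]
  norm_num
  refine lintegral_congr fun z => ?_
  rw [Real.enorm_eq_ofReal_abs, ← ENNReal.ofReal_pow (abs_nonneg _), sq_abs]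

theorem energy_eq_eLpNorm_sq (hJ : IsLevyKernel J) (f : RN N → ℝ) :
    energy J f = eLpNorm (incr f) 2 (jumpMeasure J) ^ 2 := by
  rw [energy_eq_lintegral hJ, eLpNorm_two_sq]

theorem memEnergySpace_iff (hJ : IsLevyKernel J) {f : RN N → ℝ} :
    MemEnergySpace J f ↔ MemLp f 2 volume ∧ MemLp (incr f) 2 (jumpMeasure J) := by
  unfold MemEnergySpace
  refine and_congr_right fun h => ?_
  rw [energy_eq_eLpNorm_sq hJ]
  constructor
  · intro h'
    exact ⟨aestronglyMeasurable_incr h.1, by simpa using h'⟩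
  · intro h'
    simpa using h'.2

theorem MemEnergySpace.memLp_incr {f : RN N → ℝ} (hf : MemEnergySpace J f) (hJ : IsLevyKernel J) :
    MemLp (incr f) 2 (jumpMeasure J) := ((memEnergySpace_iff hJ).1 hf).2

theorem MemEnergySpace.congr {f g : RN N → ℝ} (hJ : IsLevyKernel J) (hf : MemEnergySpace J f)
    (h : f =ᵐ[volume] g) : MemEnergySpace J g := by
  rw [memEnergySpace_iff hJ] at *
  exact ⟨hf.1.ae_eq h, hf.2.ae_eq (incr_congr h)⟩

theorem energy_congr {f g : RN N → ℝ} (hJ : IsLevyKernel J) (h : f =ᵐ[volume] g) :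
    energy J f = energy J g := by
  rw [energy_eq_eLpNorm_sq hJ, energy_eq_eLpNorm_sq hJ, eLpNorm_congr_ae (incr_congr h)]

theorem MemEnergySpace.sub {f g : RN N → ℝ} (hJ : IsLevyKernel J) (hf : MemEnergySpace J f)
    (hg : MemEnergySpace J g) : MemEnergySpace J (f - g) := by
  rw [memEnergySpace_iff hJ] at *
  refine ⟨hf.1.sub hg.1, (hf.2.sub hg.2).ae_eq (Eventually.of_forall fun z => ?_)⟩
  simp [incr]; ring

/-- A function which is, almost everywhere, a Lipschitz function of `f` belongs to the energy space
if `f` does. -/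
theorem MemEnergySpace.of_lipschitz {f g : RN N → ℝ} (hJ : IsLevyKernel J) {K : ℝ}
    (hf : MemEnergySpace J f) (hg : AEStronglyMeasurable g volume)
    (h0 : ∀ᵐ x, |g x| ≤ K * |f x|)
    (h1 : ∀ᵐ z ∂jumpMeasure J, |incr g z| ≤ K * |incr f z|) : MemEnergySpace J g := by
  rw [memEnergySpace_iff hJ] at *
  exact ⟨hf.1.of_le_mul hg h0, hf.2.of_le_mul (aestronglyMeasurable_incr hg) h1⟩

theorem integrable_incr_mul {f g : RN N → ℝ} (hJ : IsLevyKernel J) (hf : MemEnergySpace J f)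
    (hg : MemEnergySpace J g) : Integrable (fun z => incr f z * incr g z) (jumpMeasure J) :=
  (hf.memLp_incr hJ).integrable_mul (hg.memLp_incr hJ)

theorem dirichletForm_eq_lintegral (hJ : IsLevyKernel J) (f g : RN N → ℝ) :
    dirichletForm J f g = ((∫⁻ z, ENNReal.ofReal (incr f z * incr g z) ∂jumpMeasure J : ℝ≥0∞)
        : EReal)
      - ((∫⁻ z, ENNReal.ofReal (-(incr f z * incr g z)) ∂jumpMeasure J : ℝ≥0∞) : EReal) := by
  unfold dirichletForm
  congr 2
  · exact half_mul_lintegral_eq hJ fun z => incr f z * incr g z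
  · have := half_mul_lintegral_eq hJ fun z => -(incr f z * incr g z)
    simp only [neg_mul] at this
    exact this

theorem ereal_coe_sub_eq_integral {α : Type*} [MeasurableSpace α] {μ : Measure α} {F : α → ℝ}
    (hF : Integrable F μ) :
    ((∫⁻ z, ENNReal.ofReal (F z) ∂μ : ℝ≥0∞) : EReal)
      - ((∫⁻ z, ENNReal.ofReal (-F z) ∂μ : ℝ≥0∞) : EReal) = ((∫ z, F z ∂μ : ℝ) : EReal) := by
  rw [integral_eq_lintegral_pos_part_sub_lintegral_neg_part hF, EReal.coe_sub,
    EReal.coe_ennreal_toReal, EReal.coe_ennreal_toReal]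
  · exact (lt_of_le_of_lt (lintegral_mono fun z => Real.ofReal_le_enorm _) hF.neg.2).ne
  · exact (lt_of_le_of_lt (lintegral_mono fun z => Real.ofReal_le_enorm _) hF.2).ne

theorem dirichletForm_eq_coe (hJ : IsLevyKernel J) {f g : RN N → ℝ}
    (h : Integrable (fun z => incr f z * incr g z) (jumpMeasure J)) :
    dirichletForm J f g = (realForm J f g : EReal) := by
  rw [dirichletForm_eq_lintegral hJ, ereal_coe_sub_eq_integral h, realForm]

theorem realForm_comm (f g : RN N → ℝ) : realForm J f g = realForm J g f := by
  simp only [realForm, mul_comm]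

theorem realForm_congr {f f' g g' : RN N → ℝ} (hf : f =ᵐ[volume] f') (hg : g =ᵐ[volume] g') :
    realForm J f g = realForm J f' g' := by
  refine integral_congr_ae ?_
  filter_upwards [incr_congr (J := J) hf, incr_congr (J := J) hg] with z h1 h2
  rw [h1, h2]

theorem realForm_sub_left {f f' g : RN N → ℝ} (hJ : IsLevyKernel J) (hf : MemEnergySpace J f)
    (hf' : MemEnergySpace J f') (hg : MemEnergySpace J g) :
    realForm J (f - f') g = realForm J f g - realForm J f' g := by
  rw [realForm, realForm, realForm, ← integral_sub (integrable_incr_mul hJ hf hg)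
    (integrable_incr_mul hJ hf' hg)]
  refine integral_congr_ae (Eventually.of_forall fun z => ?_)
  simp [incr]; ring

theorem realForm_self_nonneg (f : RN N → ℝ) : 0 ≤ realForm J f f :=
  integral_nonneg fun _ => mul_self_nonneg _

theorem energy_toReal (hJ : IsLevyKernel J) {f : RN N → ℝ} (hf : MemEnergySpace J f) :
    (energy J f).toReal = realForm J f f := by
  rw [energy_eq_lintegral hJ, realForm, integral_eq_lintegral_of_nonneg_ae
    (Eventually.of_forall fun z => mul_self_nonneg _)
    (integrable_incr_mul hJ hf hf).aestronglyMeasurable]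
  simp only [pow_two]

/-- Cauchy–Schwarz in `L²` of the jump measure. -/
theorem sq_realForm_le (hJ : IsLevyKernel J) {f g : RN N → ℝ} (hf : MemEnergySpace J f)
    (hg : MemEnergySpace J g) :
    realForm J f g ^ 2 ≤ realForm J f f * realForm J g g := by
  set F := (hf.memLp_incr hJ).toLp
  set G := (hg.memLp_incr hJ).toLp
  have key : ∀ {a b : RN N → ℝ} (ha : MemLp (incr a) 2 (jumpMeasure J))
      (hb : MemLp (incr b) 2 (jumpMeasure J)),
      realForm J a b = inner ℝ ha.toLp hb.toLp := by
    intro a b ha hb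
    rw [L2.inner_def, realForm]
    refine integral_congr_ae ?_
    filter_upwards [ha.coeFn_toLp, hb.coeFn_toLp] with z h1 h2
    rw [h1, h2]; simp [mul_comm]
  rw [key (hf.memLp_incr hJ) (hg.memLp_incr hJ), key (hf.memLp_incr hJ) (hf.memLp_incr hJ),
    key (hg.memLp_incr hJ) (hg.memLp_incr hJ), pow_two]
  exact real_inner_mul_inner_self_le _ _

end Form

end StrongHyper

namespace StrongHyper

/-! ### The heat flow by functional calculus. -/

section Semigroup

theorem mul_exp_neg_le {δ x : ℝ} (hδ : 0 < δ) : x * Real.exp (-(δ * x)) ≤ 1 / δ := by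
  rw [Real.exp_neg, ← div_eq_mul_inv, div_le_div_iff₀ (Real.exp_pos _) hδ]
  have := Real.add_one_le_exp (δ * x)
  nlinarith

theorem sq_mul_exp_neg_le {δ x : ℝ} (hδ : 0 < δ) (hx : 0 ≤ x) :
    x ^ 2 * Real.exp (-(δ * x)) ≤ 2 / δ ^ 2 := by
  rw [Real.exp_neg, ← div_eq_mul_inv, div_le_div_iff₀ (Real.exp_pos _) (by positivity)]
  have := Real.quadratic_le_exp_of_nonneg (x := δ * x) (by positivity)
  have : 0 ≤ δ * x := by positivity
  nlinarith

theorem abs_exp_sub_exp_le {δ s t x : ℝ} (hs : δ ≤ s) (ht : δ ≤ t) (hx : 0 ≤ x) :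
    |Real.exp (-(s * x)) - Real.exp (-(t * x))| ≤ |s - t| * (x * Real.exp (-(δ * x))) := by
  wlog hst : t ≤ s generalizing s t
  · rw [abs_sub_comm, abs_sub_comm s t]
    exact this ht hs (le_of_not_ge hst)
  have h1 : Real.exp (-(s * x)) ≤ Real.exp (-(t * x)) := by
    apply Real.exp_le_exp.2; nlinarith
  have h2 : Real.exp (-(t * x)) ≤ Real.exp (-(δ * x)) := by
    apply Real.exp_le_exp.2; nlinarith
  have h3 : Real.exp (-(s * x)) = Real.exp (-(t * x)) * Real.exp (-((s - t) * x)) := by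
    rw [← Real.exp_add]; ring_nf
  have h4 := Real.add_one_le_exp (-((s - t) * x))
  have h5 : 0 ≤ (s - t) * x := mul_nonneg (by linarith) hx
  rw [abs_of_nonpos (by linarith), abs_of_nonneg (by linarith : 0 ≤ s - t)]
  calc -(Real.exp (-(s * x)) - Real.exp (-(t * x)))
      = Real.exp (-(t * x)) * (1 - Real.exp (-((s - t) * x))) := by rw [h3]; ring
    _ ≤ Real.exp (-(δ * x)) * ((s - t) * x) := by
        have := Real.exp_pos (-(t * x))
        have := Real.exp_pos (-(δ * x))
        have : Real.exp (-((s - t) * x)) ≤ 1 := by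
          apply Real.exp_le_one_iff.2; linarith
        apply mul_le_mul h2 (by linarith) (by linarith) (by positivity)
    _ = _ := by ring

/-- The bound is uniform in the spectral variable `x ≥ 0`: away from time zero the factor `exp(-δ
x)` absorbs the `x²` of the second-order remainder. It becomes differentiability of the flow in
operator norm. -/
theorem abs_exp_taylor_le {δ s t x : ℝ} (hδ : 0 < δ) (hs : δ ≤ s) (ht : δ ≤ t) (hx : 0 ≤ x) :
    |Real.exp (-(s * x)) - Real.exp (-(t * x)) - (s - t) * (-x * Real.exp (-(t * x)))|
      ≤ (s - t) ^ 2 * (2 / δ ^ 2) := by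
  set y := -((s - t) * x) with hy
  have h3 : Real.exp (-(s * x)) = Real.exp (-(t * x)) * Real.exp y := by
    rw [← Real.exp_add, hy]; ring_nf
  have h4 := Real.add_one_le_exp y
  have h5 : Real.exp y - 1 ≤ y * Real.exp y := by
    have h := Real.add_one_le_exp (-y)
    have h' : Real.exp (-y) * Real.exp y = 1 := by rw [← Real.exp_add]; simp
    have := Real.exp_pos y
    nlinarith
  have hp := Real.exp_pos (-(t * x))
  have e : Real.exp (-(s * x)) - Real.exp (-(t * x)) - (s - t) * (-x * Real.exp (-(t * x)))
      = Real.exp (-(t * x)) * (Real.exp y - 1 - y) := by rw [h3, hy]; ring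
  rw [e, abs_of_nonneg (mul_nonneg hp.le (by linarith))]
  calc Real.exp (-(t * x)) * (Real.exp y - 1 - y)
      ≤ Real.exp (-(t * x)) * (y * Real.exp y - y) := by gcongr
    _ = y * (Real.exp (-(s * x)) - Real.exp (-(t * x))) := by rw [h3]; ring
    _ ≤ |y| * |Real.exp (-(s * x)) - Real.exp (-(t * x))| := by
        rw [← abs_mul]; exact le_abs_self _
    _ ≤ (|s - t| * x) * (|s - t| * (x * Real.exp (-(δ * x)))) := by
        gcongr
        · rw [hy, abs_neg, abs_mul, abs_of_nonneg hx]
        · exact abs_exp_sub_exp_le hs ht hx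
    _ = (s - t) ^ 2 * (x ^ 2 * Real.exp (-(δ * x))) := by
        rw [← sq_abs (s - t)]; ring
    _ ≤ _ := by gcongr; exact sq_mul_exp_neg_le hδ hx

/-- The function `r ↦ exp (-t (1/r - 1))`, extended by zero to `r ≤ 0`. -/
noncomputable def heatSymbol (t r : ℝ) : ℝ := Real.exp t * expNegInvGlue (t⁻¹ * r)

theorem heatSymbol_zero (t : ℝ) : heatSymbol t 0 = 0 := by simp [heatSymbol]

theorem heatSymbol_of_pos {t r : ℝ} (ht : 0 < t) (hr : 0 < r) :
    heatSymbol t r = Real.exp (-(t * (r⁻¹ - 1))) := by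
  have : 0 < t⁻¹ * r := by positivity
  rw [heatSymbol, expNegInvGlue, if_neg this.not_ge, ← Real.exp_add]
  congr 1
  field_simp
  ring

theorem continuous_heatSymbol (t : ℝ) : Continuous (heatSymbol t) := by
  unfold heatSymbol
  exact continuous_const.mul ((expNegInvGlue.contDiff (n := 0)).continuous.comp (by fun_prop))

/-- The exponential decay at `r = 0⁺` beats the factor `1/r`. The functional calculus therefore
applies to the symbol of `S⁻¹ exp(-t (S⁻¹ - 1))` even when `0` lies in the spectrum of `S`. -/
theorem continuous_inv_mul_heatSymbol {t : ℝ} (ht : 0 < t) :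
    Continuous (fun r => r⁻¹ * heatSymbol t r) := by
  have h := (expNegInvGlue.continuous_polynomial_eval_inv_mul Polynomial.X).comp
    (by fun_prop : Continuous fun r : ℝ => t⁻¹ * r)
  have h' := (continuous_const (y := Real.exp t * t⁻¹)).mul h
  refine h'.congr fun r => ?_
  simp only [Pi.mul_apply, Function.comp, Polynomial.eval_X, heatSymbol, mul_inv, inv_inv]
  field_simp

variable {V : Type*} [NormedAddCommGroup V] [InnerProductSpace ℂ V] [CompleteSpace V]

theorem spectrum_subset_Icc {S : V →L[ℂ] V} (hS : S.IsPositive) (h1 : ‖S‖ ≤ 1) :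
    spectrum ℝ S ⊆ Icc 0 1 := by
  intro r hr
  have h0 : 0 ≤ r := by
    have := hS.spectrumRestricts
    rw [SpectrumRestricts.nnreal_iff] at this
    exact this r hr
  refine ⟨h0, ?_⟩
  rcases subsingleton_or_nontrivial V with h | h
  · simp at hr
  · have := spectrum.norm_le_norm_of_mem hr
    rw [Real.norm_of_nonneg h0] at this
    exact this.trans h1

/-- For a positive injective contraction `S`, the equation `w' = w - S⁻¹ w` has a strongly
continuous solution with any initial value. -/
theorem exists_heat_flow {S : V →L[ℂ] V} (hS : S.IsPositive) (h1 : ‖S‖ ≤ 1)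
    (hinj : Function.Injective S) (x : V) :
    ∃ w y : ℝ → V, w 0 = x ∧ ContinuousOn w (Ici 0) ∧ ContinuousOn y (Ioi 0) ∧
      (∀ t, 0 < t → S (y t) = w t) ∧ ∀ t, 0 < t → HasDerivAt w (w t - y t) t := by
  have hsp := spectrum_subset_Icc hS h1
  have hsa : IsSelfAdjoint S := hS.isSelfAdjoint
  set Φ : ℝ → (V →L[ℂ] V) := fun t => cfc (heatSymbol t) S with hΦ
  set Ψ : ℝ → (V →L[ℂ] V) := fun t => cfc (fun r => r⁻¹ * heatSymbol t r) S with hΨ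
  have cφ : ∀ t, ContinuousOn (heatSymbol t) (spectrum ℝ S) :=
    fun t => (continuous_heatSymbol t).continuousOn
  have cψ : ∀ t, 0 < t → ContinuousOn (fun r => r⁻¹ * heatSymbol t r) (spectrum ℝ S) :=
    fun t ht => (continuous_inv_mul_heatSymbol ht).continuousOn
  have hSΨ : ∀ t, 0 < t → S * Ψ t = Φ t := by
    intro t ht
    have e : Φ t = cfc (fun r => r * (r⁻¹ * heatSymbol t r)) S := by
      apply cfc_congr
      intro r hr
      rcases (hsp hr).1.eq_or_lt with h | h
      · simp [← h, heatSymbol_zero]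
      · simp only; field_simp
    rw [e, cfc_mul (fun r => r) _ S (by fun_prop) (cψ t ht), cfc_id' ℝ S]
  -- difference quotient bound
  have hder : ∀ δ s t, 0 < δ → δ ≤ s → δ ≤ t →
      ‖Φ s - Φ t - (s - t) • (Φ t - Ψ t)‖ ≤ (s - t) ^ 2 * (2 / δ ^ 2) := by
    intro δ s t hδ hs ht
    have ht' := hδ.trans_le ht
    have e : Φ s - Φ t - (s - t) • (Φ t - Ψ t) = cfc (fun r => heatSymbol s r - heatSymbol t r
        - (s - t) • (heatSymbol t r - r⁻¹ * heatSymbol t r)) S := by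
      have c1 : ContinuousOn (fun r => heatSymbol s r - heatSymbol t r) (spectrum ℝ S) :=
        (cφ s).sub (cφ t)
      have c2 : ContinuousOn (fun r => heatSymbol t r - r⁻¹ * heatSymbol t r) (spectrum ℝ S) :=
        (cφ t).sub (cψ t ht')
      have c3 : ContinuousOn (fun r => (s - t) • (heatSymbol t r - r⁻¹ * heatSymbol t r))
        (spectrum ℝ S) := c2.const_smul (s - t)
      rw [cfc_sub _ _ S c1 c3, cfc_sub _ _ S (cφ s) (cφ t), cfc_smul (s - t) _ S c2,
        cfc_sub _ _ S (cφ t) (cψ t ht')]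
    rw [e]
    refine norm_cfc_le (by positivity) fun r hr => ?_
    rcases (hsp hr).1.eq_or_lt with h | h
    · simp only [← h, heatSymbol_zero, Real.norm_eq_abs]; simp; positivity
    · have hx : 0 ≤ r⁻¹ - 1 := by linarith [one_le_inv_iff₀.2 ⟨h, (hsp hr).2⟩]
      have := abs_exp_taylor_le hδ hs ht hx
      rw [heatSymbol_of_pos (hδ.trans_le hs) h, heatSymbol_of_pos ht' h, Real.norm_eq_abs,
        smul_eq_mul]
      convert this using 3
      ring
  have hlip : ∀ δ s t, 0 < δ → δ ≤ s → δ ≤ t →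
      ‖Ψ s - Ψ t‖ ≤ |s - t| * (1 / δ + 2 / δ ^ 2) := by
    intro δ s t hδ hs ht
    have ht' := hδ.trans_le ht
    have hs' := hδ.trans_le hs
    rw [hΨ]
    simp only
    rw [← cfc_sub _ _ S (cψ s hs') (cψ t ht')]
    refine norm_cfc_le (by positivity) fun r hr => ?_
    rcases (hsp hr).1.eq_or_lt with h | h
    · simp only [← h]; simp; positivity
    · have hx : 0 ≤ r⁻¹ - 1 := by linarith [one_le_inv_iff₀.2 ⟨h, (hsp hr).2⟩]
      rw [heatSymbol_of_pos hs' h, heatSymbol_of_pos ht' h, Real.norm_eq_abs, ← mul_sub, abs_mul,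
        abs_of_pos (inv_pos.2 h)]
      have a1 := abs_exp_sub_exp_le hs ht hx
      have a2 := mul_exp_neg_le (x := r⁻¹ - 1) hδ
      have a3 := sq_mul_exp_neg_le hδ hx
      calc _ ≤ r⁻¹ * (|s - t| * ((r⁻¹ - 1) * Real.exp (-(δ * (r⁻¹ - 1))))) := by gcongr
        _ = |s - t| * ((r⁻¹ - 1) * Real.exp (-(δ * (r⁻¹ - 1)))
              + (r⁻¹ - 1) ^ 2 * Real.exp (-(δ * (r⁻¹ - 1)))) := by ring
        _ ≤ _ := by gcongr
  have hΦ1 : ∀ t, 0 < t → ‖Φ t‖ ≤ 1 := by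
    intro t ht
    refine norm_cfc_le zero_le_one fun r hr => ?_
    rcases (hsp hr).1.eq_or_lt with h | h
    · simp [← h, heatSymbol_zero]
    · have hx : 0 ≤ r⁻¹ - 1 := by linarith [one_le_inv_iff₀.2 ⟨h, (hsp hr).2⟩]
      rw [heatSymbol_of_pos ht h, Real.norm_of_nonneg (Real.exp_pos _).le, Real.exp_le_one_iff]
      nlinarith
  -- Strong continuity at zero is first quantified on the range of `S`: with `φ = heatSymbol t r`,
  -- one has `r (1 - φ) ≤ r t (1/r - 1) = t (1 - r) ≤ t`.
  have hΦS : ∀ t, 0 < t → ‖Φ t * S - S‖ ≤ t := by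
    intro t ht
    have e : Φ t * S - S = cfc (fun r => heatSymbol t r * r - r) S := by
      have c1 : ContinuousOn (fun r => heatSymbol t r * r) (spectrum ℝ S) :=
        (cφ t).mul continuousOn_id
      have c2 : ContinuousOn (fun r : ℝ => r) (spectrum ℝ S) := continuousOn_id
      rw [cfc_sub _ (fun r => r) S c1 c2,
        cfc_mul _ (fun r => r) S (cφ t) (by fun_prop), cfc_id' ℝ S]
    rw [e]
    refine norm_cfc_le ht.le fun r hr => ?_
    rcases (hsp hr).1.eq_or_lt with h | h
    · simp [← h, ht.le]
    · have hr1 := (hsp hr).2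
      have hx : 0 ≤ r⁻¹ - 1 := by linarith [one_le_inv_iff₀.2 ⟨h, hr1⟩]
      rw [heatSymbol_of_pos ht h]
      have a1 := Real.add_one_le_exp (-(t * (r⁻¹ - 1)))
      have a2 : Real.exp (-(t * (r⁻¹ - 1))) ≤ 1 := by
        rw [Real.exp_le_one_iff]; nlinarith
      rw [Real.norm_of_nonpos (by nlinarith)]
      have a3 : r * r⁻¹ = 1 := mul_inv_cancel₀ h.ne'
      calc _ = r * (1 - Real.exp (-(t * (r⁻¹ - 1)))) := by ring
        _ ≤ r * (t * (r⁻¹ - 1)) := by gcongr; linarith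
        _ = t * (1 - r) := by linear_combination t * a3
        _ ≤ t := by nlinarith
  -- The orthogonal complement of the range of a self-adjoint operator is its kernel, here zero.
  have hdense : DenseRange S := by
    have h2 : S.rangeᗮ = ⊥ := by
      rw [ContinuousLinearMap.orthogonal_range, ← ContinuousLinearMap.star_eq_adjoint,
        hsa.star_eq, LinearMap.ker_eq_bot]
      exact hinj
    have h3 := (Submodule.topologicalClosure_eq_top_iff (K := S.range)).2 h2
    rw [← Submodule.dense_iff_topologicalClosure_eq_top] at h3
    exact h3
  have hlim0 : Tendsto (fun t => Φ t x) (𝓝[>] 0) (𝓝 x) := by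
    rw [Metric.tendsto_nhds]
    intro ε hε
    obtain ⟨z, hz⟩ := Metric.denseRange_iff.1 hdense x (ε / 4) (by positivity)
    rw [dist_eq_norm] at hz
    have : ∀ᶠ t : ℝ in 𝓝[>] 0, t * ‖z‖ < ε / 4 := by
      have : Tendsto (fun t : ℝ => t * ‖z‖) (𝓝[>] 0) (𝓝 (0 * ‖z‖)) :=
        ((continuous_id.mul continuous_const).tendsto 0).mono_left nhdsWithin_le_nhds
      rw [zero_mul] at this
      exact this.eventually (gt_mem_nhds (by positivity))
    filter_upwards [this, self_mem_nhdsWithin] with t ht ht0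
    rw [dist_eq_norm]
    have e : Φ t x - x = Φ t (x - S z) + (Φ t * S - S) z - (x - S z) := by
      simp [map_sub]
    have b1 : ‖Φ t (x - S z)‖ ≤ ‖x - S z‖ :=
      ((Φ t).le_opNorm _).trans (by nlinarith [hΦ1 t ht0, norm_nonneg (x - S z)])
    have b2 : ‖(Φ t * S - S) z‖ ≤ t * ‖z‖ :=
      ((Φ t * S - S).le_opNorm _).trans (by nlinarith [hΦS t ht0, norm_nonneg z])
    rw [e]
    calc _ ≤ ‖Φ t (x - S z)‖ + ‖(Φ t * S - S) z‖ + ‖x - S z‖ :=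
          (norm_sub_le _ _).trans (by gcongr; exact norm_add_le _ _)
      _ < ε := by linarith
  have hderiv : ∀ t, 0 < t → HasDerivAt (fun s => Φ s x) (Φ t x - Ψ t x) t := by
    intro t ht
    rw [hasDerivAt_iff_isLittleO]
    have hO : (fun s => Φ s x - Φ t x - (s - t) • (Φ t x - Ψ t x)) =O[𝓝 t]
        fun s => (s - t) ^ 2 := by
      refine Asymptotics.IsBigO.of_bound (2 / (t / 2) ^ 2 * ‖x‖) ?_
      filter_upwards [lt_mem_nhds (half_lt_self ht)] with s hs
      have := hder (t / 2) s t (by positivity) hs.le (by linarith)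
      have h2 := ((Φ s - Φ t - (s - t) • (Φ t - Ψ t)).le_opNorm x).trans
        (mul_le_mul_of_nonneg_right this (norm_nonneg x))
      rw [Real.norm_of_nonneg (by positivity : 0 ≤ (s - t) ^ 2)]
      refine le_trans (le_of_eq ?_) (h2.trans (le_of_eq (by ring)))
      simp
    refine hO.trans_isLittleO ?_
    have : (fun s : ℝ => (s - t) ^ 2) = fun s => (s - t) * (s - t) := by ext; ring
    rw [this]
    have h0 : Tendsto (fun s : ℝ => s - t) (𝓝 t) (𝓝 0) := by
      have : Continuous fun s : ℝ => s - t := by fun_prop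
      simpa using this.tendsto t
    simpa using ((Asymptotics.isLittleO_one_iff ℝ).2 h0).mul_isBigO
      (Asymptotics.isBigO_refl (fun s : ℝ => s - t) (𝓝 t))
  -- The initial value is set by hand: since `0⁻¹ = 0`, `heatSymbol 0` is identically zero, so `Φ 0
  -- = 0` instead of the identity.
  refine ⟨fun t => if t ≤ 0 then x else Φ t x, fun t => Ψ t x, by simp, ?_, ?_, ?_, ?_⟩
  · intro t ht
    rcases (mem_Ici.1 ht).eq_or_lt with h | h
    · subst h
      rw [← Ioi_union_left, continuousWithinAt_union]
      refine ⟨?_, continuousWithinAt_singleton⟩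
      simp only [ContinuousWithinAt, le_refl, if_true]
      refine hlim0.congr' ?_
      filter_upwards [self_mem_nhdsWithin] with s hs
      rw [if_neg (not_le.2 hs)]
    · refine ContinuousAt.continuousWithinAt ?_
      refine (hderiv t h).continuousAt.congr ?_
      filter_upwards [lt_mem_nhds h] with s hs
      rw [if_neg (not_le.2 hs)]
  · intro t ht
    have ht : 0 < t := ht
    refine ContinuousAt.continuousWithinAt ?_
    rw [ContinuousAt, tendsto_iff_norm_sub_tendsto_zero]
    refine squeeze_zero' (g := fun s => |s - t| * (1 / (t / 2) + 2 / (t / 2) ^ 2) * ‖x‖)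
      (Eventually.of_forall fun _ => norm_nonneg _) ?_ ?_
    · filter_upwards [lt_mem_nhds (half_lt_self ht)] with s hs
      have := hlip (t / 2) s t (by positivity) hs.le (by linarith)
      exact ((Ψ s - Ψ t).le_opNorm x).trans (mul_le_mul_of_nonneg_right this (norm_nonneg x))
    · have : Continuous fun s => |s - t| * (1 / (t / 2) + 2 / (t / 2) ^ 2) * ‖x‖ := by fun_prop
      simpa using this.tendsto t
  · intro t ht
    simp only [if_neg (not_le.2 ht), ← hSΨ t ht]
    rfl
  · intro t ht
    simp only [if_neg (not_le.2 ht)]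
    refine (hderiv t ht).congr_of_eventuallyEq ?_
    filter_upwards [lt_mem_nhds ht] with s hs
    rw [if_neg (not_le.2 hs)]

variable {H : Type*} [NormedAddCommGroup H] [InnerProductSpace ℂ H] [CompleteSpace H]

/-- For an injective contraction `P : V → H`, the equation `⟨w, v⟩ = ⟨P (w - w'), P v⟩` has a
strongly continuous solution with any initial value. -/
theorem exists_form_flow {P : V →L[ℂ] H} (h1 : ‖P‖ ≤ 1) (hinj : Function.Injective P) (x : V) :
    ∃ w y : ℝ → V, w 0 = x ∧ ContinuousOn w (Ici 0) ∧ ContinuousOn y (Ioi 0) ∧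
      (∀ t, 0 < t → ∀ v, inner ℂ (w t) v = inner ℂ (P (y t)) (P v)) ∧
      ∀ t, 0 < t → HasDerivAt w (w t - y t) t := by
  set S : V →L[ℂ] V := (ContinuousLinearMap.adjoint P).comp P with hS
  have hin : ∀ a b, inner ℂ (S a) b = inner ℂ (P a) (P b) := fun a b => by
    rw [hS, ContinuousLinearMap.comp_apply, ContinuousLinearMap.adjoint_inner_left]
  have hpos : S.IsPositive := ContinuousLinearMap.isPositive_adjoint_comp_self P
  have hS1 : ‖S‖ ≤ 1 := by
    rw [hS, ContinuousLinearMap.norm_adjoint_comp_self]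
    nlinarith [norm_nonneg P]
  have hSinj : Function.Injective S := by
    rw [injective_iff_map_eq_zero]
    intro y hy
    have h := hin y y
    rw [hy, inner_zero_left, eq_comm, inner_self_eq_zero] at h
    exact hinj (by rw [h, map_zero])
  obtain ⟨w, y, hw0, hwc, hyc, hSy, hwd⟩ := exists_heat_flow hpos hS1 hSinj x
  exact ⟨w, y, hw0, hwc, hyc, fun t ht v => by rw [← hSy t ht, hin], hwd⟩

end Semigroup

end StrongHyper

namespace StrongHyper

/-! ### Existence of mild solutions with finite-energy data. -/

section Existence

theorem re_inner_ofReal {α : Type*} [MeasurableSpace α] {μ : Measure α} (F : Lp ℂ 2 μ)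
    (G : Lp ℝ 2 μ) :
    (inner ℂ F (Complex.ofRealCLM.compLp G)).re = inner ℝ (Complex.reCLM.compLp F) G := by
  rw [L2.inner_def, L2.inner_def]
  have h := L2.integrable_inner (𝕜 := ℂ) F (Complex.ofRealCLM.compLp G)
  have e := Complex.reCLM.integral_comp_comm h
  rw [Complex.reCLM_apply] at e
  rw [← e]
  refine integral_congr_ae ?_
  filter_upwards [Complex.ofRealCLM.coeFn_compLp G, Complex.reCLM.coeFn_compLp F] with x h1 h2
  rw [h1, h2]
  simp

variable {N : ℕ}

/-- The graph of `f ↦ incr f` as an operator from `L²(ℝ^N; ℂ)` to `L²` of the jump measure. -/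
noncomputable def incrGraph (J : RN N → RN N → ℝ) :
    Submodule ℂ (WithLp 2 (Lp ℂ 2 (volume : Measure (RN N)) × Lp ℂ 2 (jumpMeasure J))) where
  carrier := {x | x.snd =ᵐ[jumpMeasure J] incr x.fst}
  add_mem' := by
    intro a b ha hb
    have h := incr_congr (J := J) (Lp.coeFn_add a.fst b.fst)
    filter_upwards [ha, hb, h, Lp.coeFn_add a.snd b.snd] with z h1 h2 h3 h4
    rw [WithLp.add_snd, WithLp.add_fst, h3, h4, Pi.add_apply, h1, h2]
    simp [incr]; ring
  zero_mem' := by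
    have h := incr_congr (J := J) (Lp.coeFn_zero ℂ 2 (volume : Measure (RN N)))
    filter_upwards [h, Lp.coeFn_zero ℂ 2 (jumpMeasure J)] with z h1 h2
    rw [WithLp.zero_snd, WithLp.zero_fst, h1, h2]
    simp [incr]
  smul_mem' := by
    intro c a ha
    have h := incr_congr (J := J) (Lp.coeFn_smul c a.fst)
    filter_upwards [ha, h, Lp.coeFn_smul c a.snd] with z h1 h2 h3
    rw [WithLp.smul_snd, WithLp.smul_fst, h2, h3, Pi.smul_apply, h1]
    simp [incr]; ring

variable {J : RN N → RN N → ℝ}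

/-- Along a common subsequence both components converge almost everywhere, and the increments of an
almost everywhere convergent sequence converge almost everywhere for the jump measure. -/
theorem isClosed_incrGraph : IsClosed (incrGraph J : Set (WithLp 2
    (Lp ℂ 2 (volume : Measure (RN N)) × Lp ℂ 2 (jumpMeasure J)))) := by
  refine IsSeqClosed.isClosed fun x a hx hxa => ?_
  have h1 : Tendsto (fun n => (x n).fst) atTop (𝓝 a.fst) :=
    ((WithLp.prod_continuous_ofLp 2 _ _).fst.tendsto a).comp hxa
  have h2 : Tendsto (fun n => (x n).snd) atTop (𝓝 a.snd) :=
    ((WithLp.prod_continuous_ofLp 2 _ _).snd.tendsto a).comp hxa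
  obtain ⟨ns, hns, h1'⟩ := (tendstoInMeasure_of_tendsto_Lp h1).exists_seq_tendsto_ae
  obtain ⟨ms, hms, h2'⟩ :=
    (tendstoInMeasure_of_tendsto_Lp (h2.comp hns.tendsto_atTop)).exists_seq_tendsto_ae
  have hall : ∀ᵐ z ∂jumpMeasure J, ∀ n, (x n).snd z = incr (x n).fst z := ae_all_iff.2 hx
  show a.snd =ᵐ[jumpMeasure J] incr a.fst
  filter_upwards [hall, ae_jump_of_ae h1', h2'] with z k1 k2 k3
  have k4 : Tendsto (fun n => incr (x (ns (ms n))).fst z) atTop (𝓝 (incr a.fst z)) :=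
    (k2.1.comp hms.tendsto_atTop).sub (k2.2.comp hms.tendsto_atTop)
  refine tendsto_nhds_unique k3 (k4.congr fun n => ?_)
  rw [← k1]; rfl

instance : CompleteSpace (incrGraph J) := isClosed_incrGraph.completeSpace_coe

/-- The projection of the graph to the domain. -/
noncomputable def graphFst (J : RN N → RN N → ℝ) :
    incrGraph J →L[ℂ] Lp ℂ 2 (volume : Measure (RN N)) :=
  (WithLp.fstL 2 ℂ _ _).comp (incrGraph J).subtypeL

/-- The real part of the projection of the graph to the domain. -/
noncomputable def graphRe (J : RN N → RN N → ℝ) :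
    incrGraph J →L[ℝ] Lp ℝ 2 (volume : Measure (RN N)) :=
  (Complex.reCLM.compLpL 2 volume).comp ((graphFst J).restrictScalars ℝ)

theorem graphFst_injective : Function.Injective (graphFst J) := by
  rw [injective_iff_map_eq_zero]
  intro x hx
  have h1 : (x : WithLp 2 (Lp ℂ 2 (volume : Measure (RN N)) × Lp ℂ 2 (jumpMeasure J))).fst = 0 := hx
  have h2 : (x : WithLp 2 (Lp ℂ 2 (volume : Measure (RN N)) × Lp ℂ 2 (jumpMeasure J))).snd = 0 := by
    rw [Lp.eq_zero_iff_ae_eq_zero]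
    have h := incr_congr (J := J) (Lp.coeFn_zero ℂ 2 (volume : Measure (RN N)))
    have hx2 := x.2
    change _ =ᵐ[_] incr _ at hx2
    rw [h1] at hx2
    filter_upwards [hx2, h] with z k1 k2
    rw [k1, k2]; simp [incr]
  apply Subtype.ext
  apply WithLp.ofLp_injective
  exact Prod.ext h1 h2

theorem norm_graphFst_le : ‖graphFst J‖ ≤ 1 := by
  refine ContinuousLinearMap.opNorm_le_bound _ zero_le_one fun x => ?_
  rw [one_mul]
  have := WithLp.prod_norm_sq_eq_of_L2 (x : WithLp 2 (Lp ℂ 2 (volume : Measure (RN N))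
    × Lp ℂ 2 (jumpMeasure J)))
  have h2 : ‖graphFst J x‖ ^ 2 ≤ ‖x‖ ^ 2 := by
    rw [Submodule.coe_norm, this]
    exact le_add_of_nonneg_right (sq_nonneg _)
  exact (sq_le_sq₀ (norm_nonneg _) (norm_nonneg _)).1 h2

theorem incr_graphRe (x : incrGraph J) :
    incr (graphRe J x) =ᵐ[jumpMeasure J] Complex.reCLM.compLp
      (x : WithLp 2 (Lp ℂ 2 (volume : Measure (RN N)) × Lp ℂ 2 (jumpMeasure J))).snd := by
  have h := incr_congr (J := J) (Complex.reCLM.coeFn_compLp' (graphFst J x))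
  have hx2 := x.2
  change _ =ᵐ[_] incr _ at hx2
  filter_upwards [h, hx2, Complex.reCLM.coeFn_compLp
      (x : WithLp 2 (Lp ℂ 2 (volume : Measure (RN N)) × Lp ℂ 2 (jumpMeasure J))).snd] with z h1 h2 h3
  rw [h3, h2]
  refine h1.trans ?_
  simp [incr]; rfl

theorem memEnergySpace_graphRe (hJ : IsLevyKernel J) (x : incrGraph J) :
    MemEnergySpace J (graphRe J x) :=
  (memEnergySpace_iff hJ).2 ⟨Lp.memLp _, (Lp.memLp _).ae_eq (incr_graphRe x).symm⟩

theorem energy_graphRe_le (hJ : IsLevyKernel J) (x : incrGraph J) :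
    energy J (graphRe J x) ≤ ENNReal.ofReal (‖x‖ ^ 2) := by
  rw [energy_eq_eLpNorm_sq hJ, eLpNorm_congr_ae (incr_graphRe x),
    ENNReal.ofReal_pow (norm_nonneg _)]
  gcongr
  set y := (x : WithLp 2 (Lp ℂ 2 (volume : Measure (RN N)) × Lp ℂ 2 (jumpMeasure J))) with hy
  rw [← Lp.enorm_def, ← ofReal_norm]
  apply ENNReal.ofReal_le_ofReal
  have h1 : ‖Complex.reCLM.compLp y.snd‖ ≤ ‖y.snd‖ := by
    have := Complex.reCLM.norm_compLp_le y.snd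
    rwa [Complex.reCLM_norm, one_mul] at this
  have h2 : ‖y.snd‖ ^ 2 ≤ ‖x‖ ^ 2 := by
    rw [Submodule.coe_norm, WithLp.prod_norm_sq_eq_of_L2 y]
    exact le_add_of_nonneg_left (sq_nonneg _)
  exact h1.trans ((sq_le_sq₀ (norm_nonneg _) (norm_nonneg _)).1 h2)

/-- A real function of finite energy, as an element of the graph. -/
theorem exists_graph_ofReal (hJ : IsLevyKernel J) (g : Lp ℝ 2 (volume : Measure (RN N)))
    (hg : MemEnergySpace J g) : ∃ x : incrGraph J, graphRe J x = g ∧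
      graphFst J x = Complex.ofRealCLM.compLp g ∧
      (x : WithLp 2 (Lp ℂ 2 (volume : Measure (RN N)) × Lp ℂ 2 (jumpMeasure J))).snd
        = Complex.ofRealCLM.compLp (hg.memLp_incr hJ).toLp := by
  let y : WithLp 2 (Lp ℂ 2 (volume : Measure (RN N)) × Lp ℂ 2 (jumpMeasure J)) :=
    WithLp.toLp 2 (Complex.ofRealCLM.compLp g, Complex.ofRealCLM.compLp (hg.memLp_incr hJ).toLp)
  have hy : y ∈ incrGraph J := by
    change _ =ᵐ[_] incr _
    have h := incr_congr (J := J) (Complex.ofRealCLM.coeFn_compLp' g)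
    filter_upwards [h, Complex.ofRealCLM.coeFn_compLp (hg.memLp_incr hJ).toLp,
      (hg.memLp_incr hJ).coeFn_toLp] with z h1 h2 h3
    change (Complex.ofRealCLM.compLp (hg.memLp_incr hJ).toLp) z
      = incr (Complex.ofRealCLM.compLp g) z
    rw [h1, h2, h3]
    simp [incr]
  refine ⟨⟨y, hy⟩, ?_, rfl, rfl⟩
  apply Lp.ext
  filter_upwards [Complex.reCLM.coeFn_compLp' (Complex.ofRealCLM.compLp g),
    Complex.ofRealCLM.coeFn_compLp' g] with z h1 h2
  refine h1.trans ?_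
  rw [h2]; simp

/-- The graph inner product is the `L²` inner product plus the form. Against a real `g`, only the
real part of `x` contributes to the real part of the pairing. -/
theorem re_inner_graph (hJ : IsLevyKernel J) (x : incrGraph J)
    (g : Lp ℝ 2 (volume : Measure (RN N))) (hg : MemEnergySpace J g) (v : incrGraph J)
    (hv1 : graphFst J v = Complex.ofRealCLM.compLp g)
    (hv2 : (v : WithLp 2 (Lp ℂ 2 (volume : Measure (RN N)) × Lp ℂ 2 (jumpMeasure J))).snd
        = Complex.ofRealCLM.compLp (hg.memLp_incr hJ).toLp) :
    (inner ℂ x v).re = inner ℝ (graphRe J x) g + realForm J (graphRe J x) g := by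
  rw [Submodule.coe_inner, WithLp.prod_inner_apply, Complex.add_re]
  congr 1
  · have : (v : WithLp 2 (Lp ℂ 2 (volume : Measure (RN N)) × Lp ℂ 2 (jumpMeasure J))).fst
      = Complex.ofRealCLM.compLp g := hv1
    change (inner ℂ (graphFst J x) (v : WithLp 2 (Lp ℂ 2 (volume : Measure (RN N)) ×
      Lp ℂ 2 (jumpMeasure J))).fst).re = _
    rw [this, re_inner_ofReal]
    rfl
  · change (inner ℂ _ (v : WithLp 2 (Lp ℂ 2 (volume : Measure (RN N)) ×
      Lp ℂ 2 (jumpMeasure J))).snd).re = _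
    rw [hv2, re_inner_ofReal, L2.inner_def, realForm]
    refine integral_congr_ae ?_
    filter_upwards [incr_graphRe x, (hg.memLp_incr hJ).coeFn_toLp] with z h1 h2
    rw [h1, h2]
    exact mul_comm _ _

set_option maxHeartbeats 2000000 in
/-- Existence of mild solutions with initial datum of finite energy; the energy is continuous up to
the initial time. -/
theorem exists_isMildSolution (hJ : IsLevyKernel J) (f : Lp ℝ 2 (volume : Measure (RN N)))
    (hf : MemEnergySpace J f) :
    ∃ u, IsMildSolution J f u ∧
      Tendsto (fun s => energy J (⇑(u s) - ⇑f)) (𝓝[>] 0) (𝓝 0) := by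
  obtain ⟨x, hx, -, -⟩ := exists_graph_ofReal hJ f hf
  -- The flow lives in the graph space, so its continuity at time zero already includes convergence
  -- in energy.
  obtain ⟨w, y, hw0, hwc, hyc, hSy, hwd⟩ := exists_form_flow norm_graphFst_le graphFst_injective x
  have hsub : ∀ a b : incrGraph J, energy J (⇑(graphRe J a) - ⇑(graphRe J b))
      ≤ ENNReal.ofReal (‖a - b‖ ^ 2) := by
    intro a b
    have e : ⇑(graphRe J a) - ⇑(graphRe J b) =ᵐ[volume] graphRe J (a - b) := by
      rw [map_sub]; exact (Lp.coeFn_sub _ _).symm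
    rw [energy_congr hJ e]
    exact energy_graphRe_le hJ _
  have hlim : ∀ (l : Filter ℝ) (a : incrGraph J), Tendsto w l (𝓝 a) →
      Tendsto (fun s => energy J (⇑(graphRe J (w s)) - ⇑(graphRe J a))) l (𝓝 0) := by
    intro l a h
    have h0 : Tendsto (fun s => ENNReal.ofReal (‖w s - a‖ ^ 2)) l (𝓝 0) := by
      have : Tendsto (fun s => ‖w s - a‖ ^ 2) l (𝓝 0) := by
        simpa using ((tendsto_iff_norm_sub_tendsto_zero.1 h).pow 2)
      simpa using ENNReal.tendsto_ofReal this
    exact tendsto_of_tendsto_of_tendsto_of_le_of_le tendsto_const_nhds h0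
      (fun _ => zero_le) (fun s => hsub _ _)
  obtain ⟨u, hu⟩ : ∃ u : ℝ → Lp ℝ 2 (volume : Measure (RN N)), ∀ t, u t = graphRe J (w t) :=
    ⟨_, fun _ => rfl⟩
  obtain ⟨d, hd⟩ : ∃ d : ℝ → Lp ℝ 2 (volume : Measure (RN N)), ∀ t, d t = graphRe J (y t) :=
    ⟨_, fun _ => rfl⟩
  have huc : ContinuousOn u (Ici 0) :=
    ((graphRe J).continuous.comp_continuousOn hwc).congr fun t _ => hu t
  have hdc : ContinuousOn d (Ioi 0) :=
    ((graphRe J).continuous.comp_continuousOn hyc).congr fun t _ => hd t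
  have hud : ∀ t, 0 < t → HasDerivAt u (u t - d t) t := fun t ht => by
    rw [hu, hd, ← map_sub, funext hu]
    exact (graphRe J).hasFDerivAt.comp_hasDerivAt t (hwd t ht)
  have hmem : ∀ t, MemEnergySpace J (u t) := fun t => by
    rw [hu]; exact memEnergySpace_graphRe hJ _
  -- This is the weak equation: since `u' = u - d`, it says `𝓔(u, g) = ⟨d - u, g⟩ = -⟨u', g⟩`.
  have heq : ∀ t, 0 < t → ∀ g : Lp ℝ 2 (volume : Measure (RN N)), MemEnergySpace J g →
      inner ℝ (u t) g + realForm J (u t) g = inner ℝ (d t) g := by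
    intro t ht g hg
    obtain ⟨v, -, hv1, hv2⟩ := exists_graph_ofReal hJ g hg
    have h1 := re_inner_graph hJ (w t) g hg v hv1 hv2
    have h2 := re_inner_ofReal (graphFst J (y t)) g
    rw [← hv1, ← hSy t ht v, h1] at h2
    rw [hu, hd]
    exact h2
  have hlim' : ∀ l a, Tendsto w l (𝓝 a) →
      Tendsto (fun s => energy J (⇑(u s) - ⇑(graphRe J a))) l (𝓝 0) := fun l a h => by
    simpa only [hu] using hlim l a h
  clear hlim hsub hSy hwd hyc
  refine ⟨u, ⟨huc, ?_, fun t _ => hmem t, ?_, ?_, ?_⟩, ?_⟩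
  · have h1 : ContDiffOn ℝ (0 + 1) u (Ioi 0) := by
      rw [contDiffOn_succ_iff_deriv_of_isOpen isOpen_Ioi]
      refine ⟨fun t ht => (hud t ht).differentiableAt.differentiableWithinAt, by simp, ?_⟩
      rw [contDiffOn_zero]
      exact ((huc.mono Ioi_subset_Ici_self).sub hdc).congr fun t ht => (hud t ht).deriv
    simpa using h1
  · intro t ht
    have := hlim' _ _ ((hwc t ht.le).continuousAt (Ici_mem_nhds ht))
    rwa [← hu] at this
  · intro t ht g hg
    rw [(hud t ht).deriv, dirichletForm_eq_coe hJ (integrable_incr_mul hJ (hmem t) hg),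
      inner_sub_left, ← heq t ht g hg]
    congr 1
    ring
  · rw [hu, hw0, hx]
  · have := hlim' (𝓝[>] 0) x (by
      rw [← hw0]
      exact (hwc 0 self_mem_Ici).mono_left (nhdsWithin_mono _ Ioi_subset_Ici_self))
    rwa [hx] at this

end Existence

end StrongHyper

namespace StrongHyper

/-! ### Differentiability of integral functionals along curves in `L²`. -/

section Functional

variable {α : Type*} [MeasurableSpace α] {μ : Measure α}

theorem integral_sq_eq_norm_sq (v : Lp ℝ 2 μ) : ∫ x, v x ^ 2 ∂μ = ‖v‖ ^ 2 := by
  rw [← real_inner_self_eq_norm_sq, L2.inner_def]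
  refine integral_congr_ae (Eventually.of_forall fun x => ?_)
  simp [pow_two]

theorem integrable_sq_coeFn (v : Lp ℝ 2 μ) : Integrable (fun x => v x ^ 2) μ :=
  (Lp.memLp v).integrable_sq

/-- Pointwise data making `v ↦ ∫ θ (v x)` differentiable on `I`-valued functions of `L²`. -/
structure QuadraticTaylor (I : Set ℝ) (θ θ' : ℝ → ℝ) (K : ℝ) : Prop where
  measurable : Measurable θ
  measurable' : Measurable θ'
  bound : ∀ a ∈ I, |θ a| ≤ K * a ^ 2
  bound' : ∀ a ∈ I, |θ' a| ≤ K * |a|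
  taylor : ∀ a ∈ I, ∀ b ∈ I, |θ b - θ a - θ' a * (b - a)| ≤ K * (b - a) ^ 2

namespace QuadraticTaylor

variable {I : Set ℝ} {θ θ' : ℝ → ℝ} {K : ℝ}

theorem integrable (h : QuadraticTaylor I θ θ' K) (v : Lp ℝ 2 μ) (hv : ∀ᵐ x ∂μ, v x ∈ I) :
    Integrable (fun x => θ (v x)) μ := by
  refine ((integrable_sq_coeFn v).const_mul K).mono'
    (h.measurable.comp_aemeasurable (Lp.aestronglyMeasurable v).aemeasurable).aestronglyMeasurable
    ?_
  filter_upwards [hv] with x hx using h.bound _ hx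

theorem memLp_deriv (h : QuadraticTaylor I θ θ' K) (v : Lp ℝ 2 μ) (hv : ∀ᵐ x ∂μ, v x ∈ I) :
    MemLp (fun x => θ' (v x)) 2 μ := by
  refine (Lp.memLp v).of_le_mul (c := K)
    (h.measurable'.comp_aemeasurable (Lp.aestronglyMeasurable v).aemeasurable).aestronglyMeasurable
    ?_
  filter_upwards [hv] with x hx using h.bound' _ hx

/-- Integrating the pointwise Taylor estimate gives a remainder that is quadratic in the `L²` norm.
Continuity and differentiability of the functional both follow from it. -/
theorem abs_integral_sub_le (h : QuadraticTaylor I θ θ' K) (a v : Lp ℝ 2 μ)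
    (ha : ∀ᵐ x ∂μ, a x ∈ I) (hv : ∀ᵐ x ∂μ, v x ∈ I) :
    |∫ x, θ (v x) ∂μ - ∫ x, θ (a x) ∂μ - inner ℝ ((h.memLp_deriv a ha).toLp) (v - a)|
      ≤ K * ‖v - a‖ ^ 2 := by
  have hI := L2.integrable_inner (𝕜 := ℝ) ((h.memLp_deriv a ha).toLp) (v - a)
  have hva : Integrable (fun x => θ (v x) - θ (a x)) μ :=
    (h.integrable v hv).sub (h.integrable a ha)
  rw [L2.inner_def, ← integral_sub (h.integrable v hv) (h.integrable a ha),
    ← integral_sub hva hI, ← integral_sq_eq_norm_sq,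
    ← integral_const_mul]
  refine abs_integral_le_integral_abs.trans (integral_mono_ae ?_ ?_ ?_)
  · exact (hva.sub hI).abs
  · exact (integrable_sq_coeFn _).const_mul K
  · filter_upwards [ha, hv, Lp.coeFn_sub v a, (h.memLp_deriv a ha).coeFn_toLp] with x h1 h2 h3 h4
    rw [h3, h4]
    refine le_trans (le_of_eq ?_) (h.taylor _ h1 _ h2)
    simp [mul_comm]

theorem tendsto (h : QuadraticTaylor I θ θ' K) {ι : Type*} {l : Filter ι} {w : ι → Lp ℝ 2 μ}
    {a : Lp ℝ 2 μ} (hw : Tendsto w l (𝓝 a)) (ha : ∀ᵐ x ∂μ, a x ∈ I)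
    (hwI : ∀ i, ∀ᵐ x ∂μ, w i x ∈ I) :
    Tendsto (fun i => ∫ x, θ (w i x) ∂μ) l (𝓝 (∫ x, θ (a x) ∂μ)) := by
  set G := (h.memLp_deriv a ha).toLp
  have h0 : Tendsto (fun i => w i - a) l (𝓝 0) := by simpa using hw.sub_const a
  have h1 : Tendsto (fun i => K * ‖w i - a‖ ^ 2) l (𝓝 0) := by
    simpa using ((h0.norm.pow 2).const_mul K)
  have h2 : Tendsto (fun i => inner ℝ G (w i - a)) l (𝓝 0) := by
    simpa using (tendsto_const_nhds (x := G)).inner h0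
  have h3 : Tendsto (fun i => ∫ x, θ (w i x) ∂μ - ∫ x, θ (a x) ∂μ - inner ℝ G (w i - a)) l (𝓝 0) :=
    squeeze_zero_norm (fun i => (h.abs_integral_sub_le a (w i) ha (hwI i))) h1
  have h4 := (h3.add h2).add_const (∫ x, θ (a x) ∂μ)
  simpa using h4

theorem hasDerivAt (h : QuadraticTaylor I θ θ' K) {w : ℝ → Lp ℝ 2 μ} {d : Lp ℝ 2 μ} {t : ℝ}
    (hw : HasDerivAt w d t) (hwI : ∀ s, ∀ᵐ x ∂μ, w s x ∈ I) :
    HasDerivAt (fun s => ∫ x, θ (w s x) ∂μ) (∫ x, θ' (w t x) * d x ∂μ) t := by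
  have e : ∫ x, θ' (w t x) * d x ∂μ = inner ℝ ((h.memLp_deriv (w t) (hwI t)).toLp) d := by
    rw [L2.inner_def]
    refine integral_congr_ae ?_
    filter_upwards [(h.memLp_deriv (w t) (hwI t)).coeFn_toLp] with x hx
    rw [hx]; simp [mul_comm]
  rw [e]
  set G := (h.memLp_deriv (w t) (hwI t)).toLp
  have h1 : HasDerivAt (fun s => inner ℝ G (w s - w t)) (inner ℝ G d) t := by
    have := (hasDerivAt_const t G).inner ℝ (hw.sub_const (w t))
    simpa using this
  have h2 : HasDerivAt (fun s => ∫ x, θ (w s x) ∂μ - ∫ x, θ (w t x) ∂μ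
      - inner ℝ G (w s - w t)) 0 t := by
    rw [hasDerivAt_iff_isLittleO]
    have hO : (fun s => ∫ x, θ (w s x) ∂μ - ∫ x, θ (w t x) ∂μ - inner ℝ G (w s - w t))
        =O[𝓝 t] fun s => (s - t) ^ 2 := by
      have b1 : (fun s => ∫ x, θ (w s x) ∂μ - ∫ x, θ (w t x) ∂μ - inner ℝ G (w s - w t))
          =O[𝓝 t] fun s => ‖w s - w t‖ ^ 2 :=
        Asymptotics.IsBigO.of_bound K (Eventually.of_forall fun s => by
          simpa using h.abs_integral_sub_le (w t) (w s) (hwI t) (hwI s))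
      exact b1.trans ((hw.isBigO_sub.norm_left).pow 2)
    have ho : (fun s : ℝ => (s - t) ^ 2) =o[𝓝 t] fun s => s - t := by
      have h0 : Tendsto (fun s : ℝ => s - t) (𝓝 t) (𝓝 0) := by
        have : Continuous fun s : ℝ => s - t := by fun_prop
        simpa using this.tendsto t
      have := ((Asymptotics.isLittleO_one_iff ℝ).2 h0).mul_isBigO
        (Asymptotics.isBigO_refl (fun s : ℝ => s - t) (𝓝 t))
      simpa [pow_two] using this
    simpa using hO.trans_isLittleO ho
  have h3 := (h2.add h1).add_const (∫ x, θ (w t x) ∂μ)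
  simpa using h3

end QuadraticTaylor

theorem antitoneOn_of_hasDerivAt_nonpos {F F' : ℝ → ℝ} (hc : ContinuousOn F (Ici 0))
    (hd : ∀ t, 0 < t → HasDerivAt F (F' t) t) (hF : ∀ t, 0 < t → F' t ≤ 0) :
    AntitoneOn F (Ici 0) := by
  refine antitoneOn_of_deriv_nonpos (convex_Ici 0) hc ?_ ?_
  · rw [interior_Ici]
    exact fun t ht => (hd t ht).differentiableAt.differentiableWithinAt
  · rw [interior_Ici]
    intro t ht
    rw [(hd t ht).deriv]
    exact hF t ht

theorem antitoneOn_norm {E : Type*} [NormedAddCommGroup E] [InnerProductSpace ℝ E] {w w' : ℝ → E}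
    (hc : ContinuousOn w (Ici 0)) (hd : ∀ t, 0 < t → HasDerivAt w (w' t) t)
    (hF : ∀ t, 0 < t → inner ℝ (w' t) (w t) ≤ 0) : AntitoneOn (fun t => ‖w t‖) (Ici 0) := by
  have h : AntitoneOn (fun t => ‖w t‖ ^ 2) (Ici 0) := by
    refine antitoneOn_of_hasDerivAt_nonpos (F' := fun t => 2 * inner ℝ (w t) (w' t))
      (hc.norm.pow 2) (fun t ht => (hd t ht).norm_sq) fun t ht => ?_
    have := hF t ht
    rw [real_inner_comm] at this
    linarith
  intro s hs t ht hst
  exact (sq_le_sq₀ (norm_nonneg _) (norm_nonneg _)).1 (h hs ht hst)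

end Functional

/-! ### Truncation at height `M`. -/

section Clamp

/-- Truncation to `[-M, M]`. -/
noncomputable def clamp (M a : ℝ) : ℝ := max (-M) (min M a)

theorem clamp_cases {M : ℝ} (hM : 0 ≤ M) (a : ℝ) :
    (a ≤ -M ∧ clamp M a = -M) ∨ (-M ≤ a ∧ a ≤ M ∧ clamp M a = a) ∨ (M ≤ a ∧ clamp M a = M) := by
  unfold clamp
  rcases le_total a (-M) with h | h
  · exact Or.inl ⟨h, by rw [min_eq_right (by linarith), max_eq_left h]⟩
  · rcases le_total a M with h' | h'
    · exact Or.inr (Or.inl ⟨h, h', by rw [min_eq_right h', max_eq_right h]⟩)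
    · exact Or.inr (Or.inr ⟨h', by rw [min_eq_left h', max_eq_right (by linarith)]⟩)

theorem continuous_clamp (M : ℝ) : Continuous (clamp M) := by unfold clamp; fun_prop

theorem abs_clamp_le {M : ℝ} (hM : 0 ≤ M) (a : ℝ) : |clamp M a| ≤ M := by
  rw [abs_le]
  rcases clamp_cases hM a with h | h | h <;> constructor <;> linarith [h.2]

theorem abs_clamp_le_abs {M : ℝ} (hM : 0 ≤ M) (a : ℝ) : |clamp M a| ≤ |a| := by
  rcases clamp_cases hM a with ⟨h, h'⟩ | ⟨h, h', h''⟩ | ⟨h, h'⟩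
  · rw [h', abs_neg, abs_of_nonneg hM, abs_of_nonpos (by linarith)]; linarith
  · rw [h'']
  · rw [h', abs_of_nonneg hM, abs_of_nonneg (by linarith)]; linarith

theorem abs_clamp_sub_le {M : ℝ} (hM : 0 ≤ M) (a b : ℝ) : |clamp M a - clamp M b| ≤ |a - b| := by
  rw [abs_le]
  rcases clamp_cases hM a with h | h | h <;> rcases clamp_cases hM b with h' | h' | h' <;>
    constructor <;> cases abs_cases (a - b) <;> linarith [h.2, h'.2]

theorem clamp_eq_self {M a : ℝ} (h : |a| ≤ M) : clamp M a = a := by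
  rw [abs_le] at h
  rw [clamp, min_eq_right h.2, max_eq_right h.1]

theorem quadraticTaylor_clamp {M : ℝ} (hM : 0 ≤ M) :
    QuadraticTaylor univ (fun a => 2⁻¹ * (a - clamp M a) ^ 2) (fun a => a - clamp M a) 1 := by
  have hc := continuous_clamp M
  refine ⟨by fun_prop, by fun_prop, fun a _ => ?_, fun a _ => ?_, fun a _ b _ => ?_⟩
  · rw [abs_of_nonneg (by positivity)]
    rcases clamp_cases hM a with ⟨h, h'⟩ | ⟨h, h', h''⟩ | ⟨h, h'⟩ <;> simp only [*] <;> nlinarith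
  · rcases clamp_cases hM a with ⟨h, h'⟩ | ⟨h, h', h''⟩ | ⟨h, h'⟩
    · rw [h', abs_of_nonpos (by linarith), abs_of_nonpos (by linarith)]; linarith
    · rw [h'']; simp
    · rw [h', abs_of_nonneg (by linarith), abs_of_nonneg (by linarith)]; linarith
  · rw [abs_le]
    rcases clamp_cases hM a with h | h | h <;> rcases clamp_cases hM b with h' | h' | h' <;>
      simp only [h.2, h'.2] <;> constructor <;>
      nlinarith [h.1, h'.1, h.2, h'.2, sq_nonneg (b - a), sq_nonneg (a - M), sq_nonneg (b - M),
        sq_nonneg (a + M), sq_nonneg (b + M)]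

/-- As `clamp M` is 1-Lipschitz, `a - clamp M a` is nondecreasing in `a`. Hence `𝓔(u, u - clamp M u)
≥ 0`, the sign behind the `L^∞` bound. -/
theorem sub_clamp_mono {M : ℝ} (hM : 0 ≤ M) (a b : ℝ) :
    0 ≤ (a - b) * ((a - clamp M a) - (b - clamp M b)) := by
  have h1 := abs_clamp_sub_le hM a b
  have h2 : (a - b) * (clamp M a - clamp M b) ≤ (a - b) * (a - b) := by
    rw [← abs_mul_abs_self (a - b)]
    calc _ ≤ |(a - b) * (clamp M a - clamp M b)| := le_abs_self _
      _ = |a - b| * |clamp M a - clamp M b| := abs_mul _ _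
      _ ≤ _ := by gcongr
  nlinarith

end Clamp

/-! ### Contraction properties of mild solutions. -/

section MildSolution

variable {N : ℕ} {J : RN N → RN N → ℝ} {u₀ v₀ : Lp ℝ 2 (volume : Measure (RN N))}
  {u v : ℝ → Lp ℝ 2 (volume : Measure (RN N))}

namespace IsMildSolution

theorem hasDerivAt (h : IsMildSolution J u₀ u) {t : ℝ} (ht : 0 < t) :
    HasDerivAt u (deriv u t) t :=
  (((h.contDiffOn.differentiableOn (by simp)) t ht).differentiableAt
    (Ioi_mem_nhds ht)).hasDerivAt

theorem realForm_eq (h : IsMildSolution J u₀ u) (hJ : IsLevyKernel J) {t : ℝ} (ht : 0 < t)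
    (g : Lp ℝ 2 (volume : Measure (RN N))) (hg : MemEnergySpace J g) :
    realForm J (u t) g = -inner ℝ (deriv u t) g := by
  have := h.equation t ht g hg
  rw [dirichletForm_eq_coe hJ (integrable_incr_mul hJ (h.memEnergySpace t ht) hg)] at this
  exact_mod_cast this

theorem realForm_eq_integral (h : IsMildSolution J u₀ u) (hJ : IsLevyKernel J) {t : ℝ} (ht : 0 < t)
    {g : RN N → ℝ} (hg : MemEnergySpace J g) :
    realForm J (u t) g = -∫ x, g x * deriv u t x := by
  have hg' : MemEnergySpace J hg.1.toLp := hg.congr hJ hg.1.coeFn_toLp.symm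
  rw [realForm_congr (EventuallyEq.refl _ _) hg.1.coeFn_toLp.symm, h.realForm_eq hJ ht _ hg',
    L2.inner_def]
  congr 1
  refine integral_congr_ae ?_
  filter_upwards [hg.1.coeFn_toLp] with x hx
  rw [hx]; simp

/-- Testing the equation for `u - v` with `u - v` itself gives `⟨u' - v', u - v⟩ = -𝓔(u - v, u - v)
≤ 0`. -/
theorem antitoneOn_norm_sub (hu : IsMildSolution J u₀ u) (hv : IsMildSolution J v₀ v)
    (hJ : IsLevyKernel J) : AntitoneOn (fun t => ‖u t - v t‖) (Ici 0) := by
  refine antitoneOn_norm (hu.continuousOn.sub hv.continuousOn)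
    (fun t ht => (hu.hasDerivAt ht).sub (hv.hasDerivAt ht)) fun t ht => ?_
  have hm : MemEnergySpace J (⇑(u t) - ⇑(v t)) :=
    (hu.memEnergySpace t ht).sub hJ (hv.memEnergySpace t ht)
  have e := Lp.coeFn_sub (u t) (v t)
  have hm' : MemEnergySpace J (u t - v t : Lp ℝ 2 (volume : Measure (RN N))) := hm.congr hJ e.symm
  have h1 := hu.realForm_eq hJ ht _ hm'
  have h2 := hv.realForm_eq hJ ht _ hm'
  have h3 := realForm_sub_left hJ (hu.memEnergySpace t ht) (hv.memEnergySpace t ht) hm'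
  have h4 := realForm_self_nonneg (J := J) (⇑(u t) - ⇑(v t))
  rw [← realForm_congr (EventuallyEq.refl _ _) e] at h4
  rw [inner_sub_left]
  linarith

theorem antitoneOn_norm (hu : IsMildSolution J u₀ u) (hJ : IsLevyKernel J) :
    AntitoneOn (fun t => ‖u t‖) (Ici 0) := by
  refine StrongHyper.antitoneOn_norm hu.continuousOn (fun t ht => hu.hasDerivAt ht) fun t ht => ?_
  have h1 := hu.realForm_eq hJ ht _ (hu.memEnergySpace t ht)
  have h4 := realForm_self_nonneg (J := J) (u t)
  linarith

theorem norm_sub_le (hu : IsMildSolution J u₀ u) (hv : IsMildSolution J v₀ v)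
    (hJ : IsLevyKernel J) {t : ℝ} (ht : 0 ≤ t) : ‖u t - v t‖ ≤ ‖u₀ - v₀‖ := by
  have := hu.antitoneOn_norm_sub hv hJ self_mem_Ici ht ht
  simpa [hu.initial, hv.initial] using this

theorem tendsto_zero (hu : IsMildSolution J u₀ u) : Tendsto u (𝓝[>] 0) (𝓝 u₀) := by
  rw [← hu.initial]
  exact (hu.continuousOn 0 self_mem_Ici).mono_left (nhdsWithin_mono _ Ioi_subset_Ici_self)

/-- The `L^∞` bound of the initial datum is preserved. -/
theorem abs_le (hu : IsMildSolution J u₀ u) (hJ : IsLevyKernel J) {M : ℝ} (hM : 0 ≤ M)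
    (h0 : ∀ᵐ x, |u₀ x| ≤ M) {t : ℝ} (ht : 0 ≤ t) : ∀ᵐ x, |u t x| ≤ M := by
  have hq := quadraticTaylor_clamp hM
  have hmem : ∀ s, ∀ᵐ x, u s x ∈ univ := fun s => Eventually.of_forall fun _ => mem_univ _
  -- Stampacchia's method: the derivative of this excess is `-𝓔(u, u - clamp M u) ≤ 0`, and the
  -- excess vanishes at time zero, hence always.
  have hanti : AntitoneOn (fun s => ∫ x, 2⁻¹ * (u s x - clamp M (u s x)) ^ 2) (Ici 0) := by
    refine antitoneOn_of_hasDerivAt_nonpos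
      (fun s hs => hq.tendsto (hu.continuousOn s hs) (hmem s) hmem)
      (fun s hs => hq.hasDerivAt (hu.hasDerivAt hs) hmem) fun s hs => ?_
    have hm : MemEnergySpace J fun x => u s x - clamp M (u s x) := by
      refine (hu.memEnergySpace s hs).of_lipschitz (K := 2) hJ ?_ ?_ ?_
      · have := Lp.aestronglyMeasurable (u s)
        exact this.sub ((continuous_clamp M).comp_aestronglyMeasurable this)
      · refine Eventually.of_forall fun x => ?_
        have := abs_clamp_le_abs hM (u s x)
        have := abs_sub (u s x) (clamp M (u s x))
        linarith
      · refine Eventually.of_forall fun z => ?_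
        have h1 := abs_clamp_sub_le hM (u s z.1) (u s z.2)
        have h2 := abs_sub (u s z.1 - u s z.2) (clamp M (u s z.1) - clamp M (u s z.2))
        have e : incr (fun x => u s x - clamp M (u s x)) z
          = (u s z.1 - u s z.2) - (clamp M (u s z.1) - clamp M (u s z.2)) := by
          simp [incr]; ring
        rw [e]
        simp only [incr]
        linarith
    have h1 := hu.realForm_eq_integral hJ hs hm
    have h2 : 0 ≤ realForm J (u s) fun x => u s x - clamp M (u s x) :=
      integral_nonneg fun z => sub_clamp_mono hM _ _
    linarith
  have h1 := hanti self_mem_Ici ht ht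
  have h2 : ∫ x, 2⁻¹ * (u 0 x - clamp M (u 0 x)) ^ 2 = 0 := by
    rw [hu.initial]
    refine integral_eq_zero_of_ae ?_
    filter_upwards [h0] with x hx
    simp [clamp_eq_self hx]
  simp only [h2] at h1
  have h3 : ∫ x, 2⁻¹ * (u t x - clamp M (u t x)) ^ 2 = 0 :=
    le_antisymm h1 (integral_nonneg fun x => by positivity)
  rw [integral_eq_zero_iff_of_nonneg (fun x => by positivity) (hq.integrable _ (hmem t))] at h3
  filter_upwards [h3] with x hx
  have : u t x = clamp M (u t x) := by
    simp only [Pi.zero_apply, mul_eq_zero, pow_eq_zero_iff, ne_eq, OfNat.ofNat_ne_zero,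
      not_false_eq_true] at hx
    rcases hx with h | h
    · norm_num at h
    · linarith
  rw [this]
  exact abs_clamp_le hM _

end IsMildSolution

end MildSolution

end StrongHyper

namespace StrongHyper

/-! ### Inequalities for powers, for `s log s` and for the two-sided cutoff. -/

section Elementary

/-- Convexity, via Bernoulli's inequality for `|y| / x`. The sign of `y` is left free because it
will be a value of the solution, whose positivity is never established. -/
theorem rpow_tangent_le {r x y : ℝ} (hr : 1 < r) (hx : 0 ≤ x) :
    x ^ r + r * x ^ (r - 1) * (y - x) ≤ |y| ^ r := by
  rcases hx.eq_or_lt with rfl | hx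
  · rw [Real.zero_rpow (by linarith), Real.zero_rpow (by linarith)]
    simp only [mul_zero, zero_mul, add_zero]
    positivity
  · have h1 := one_add_mul_self_le_rpow_one_add (s := |y| / x - 1) (p := r)
      (by have : 0 ≤ |y| / x := by positivity
          linarith) hr.le
    have h2 : x ^ r * (1 + r * (|y| / x - 1)) ≤ |y| ^ r := by
      calc _ ≤ x ^ r * (1 + (|y| / x - 1)) ^ r := by gcongr
        _ = |y| ^ r := by
          rw [← Real.mul_rpow hx.le (by simp; positivity)]
          congr 1
          field_simp
          ring
    have h3 : x ^ r = x ^ (r - 1) * x := by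
      rw [← Real.rpow_add_one hx.ne']; simp
    have h4 : r * x ^ (r - 1) * (y - x) ≤ r * x ^ (r - 1) * (|y| - x) := by
      gcongr; exact le_abs_self y
    have h5 : x ^ r * (1 + r * (|y| / x - 1)) = x ^ r + r * x ^ (r - 1) * (|y| - x) := by
      rw [h3]; field_simp
    linarith

theorem rpow_tangent_le_of_nonneg {r x y : ℝ} (hr : 1 ≤ r) (hx : 0 ≤ x) (hy : 0 ≤ y) :
    x ^ r + r * x ^ (r - 1) * (y - x) ≤ y ^ r := by
  rcases hr.eq_or_lt with rfl | hr
  · simp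
  · simpa [abs_of_nonneg hy] using rpow_tangent_le (y := y) hr hx

theorem abs_rpow_sub_rpow_le {r M a b : ℝ} (hr : 1 ≤ r) (ha : 0 ≤ a) (hb : 0 ≤ b) (haM : a ≤ M)
    (hbM : b ≤ M) : |a ^ r - b ^ r| ≤ r * M ^ (r - 1) * |a - b| := by
  wlog h : b ≤ a generalizing a b
  · rw [abs_sub_comm, abs_sub_comm a]
    exact this hb ha hbM haM (le_of_not_ge h)
  have h1 := rpow_tangent_le_of_nonneg hr ha hb
  have h2 : b ^ r ≤ a ^ r := Real.rpow_le_rpow hb h (by linarith)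
  rw [abs_of_nonneg (by linarith), abs_of_nonneg (by linarith)]
  calc a ^ r - b ^ r ≤ r * a ^ (r - 1) * (a - b) := by linarith
    _ ≤ r * M ^ (r - 1) * (a - b) := by gcongr

theorem rpow_add_sub_rpow_mono {r x y d : ℝ} (hr : 1 ≤ r) (hx : 0 ≤ x) (hxy : x ≤ y) (hd : 0 ≤ d) :
    (x + d) ^ r - x ^ r ≤ (y + d) ^ r - y ^ r := by
  have h : MonotoneOn (fun s : ℝ => (s + d) ^ r - s ^ r) (Ici 0) := by
    have hder : ∀ s : ℝ, HasDerivAt (fun s : ℝ => (s + d) ^ r - s ^ r)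
        (r * (s + d) ^ (r - 1) - r * s ^ (r - 1)) s := fun s => by
      have h1 := ((hasDerivAt_id s).add_const d).rpow_const (p := r) (Or.inr hr)
      have h2 := Real.hasDerivAt_rpow_const (x := s) (p := r) (Or.inr hr)
      exact (h1.sub h2).congr_deriv (by simp)
    refine monotoneOn_of_deriv_nonneg (convex_Ici 0)
      (fun s _ => (hder s).continuousAt.continuousWithinAt)
      (fun s _ => (hder s).differentiableAt.differentiableWithinAt) fun s hs => ?_
    rw [interior_Ici] at hs
    rw [(hder s).deriv, ← mul_sub]
    have hs' : 0 ≤ s := le_of_lt hs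
    have : s ^ (r - 1) ≤ (s + d) ^ (r - 1) :=
      Real.rpow_le_rpow hs' (by linarith) (by linarith)
    exact mul_nonneg (by linarith) (by linarith)
  exact h hx (hx.trans hxy) hxy

/-- `(a^(p-1) - b^(p-1)) (a - b) ≤ (a^(p/2) - b^(p/2))²`. -/
theorem rpow_sub_mul_sub_le {p a b : ℝ} (hp : 2 ≤ p) (ha : 0 ≤ a) (hb : 0 ≤ b) :
    (a ^ (p - 1) - b ^ (p - 1)) * (a - b) ≤ (a ^ (p / 2) - b ^ (p / 2)) ^ 2 := by
  have key : ∀ c : ℝ, 0 ≤ c → c ^ (p - 1) = c ^ (p / 2) * c ^ (p / 2 - 1) := fun c hc => by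
    rw [← Real.rpow_add_of_nonneg hc (by linarith) (by linarith)]; congr 1; ring
  have key2 : ∀ c : ℝ, 0 ≤ c → c ^ (p / 2) = c * c ^ (p / 2 - 1) := fun c hc => by
    nth_rw 2 [← Real.rpow_one c]
    rw [← Real.rpow_add_of_nonneg hc (by linarith) (by linarith)]; congr 1; ring
  -- This is exactly the difference of the two sides.
  have hm : 0 ≤ a * b * (a ^ (p / 2 - 1) - b ^ (p / 2 - 1)) ^ 2 := by positivity
  rw [key a ha, key b hb, key2 a ha, key2 b hb]
  nlinarith [hm]

theorem rpow_sub_mul_sub_nonneg {r a b : ℝ} (hr : 0 ≤ r) (ha : 0 ≤ a) (hb : 0 ≤ b) :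
    0 ≤ (a ^ r - b ^ r) * (a - b) := by
  rcases le_total a b with h | h
  · exact mul_nonneg_of_nonpos_of_nonpos (by linarith [Real.rpow_le_rpow ha h hr]) (by linarith)
  · exact mul_nonneg (by linarith [Real.rpow_le_rpow hb h hr]) (by linarith)

theorem neg_entFun_le_one {s : ℝ} (hs : 0 ≤ s) : -entFun s ≤ 1 := by
  rcases hs.eq_or_lt with rfl | hs
  · simp [entFun]
  · have h := Real.log_le_sub_one_of_pos (inv_pos.2 hs)
    rw [Real.log_inv] at h
    have : s * s⁻¹ = 1 := mul_inv_cancel₀ hs.ne'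
    unfold entFun
    nlinarith

theorem entFun_le_sq {s : ℝ} (hs : 0 ≤ s) : entFun s ≤ s ^ 2 := by
  rcases hs.eq_or_lt with rfl | hs
  · simp [entFun]
  · have h := Real.log_le_sub_one_of_pos hs
    unfold entFun
    nlinarith

theorem entFun_nonpos {s : ℝ} (hs : 0 ≤ s) (h1 : s ≤ 1) : entFun s ≤ 0 :=
  mul_nonpos_of_nonneg_of_nonpos hs (Real.log_nonpos hs h1)

/-- `|s log s|` is not monotone, but the correction `t` restores domination. It provides the
majorant for dominated convergence of the entropies of truncated functions. -/
theorem abs_entFun_le {s t : ℝ} (hs : 0 ≤ s) (hst : s ≤ t) : |entFun s| ≤ |entFun t| + t := by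
  rcases hs.eq_or_lt with rfl | hs
  · simp only [entFun, zero_mul, abs_zero]; positivity
  have ht : 0 < t := hs.trans_le hst
  rw [abs_le]
  constructor
  · have h1 : s * Real.log t ≤ |entFun t| := by
      calc s * Real.log t ≤ s * |Real.log t| := by gcongr; exact le_abs_self _
        _ ≤ t * |Real.log t| := by gcongr
        _ = |entFun t| := by rw [entFun, abs_mul, abs_of_pos ht]
    have h1' : s * (-Real.log t) ≤ |entFun t| := by
      calc s * (-Real.log t) ≤ s * |Real.log t| := by gcongr; exact neg_le_abs _
        _ ≤ t * |Real.log t| := by gcongr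
        _ = |entFun t| := by rw [entFun, abs_mul, abs_of_pos ht]
    have h2 := Real.log_le_sub_one_of_pos (div_pos ht hs)
    rw [Real.log_div ht.ne' hs.ne'] at h2
    have h3 : s * (t / s) = t := by field_simp
    unfold entFun at *
    nlinarith
  · rcases le_total s 1 with h | h
    · linarith [entFun_nonpos hs.le h, abs_nonneg (entFun t)]
    · have : entFun s ≤ entFun t := by
        unfold entFun
        have := Real.log_nonneg h
        have := Real.log_le_log hs hst
        gcongr
      linarith [le_abs_self (entFun t)]

theorem continuous_entFun : Continuous entFun := Real.continuous_mul_log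

/-- The truncation `min s M - min s ε`. -/
noncomputable def cutoff (ε M s : ℝ) : ℝ := min s M - min s ε

theorem continuous_cutoff (ε M : ℝ) : Continuous (cutoff ε M) := by unfold cutoff; fun_prop

variable {ε M a b : ℝ}

theorem cutoff_nonneg (hεM : ε ≤ M) (a : ℝ) : 0 ≤ cutoff ε M a :=
  sub_nonneg.2 (min_le_min_left a hεM)

theorem cutoff_le (hε : 0 ≤ ε) (ha : 0 ≤ a) : cutoff ε M a ≤ a := by
  have := min_le_left a M
  have := le_min ha hε
  unfold cutoff; linarith

theorem cutoff_le_bound (hε : 0 ≤ ε) (ha : 0 ≤ a) : cutoff ε M a ≤ M := by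
  have := min_le_right a M
  have := le_min ha hε
  unfold cutoff; linarith

theorem cutoff_eq_zero (hεM : ε ≤ M) (ha : a ≤ ε) : cutoff ε M a = 0 := by
  rw [cutoff, min_eq_left (ha.trans hεM), min_eq_left ha, sub_self]

theorem cutoff_mono (hεM : ε ≤ M) (hab : b ≤ a) : cutoff ε M b ≤ cutoff ε M a := by
  unfold cutoff
  rcases min_cases a M with h | h <;> rcases min_cases b M with h' | h' <;>
    rcases min_cases a ε with h'' | h'' <;> rcases min_cases b ε with h''' | h''' <;> linarith

theorem cutoff_sub_le (hεM : ε ≤ M) (hab : b ≤ a) :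
    cutoff ε M a - cutoff ε M b ≤ max a ε - max b ε := by
  unfold cutoff
  rcases min_cases a M with h | h <;> rcases min_cases b M with h' | h' <;>
    rcases min_cases a ε with h'' | h'' <;> rcases min_cases b ε with h''' | h''' <;>
    rcases max_cases a ε with k | k <;> rcases max_cases b ε with k' | k' <;> linarith

theorem max_sub_max_le (hab : b ≤ a) : max a ε - max b ε ≤ a - b := by
  rcases max_cases a ε with k | k <;> rcases max_cases b ε with k' | k' <;> linarith

/-- The cutoff is constant below `ε` and has slope at most one above, where `s^r` has slope at least
`ε^(r-1)`. Being a Lipschitz function of `s^r`, the cutoff of `g` inherits finite energy from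
`g^(p/2)`. -/
theorem abs_cutoff_sub_le {r : ℝ} (hε : 0 < ε) (hεM : ε ≤ M) (hr : 1 ≤ r) (ha : 0 ≤ a)
    (hb : 0 ≤ b) :
    |cutoff ε M a - cutoff ε M b| ≤ (ε ^ (r - 1))⁻¹ * |a ^ r - b ^ r| := by
  wlog h : b ≤ a generalizing a b
  · rw [abs_sub_comm, abs_sub_comm (a ^ r)]
    exact this hb ha (le_of_not_ge h)
  have hε' : 0 < ε ^ (r - 1) := Real.rpow_pos_of_pos hε _
  have h2 : b ^ r ≤ a ^ r := Real.rpow_le_rpow hb h (by linarith)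
  rw [abs_of_nonneg (by linarith [cutoff_mono hεM h]), abs_of_nonneg (by linarith),
    inv_mul_eq_div, le_div_iff₀ hε']
  have h3 := cutoff_sub_le hεM h
  rcases le_total a ε with h4 | h4
  · rw [max_eq_right h4, max_eq_right (h.trans h4)] at h3
    nlinarith
  · rw [max_eq_left h4] at h3
    set c := max b ε
    have hc : ε ≤ c := le_max_right _ _
    have hc0 : 0 ≤ c := hε.le.trans hc
    have hca : c ≤ a := max_le h h4
    have h5 := rpow_tangent_le_of_nonneg hr hc0 ha
    have h6 : b ^ r ≤ c ^ r := Real.rpow_le_rpow hb (le_max_left _ _) (by linarith)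
    have h7 : ε ^ (r - 1) ≤ c ^ (r - 1) := Real.rpow_le_rpow hε.le hc (by linarith)
    have h8 : 0 ≤ c ^ (r - 1) := by positivity
    calc (cutoff ε M a - cutoff ε M b) * ε ^ (r - 1) ≤ (a - c) * ε ^ (r - 1) := by gcongr
      _ ≤ (a - c) * c ^ (r - 1) := by
          have : 0 ≤ a - c := by linarith
          gcongr
      _ ≤ r * c ^ (r - 1) * (a - c) := by
          have : 0 ≤ (a - c) * c ^ (r - 1) := mul_nonneg (by linarith) h8
          nlinarith
      _ ≤ a ^ r - b ^ r := by linarith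

/-- The cutoff is nondecreasing, 1-Lipschitz and below the identity. Increments of the convex
function `s^r` shrink when the base point moves down or the step shortens, so both factors decrease.
-/
theorem cutoff_form_le {r : ℝ} (hε : 0 ≤ ε) (hεM : ε ≤ M) (hr : 1 ≤ r) (ha : 0 ≤ a)
    (hb : 0 ≤ b) :
    (cutoff ε M a ^ r - cutoff ε M b ^ r) * (cutoff ε M a - cutoff ε M b)
      ≤ (a ^ r - b ^ r) * (a - b) := by
  wlog h : b ≤ a generalizing a b
  · have := this hb ha (le_of_not_ge h)
    linarith
  have h1 : cutoff ε M a - cutoff ε M b ≤ a - b := (cutoff_sub_le hεM h).trans (max_sub_max_le h)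
  have h2 := cutoff_mono hεM h
  have hb0 := cutoff_nonneg hεM b
  have h3 := rpow_add_sub_rpow_mono hr hb0 (cutoff_le (M := M) hε hb)
    (sub_nonneg.2 h2)
  have h4 : (b + (cutoff ε M a - cutoff ε M b)) ^ r ≤ a ^ r :=
    Real.rpow_le_rpow (by linarith) (by linarith) (by linarith)
  have h5 : cutoff ε M b + (cutoff ε M a - cutoff ε M b) = cutoff ε M a := by ring
  rw [h5] at h3
  have h6 : b ^ r ≤ a ^ r := Real.rpow_le_rpow hb h (by linarith)
  apply mul_le_mul (by linarith) h1 (by linarith) (by linarith)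

end Elementary

end StrongHyper

namespace StrongHyper

/-! ### Reduction of the logarithmic Sobolev inequality to test functions. -/

section Truncation

variable {N : ℕ} {J : RN N → RN N → ℝ}

/-- Nonnegative functions of finite energy, bounded by `M` and supported in a set of finite
measure. -/
structure IsTestFunction (J : RN N → RN N → ℝ) (M : ℝ) (f : RN N → ℝ) : Prop where
  nonneg : ∀ x, 0 ≤ f x
  le : ∀ x, f x ≤ M
  measure_lt : volume {x | f x ≠ 0} < ∞
  mem : MemEnergySpace J f

theorem IsTestFunction.integrable_comp {M : ℝ} {f : RN N → ℝ} (hf : IsTestFunction J M f)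
    {φ : ℝ → ℝ} (hφ : Measurable φ) (hc : ContinuousOn φ (Icc 0 M)) (h0 : φ 0 = 0) :
    Integrable (fun x => φ (f x)) := by
  obtain ⟨K, hK⟩ := isCompact_Icc.exists_bound_of_continuousOn hc
  have hs : Function.support (fun x => φ (f x)) ⊆ {x | f x ≠ 0} := by
    intro x hx hfx
    exact hx (by simp only [hfx, h0])
  rw [← integrableOn_iff_integrable_of_support_subset hs]
  refine Measure.integrableOn_of_bounded (M := K) hf.measure_lt.ne
    (hφ.comp_aemeasurable hf.mem.1.aestronglyMeasurable.aemeasurable).aestronglyMeasurable ?_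
  exact Eventually.of_forall fun x => hK _ ⟨hf.nonneg x, hf.le x⟩

theorem IsTestFunction.integrable_rpow {M r : ℝ} {f : RN N → ℝ} (hf : IsTestFunction J M f)
    (hr : 0 < r) : Integrable (fun x => f x ^ r) :=
  hf.integrable_comp (φ := fun s => s ^ r) (by fun_prop)
    (Real.continuous_rpow_const hr.le).continuousOn (Real.zero_rpow hr.ne')

theorem IsTestFunction.integrable_entFun {M r : ℝ} {f : RN N → ℝ} (hf : IsTestFunction J M f)
    (hr : 0 < r) : Integrable (fun x => entFun (f x ^ r)) :=
  hf.integrable_comp (φ := fun s => entFun (s ^ r))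
    (continuous_entFun.comp (Real.continuous_rpow_const hr.le)).measurable
    (continuous_entFun.comp (Real.continuous_rpow_const hr.le)).continuousOn
    (by simp [entFun, Real.zero_rpow hr.ne'])

variable {p ε M : ℝ} {g : RN N → ℝ}

theorem integrable_rpow_of_memEnergySpace (hg : ∀ x, 0 ≤ g x)
    (hE : MemEnergySpace J fun x => g x ^ (p / 2)) : Integrable (fun x => g x ^ p) := by
  refine hE.1.integrable_sq.congr (Eventually.of_forall fun x => ?_)
  simp only
  rw [← Real.rpow_natCast, ← Real.rpow_mul (hg x)]
  congr 1
  push_cast; ring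

theorem isTestFunction_cutoff (hJ : IsLevyKernel J) (hp : 2 ≤ p)
    (hgm : AEStronglyMeasurable g volume) (hg : ∀ x, 0 ≤ g x)
    (hE : MemEnergySpace J fun x => g x ^ (p / 2)) (hε : 0 < ε) (hεM : ε ≤ M) :
    IsTestFunction J M fun x => cutoff ε M (g x) := by
  refine ⟨fun x => cutoff_nonneg hεM _, fun x => cutoff_le_bound hε.le (hg x), ?_, ?_⟩
  · have hi := integrable_rpow_of_memEnergySpace hg hE
    refine lt_of_le_of_lt (measure_mono fun x hx => ?_)
      (hi.measure_norm_ge_lt_top (ε := ε ^ p) (Real.rpow_pos_of_pos hε _))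
    simp only [mem_ofPred_eq] at *
    rw [Real.norm_of_nonneg (Real.rpow_nonneg (hg x) _)]
    refine Real.rpow_le_rpow hε.le ?_ (by linarith)
    by_contra! h
    exact hx (cutoff_eq_zero hεM h.le)
  · refine hE.of_lipschitz (K := (ε ^ (p / 2 - 1))⁻¹) hJ
      ((continuous_cutoff ε M).comp_aestronglyMeasurable hgm) ?_ ?_
    · refine Eventually.of_forall fun x => ?_
      have h := abs_cutoff_sub_le hε hεM (r := p / 2) (by linarith) (hg x) le_rfl
      rw [cutoff_eq_zero hεM hε.le, Real.zero_rpow (by linarith)] at h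
      simpa using h
    · exact Eventually.of_forall fun z =>
        abs_cutoff_sub_le hε hεM (by linarith) (hg z.1) (hg z.2)

/-- The integrand lies between `0` and the squared increment of `g^(p/2)`, by `rpow_sub_mul_sub_le`.
-/
theorem integrable_form_rpow (hJ : IsLevyKernel J) (hp : 2 ≤ p)
    (hgm : AEStronglyMeasurable g volume) (hg : ∀ x, 0 ≤ g x)
    (hE : MemEnergySpace J fun x => g x ^ (p / 2)) :
    Integrable (fun z => incr (fun x => g x ^ (p - 1)) z * incr g z) (jumpMeasure J) := by
  refine (hE.memLp_incr hJ).integrable_sq.mono' ?_ (Eventually.of_forall fun z => ?_)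
  · have h1 : AEStronglyMeasurable (fun x => g x ^ (p - 1)) volume :=
      (Real.continuous_rpow_const (by linarith)).comp_aestronglyMeasurable hgm
    exact (aestronglyMeasurable_incr h1).mul (aestronglyMeasurable_incr hgm)
  · have h0 := rpow_sub_mul_sub_nonneg (r := p - 1) (by linarith) (hg z.1) (hg z.2)
    exact (Real.norm_of_nonneg h0).trans_le (rpow_sub_mul_sub_le hp (hg z.1) (hg z.2))

theorem realForm_cutoff_le (hJ : IsLevyKernel J) (hp : 2 ≤ p)
    (hgm : AEStronglyMeasurable g volume) (hg : ∀ x, 0 ≤ g x)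
    (hE : MemEnergySpace J fun x => g x ^ (p / 2)) (hε : 0 < ε) (hεM : ε ≤ M) :
    realForm J (fun x => cutoff ε M (g x) ^ (p - 1)) (fun x => cutoff ε M (g x))
      ≤ realForm J (fun x => g x ^ (p - 1)) g := by
  refine integral_mono_of_nonneg (Eventually.of_forall fun z => ?_)
    (integrable_form_rpow hJ hp hgm hg hE) (Eventually.of_forall fun z => ?_)
  · exact rpow_sub_mul_sub_nonneg (r := p - 1) (by linarith) (cutoff_nonneg hεM _)
      (cutoff_nonneg hεM _)
  · exact cutoff_form_le hε.le hεM (by linarith) (hg z.1) (hg z.2)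

/-- The energy of `|f|` is at most that of `f`. -/
theorem realForm_abs_le_dirichletForm (hJ : IsLevyKernel J) (hp : 2 ≤ p) {f : RN N → ℝ}
    (hfm : AEStronglyMeasurable f volume) (hE : MemEnergySpace J fun x => |f x| ^ (p / 2)) :
    ((realForm J (fun x => |f x| ^ (p - 1)) fun x => |f x| : ℝ) : EReal)
      ≤ dirichletForm J (fun x => |f x| ^ (p - 2) * f x) f := by
  have hi := integrable_form_rpow (g := fun x => |f x|) hJ hp hfm.norm (fun x => abs_nonneg _) hE
  -- The right side minus the left side is `(|a|^(p-2) + |b|^(p-2)) (|a| |b| - a b)`.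
  have key : ∀ a b : ℝ, (|a| ^ (p - 1) - |b| ^ (p - 1)) * (|a| - |b|)
      ≤ (|a| ^ (p - 2) * a - |b| ^ (p - 2) * b) * (a - b) := by
    intro a b
    have e : ∀ c : ℝ, |c| ^ (p - 1) = |c| ^ (p - 2) * |c| := fun c => by
      nth_rw 3 [← Real.rpow_one |c|]
      rw [← Real.rpow_add_of_nonneg (abs_nonneg c) (by linarith) zero_le_one]; congr 1; ring
    rw [e a, e b]
    have h1 : 0 ≤ |a| ^ (p - 2) := by positivity
    have h2 : 0 ≤ |b| ^ (p - 2) := by positivity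
    have h3 : a * b ≤ |a| * |b| := by rw [← abs_mul]; exact le_abs_self _
    have h4 := abs_mul_abs_self a
    have h5 := abs_mul_abs_self b
    nlinarith [mul_le_mul_of_nonneg_left h3 h1, mul_le_mul_of_nonneg_left h3 h2]
  have hnn : ∀ z : RN N × RN N, 0 ≤ incr (fun x => |f x| ^ (p - 2) * f x) z * incr f z := fun z =>
    (rpow_sub_mul_sub_nonneg (r := p - 1) (by linarith) (abs_nonneg _) (abs_nonneg _)).trans
      (key (f z.1) (f z.2))
  rw [dirichletForm_eq_lintegral hJ, ← dirichletForm_eq_coe hJ hi, dirichletForm_eq_lintegral hJ]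
  refine EReal.sub_le_sub ?_ ?_
  · exact EReal.coe_ennreal_le_coe_ennreal_iff.2
      (lintegral_mono fun z => ENNReal.ofReal_le_ofReal (key (f z.1) (f z.2)))
  · have : ∫⁻ z, ENNReal.ofReal (-(incr (fun x => |f x| ^ (p - 2) * f x) z * incr f z))
        ∂jumpMeasure J = 0 := by
      rw [lintegral_congr fun z => ENNReal.ofReal_of_nonpos (neg_nonpos.2 (hnn z))]
      simp
    rw [this]
    exact_mod_cast zero_le

variable {C D : ℝ}

/-- The positive part of `Φ(g^p)` is integrable, once the logarithmic Sobolev inequality holds for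
test functions. -/
theorem lintegral_entFun_lt_top (hJ : IsLevyKernel J) (hp : 2 ≤ p) (hD : 0 < D)
    (hgm : AEStronglyMeasurable g volume) (hg : ∀ x, 0 ≤ g x)
    (hE : MemEnergySpace J fun x => g x ^ (p / 2))
    (H : ∀ M f, IsTestFunction J M f → ∫ x, entFun (f x ^ p) ≤ entFun (∫ x, f x ^ p)
      + C * (∫ x, f x ^ p) + D * realForm J (fun x => f x ^ (p - 1)) f) :
    ∫⁻ x, ENNReal.ofReal (entFun (g x ^ p)) < ∞ := by
  have hp0 : 0 < p := by linarith
  have hi := integrable_rpow_of_memEnergySpace hg hE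
  set I := ∫ x, g x ^ p with hI
  set E := realForm J (fun x => g x ^ (p - 1)) g
  -- A fixed set of finite measure controls the negative part of `Φ`: off `W` every cutoff at level
  -- `1/2` vanishes, and on `W` one has `-Φ ≤ 1`.
  set W : Set (RN N) := toMeasurable volume {x | g x ^ p ≥ (2⁻¹ : ℝ) ^ p} with hW
  have hWfin : volume W < ∞ := by
    rw [hW, measure_toMeasurable]
    refine lt_of_le_of_lt (measure_mono fun x hx => ?_)
      (hi.measure_norm_ge_lt_top (ε := (2⁻¹ : ℝ) ^ p) (Real.rpow_pos_of_pos (by norm_num) _))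
    simp only [mem_ofPred_eq] at *
    rwa [Real.norm_of_nonneg (Real.rpow_nonneg (hg x) _)]
  have hWm : MeasurableSet W := measurableSet_toMeasurable _ _
  have hWind : Integrable (W.indicator fun _ => (1 : ℝ)) :=
    (integrable_indicator_iff hWm).2 (integrableOn_const hWfin.ne)
  set B := I ^ 2 + |C| * I + D * E + ∫ x, W.indicator (fun _ => (1 : ℝ)) x with hB
  have hbound : ∀ n : ℕ, ∫⁻ x, ENNReal.ofReal (entFun (cutoff 2⁻¹ (n + 1) (g x) ^ p))
      ≤ ENNReal.ofReal B := by
    intro n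
    have hεM : (2⁻¹ : ℝ) ≤ n + 1 := by
      have : (0 : ℝ) ≤ n := by positivity
      linarith
    have hT := isTestFunction_cutoff (M := n + 1) hJ hp hgm hg hE (ε := 2⁻¹) (by norm_num) hεM
    have hH := H _ _ hT
    have hr := realForm_cutoff_le (M := n + 1) hJ hp hgm hg hE (ε := 2⁻¹) (by norm_num) hεM
    have hint := hT.integrable_entFun hp0
    have hIn : ∫ x, cutoff 2⁻¹ (n + 1) (g x) ^ p ≤ I :=
      integral_mono (hT.integrable_rpow hp0) hi fun x =>
        Real.rpow_le_rpow (cutoff_nonneg hεM _) (cutoff_le (by norm_num) (hg x)) hp0.le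
    have hIn0 : 0 ≤ ∫ x, cutoff 2⁻¹ (n + 1) (g x) ^ p :=
      integral_nonneg fun x => Real.rpow_nonneg (cutoff_nonneg hεM _) _
    have h1 := entFun_le_sq hIn0
    have h2 : C * ∫ x, cutoff 2⁻¹ (n + 1) (g x) ^ p ≤ |C| * I := by
      calc _ ≤ |C| * ∫ x, cutoff 2⁻¹ (n + 1) (g x) ^ p := by gcongr; exact le_abs_self C
        _ ≤ _ := by gcongr
    have h3 : (∫ x, cutoff 2⁻¹ (n + 1) (g x) ^ p) ^ 2 ≤ I ^ 2 := by gcongr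
    have h4 : D * realForm J (fun x => cutoff 2⁻¹ (n + 1) (g x) ^ (p - 1))
        (fun x => cutoff 2⁻¹ (n + 1) (g x)) ≤ D * E := by gcongr
    have hpt : ∀ x, max (entFun (cutoff 2⁻¹ (n + 1) (g x) ^ p)) 0
        ≤ entFun (cutoff 2⁻¹ (n + 1) (g x) ^ p) + W.indicator (fun _ => (1 : ℝ)) x := by
      intro x
      have h0 : 0 ≤ cutoff 2⁻¹ (n + 1) (g x) ^ p := Real.rpow_nonneg (cutoff_nonneg hεM _) _
      by_cases hx : x ∈ W
      · rw [indicator_of_mem hx]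
        exact max_le (by linarith) (by linarith [neg_entFun_le_one h0])
      · rw [indicator_of_notMem hx]
        have : g x ≤ 2⁻¹ := by
          by_contra! h
          exact hx (subset_toMeasurable _ _
            (Real.rpow_le_rpow (by norm_num) h.le hp0.le : (2⁻¹ : ℝ) ^ p ≤ g x ^ p))
        rw [cutoff_eq_zero hεM this, Real.zero_rpow hp0.ne']
        simp [entFun]
    have h5 : ∫ x, max (entFun (cutoff 2⁻¹ (n + 1) (g x) ^ p)) 0 ≤ B := by
      calc _ ≤ ∫ x, (entFun (cutoff 2⁻¹ (n + 1) (g x) ^ p) + W.indicator (fun _ => (1 : ℝ)) x) :=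
            integral_mono hint.pos_part (hint.add hWind) hpt
        _ = (∫ x, entFun (cutoff 2⁻¹ (n + 1) (g x) ^ p)) + ∫ x, W.indicator (fun _ => (1 : ℝ)) x :=
            integral_add hint hWind
        _ ≤ B := by rw [hB]; linarith
    calc _ = ∫⁻ x, ENNReal.ofReal (max (entFun (cutoff 2⁻¹ (n + 1) (g x) ^ p)) 0) := by
          simp
      _ = ENNReal.ofReal (∫ x, max (entFun (cutoff 2⁻¹ (n + 1) (g x) ^ p)) 0) :=
          (ofReal_integral_eq_lintegral_ofReal hint.pos_part
            (Eventually.of_forall fun x => le_max_right _ _)).symm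
      _ ≤ _ := ENNReal.ofReal_le_ofReal h5
  -- Fatou's lemma; at each point the upper truncation is eventually inactive.
  have hlim : ∫⁻ x, ENNReal.ofReal (entFun ((g x - min (g x) 2⁻¹) ^ p)) ≤ ENNReal.ofReal B := by
    have hm : ∀ n : ℕ, AEMeasurable
        (fun x => ENNReal.ofReal (entFun (cutoff 2⁻¹ (n + 1) (g x) ^ p))) volume := fun n =>
      (continuous_entFun.comp ((Real.continuous_rpow_const hp0.le).comp
        (continuous_cutoff _ _))).measurable.comp_aemeasurable hgm.aemeasurable |>.ennreal_ofReal
    refine le_trans (le_of_eq (lintegral_congr fun x => ?_)) ((lintegral_liminf_le' (u := atTop) hm).trans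
      (liminf_le_of_frequently_le' (Frequently.of_forall hbound)))
    refine (Tendsto.liminf_eq ?_).symm
    refine tendsto_const_nhds.congr' ?_
    obtain ⟨n₀, hn₀⟩ := exists_nat_ge (g x)
    filter_upwards [eventually_ge_atTop n₀] with n hn
    have : g x ≤ n + 1 := by
      have : (n₀ : ℝ) ≤ n := by exact_mod_cast hn
      linarith
    rw [cutoff, min_eq_left this]
  -- Where `g ≥ 1`, one has `g ≤ 2 (g - 1/2)`, so removing the lower cutoff costs only a factor
  -- `2^p` in the argument of `Φ`. Where `g ≤ 1` the left side is zero.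
  have hpt : ∀ x, ENNReal.ofReal (entFun (g x ^ p)) ≤ ENNReal.ofReal (Real.log (2 ^ p) * g x ^ p)
      + ENNReal.ofReal (2 ^ p) * ENNReal.ofReal (entFun ((g x - min (g x) 2⁻¹) ^ p)) := by
    intro x
    rcases le_total (g x) 1 with h | h
    · rw [ENNReal.ofReal_of_nonpos (entFun_nonpos (Real.rpow_nonneg (hg x) _)
        (Real.rpow_le_one (hg x) h hp0.le))]
      exact zero_le
    · rw [min_eq_right (by linarith)]
      set k := g x - 2⁻¹ with hk
      have hk0 : 0 < k := by rw [hk]; linarith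
      have hkp : 0 < k ^ p := Real.rpow_pos_of_pos hk0 _
      have hgp : 0 < g x ^ p := Real.rpow_pos_of_pos (by linarith) _
      have h1 : g x ^ p ≤ 2 ^ p * k ^ p := by
        rw [← Real.mul_rpow (by norm_num) hk0.le]
        exact Real.rpow_le_rpow (hg x) (by rw [hk]; linarith) hp0.le
      have h2 : Real.log (g x ^ p) ≤ Real.log (2 ^ p) + Real.log (k ^ p) := by
        rw [← Real.log_mul (by positivity) hkp.ne']
        exact Real.log_le_log hgp h1
      have h3 : entFun (g x ^ p) ≤ Real.log (2 ^ p) * g x ^ p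
          + 2 ^ p * max (entFun (k ^ p)) 0 := by
        have a1 : g x ^ p * Real.log (k ^ p) ≤ 2 ^ p * max (entFun (k ^ p)) 0 := by
          rcases le_total 0 (Real.log (k ^ p)) with h | h
          · calc _ ≤ 2 ^ p * k ^ p * Real.log (k ^ p) := by gcongr
              _ = 2 ^ p * entFun (k ^ p) := by rw [entFun]; ring
              _ ≤ _ := by gcongr; exact le_max_left _ _
          · exact (mul_nonpos_of_nonneg_of_nonpos hgp.le h).trans
              (mul_nonneg (by positivity) (le_max_right _ _))
        have a2 := mul_le_mul_of_nonneg_left h2 hgp.le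
        unfold entFun at *
        linarith
      have h4 : 0 ≤ Real.log (2 ^ p) := Real.log_nonneg (Real.one_le_rpow (by norm_num) hp0.le)
      refine (ENNReal.ofReal_le_ofReal h3).trans ?_
      rw [ENNReal.ofReal_add (by positivity) (mul_nonneg (by positivity) (le_max_right _ _)),
        ENNReal.ofReal_mul (p := 2 ^ p) (by positivity), ENNReal.ofReal_max]
      simp
  refine lt_of_le_of_lt (lintegral_mono hpt) ?_
  have hm1 : AEMeasurable (fun x => ENNReal.ofReal (Real.log (2 ^ p) * g x ^ p)) volume :=
    (hi.const_mul _).aestronglyMeasurable.aemeasurable.ennreal_ofReal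
  rw [lintegral_add_left' hm1, lintegral_const_mul' _ _ ENNReal.ofReal_ne_top]
  refine ENNReal.add_lt_top.2 ⟨?_, ENNReal.mul_lt_top ENNReal.ofReal_lt_top
    (hlim.trans_lt ENNReal.ofReal_lt_top)⟩
  exact (hi.const_mul _).lintegral_lt_top

/-- The logarithmic Sobolev inequality follows from that for test functions. -/
theorem logSobolev_of_isTestFunction (hJ : IsLevyKernel J) (hp : 2 ≤ p) (hD : 0 < D)
    (H : ∀ M f, IsTestFunction J M f → ∫ x, entFun (f x ^ p) ≤ entFun (∫ x, f x ^ p)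
      + C * (∫ x, f x ^ p) + D * realForm J (fun x => f x ^ (p - 1)) f) :
    LogSobolev J p C D := by
  refine ⟨hD, fun f hfm hE => ?_⟩
  have hp0 : 0 < p := by linarith
  have hgm : AEStronglyMeasurable (fun x => |f x|) volume := hfm.norm
  have hg : ∀ x, 0 ≤ |f x| := fun x => abs_nonneg _
  have hi := integrable_rpow_of_memEnergySpace hg hE
  have hfin := lintegral_entFun_lt_top hJ hp hD hgm hg hE H
  refine ⟨hfin, ?_⟩
  have habs : ∀ x, |(|f x| ^ p)| = |f x| ^ p := fun x => abs_of_nonneg (by positivity)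
  unfold entropy
  simp only [habs]
  -- If the negative part has infinite integral, the entropy is `-∞` and there is nothing to prove;
  -- otherwise `Φ(|f|^p)` is integrable.
  by_cases hneg : ∫⁻ x, ENNReal.ofReal (-entFun (|f x| ^ p)) = ∞
  · rw [hneg]
    have : ((∫⁻ x, ENNReal.ofReal (entFun (|f x| ^ p)) : ℝ≥0∞) : EReal) - ((∞ : ℝ≥0∞) : EReal)
        = ⊥ := by
      rw [EReal.coe_ennreal_top, EReal.sub_top]
    rw [this, EReal.bot_sub]
    exact bot_le
  have hEm : AEStronglyMeasurable (fun x => entFun (|f x| ^ p)) volume :=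
    (continuous_entFun.comp (Real.continuous_rpow_const hp0.le)).comp_aestronglyMeasurable hgm
  have hint : Integrable fun x => entFun (|f x| ^ p) := by
    refine ⟨hEm, ?_⟩
    have : ∀ x, ‖entFun (|f x| ^ p)‖ₑ ≤ ENNReal.ofReal (entFun (|f x| ^ p))
        + ENNReal.ofReal (-entFun (|f x| ^ p)) := by
      intro x
      rw [Real.enorm_eq_ofReal_abs]
      rcases abs_cases (entFun (|f x| ^ p)) with h | h <;> rw [h.1] <;> simp
    refine lt_of_le_of_lt (lintegral_mono this) ?_
    rw [lintegral_add_left' hEm.aemeasurable.ennreal_ofReal]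
    exact ENNReal.add_lt_top.2 ⟨hfin, lt_top_iff_ne_top.2 hneg⟩
  rw [ereal_coe_sub_eq_integral hint]
  set I := ∫ x, |f x| ^ p with hI
  set E := realForm J (fun x => |f x| ^ (p - 1)) fun x => |f x|
  have hmain : ∫ x, entFun (|f x| ^ p) ≤ entFun I + C * I + D * E := by
    have hpos : ∀ n : ℕ, (0 : ℝ) < 1 / (n + 1) := fun n => by positivity
    have hle : ∀ n : ℕ, (1 : ℝ) / (n + 1) ≤ n + 1 := fun n => by
      have h0 : (1 : ℝ) ≤ n + 1 := by
        have : (0 : ℝ) ≤ n := by positivity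
        linarith
      exact (div_le_one (by positivity)).2 h0 |>.trans h0
    set c : ℕ → RN N → ℝ := fun n x => cutoff (1 / (n + 1)) (n + 1) |f x| with hc
    have hT : ∀ n : ℕ, IsTestFunction J ((n : ℝ) + 1) (c n) := fun n =>
      isTestFunction_cutoff hJ hp hgm hg hE (hpos n) (hle n)
    have hc0 : ∀ n x, 0 ≤ c n x := fun n x => cutoff_nonneg (hle n) _
    have hcle : ∀ n x, c n x ^ p ≤ |f x| ^ p := fun n x =>
      Real.rpow_le_rpow (hc0 n x) (cutoff_le (hpos n).le (hg x)) hp0.le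
    have hcp : ∀ n x, 0 ≤ c n x ^ p := fun n x => Real.rpow_nonneg (hc0 n x) _
    have hlim : ∀ x, Tendsto (fun n => c n x) atTop (𝓝 |f x|) := by
      intro x
      have h1 : Tendsto (fun n : ℕ => min |f x| ((n : ℝ) + 1)) atTop (𝓝 |f x|) := by
        refine tendsto_const_nhds.congr' ?_
        obtain ⟨n₀, hn₀⟩ := exists_nat_ge |f x|
        filter_upwards [eventually_ge_atTop n₀] with n hn
        rw [min_eq_left]
        have : (n₀ : ℝ) ≤ n := by exact_mod_cast hn
        linarith
      have h2 : Tendsto (fun n : ℕ => min |f x| ((1 : ℝ) / (n + 1))) atTop (𝓝 0) := by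
        have := (tendsto_const_nhds (x := |f x|)).min (tendsto_one_div_add_atTop_nhds_zero_nat
          (𝕜 := ℝ))
        rwa [min_eq_right (hg x)] at this
      have h3 := h1.sub h2
      rwa [sub_zero] at h3
    have hlimp : ∀ x, Tendsto (fun n => c n x ^ p) atTop (𝓝 (|f x| ^ p)) := fun x =>
      ((Real.continuous_rpow_const hp0.le).tendsto _).comp (hlim x)
    have t1 : Tendsto (fun n => ∫ x, c n x ^ p) atTop (𝓝 I) := by
      refine tendsto_integral_of_dominated_convergence (fun x => |f x| ^ p)
        (fun n => ((hT n).integrable_rpow hp0).aestronglyMeasurable) hi (fun n => ?_)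
        (Eventually.of_forall hlimp)
      refine Eventually.of_forall fun x => ?_
      rw [Real.norm_of_nonneg (hcp n x)]
      exact hcle n x
    have t2 : Tendsto (fun n => ∫ x, entFun (c n x ^ p)) atTop (𝓝 (∫ x, entFun (|f x| ^ p))) := by
      refine tendsto_integral_of_dominated_convergence (fun x => |entFun (|f x| ^ p)| + |f x| ^ p)
        (fun n => ((hT n).integrable_entFun hp0).aestronglyMeasurable) (hint.abs.add hi)
        (fun n => ?_) (Eventually.of_forall fun x => (continuous_entFun.tendsto _).comp (hlimp x))
      exact Eventually.of_forall fun x => abs_entFun_le (hcp n x) (hcle n x)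
    have t3 : Tendsto (fun n => entFun (∫ x, c n x ^ p) + C * (∫ x, c n x ^ p) + D * E) atTop
        (𝓝 (entFun I + C * I + D * E)) :=
      (((continuous_entFun.tendsto I).comp t1).add (t1.const_mul C)).add_const _
    refine le_of_tendsto_of_tendsto' t2 t3 fun n => ?_
    have h1 := H _ _ (hT n)
    have h2 := mul_le_mul_of_nonneg_left
      (realForm_cutoff_le hJ hp hgm hg hE (hpos n) (hle n)) hD.le
    exact h1.trans (by linarith)
  have h1 : ((∫ x, entFun (|f x| ^ p) : ℝ) : EReal) - ((entFun I : ℝ) : EReal)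
      ≤ ((C * I : ℝ) : EReal) + (D : EReal) * ((E : ℝ) : EReal) := by
    rw [← EReal.coe_sub, ← EReal.coe_mul, ← EReal.coe_add, EReal.coe_le_coe_iff]
    linarith
  refine h1.trans (add_le_add le_rfl ?_)
  exact mul_le_mul_of_nonneg_left (realForm_abs_le_dirichletForm hJ hp hfm hE)
    (by exact_mod_cast hD.le)

end Truncation

end StrongHyper

namespace StrongHyper

/-! ### `L^r` norms as real integrals. -/

section LpTools

variable {α : Type*} [MeasurableSpace α] {μ : Measure α}

theorem integrable_abs_rpow_iff {f : α → ℝ} {r : ℝ} (hr : 0 < r)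
    (hf : AEStronglyMeasurable f μ) :
    Integrable (fun x => |f x| ^ r) μ ↔ MemLp f (ENNReal.ofReal r) μ := by
  have := integrable_norm_rpow_iff (p := ENNReal.ofReal r) hf (by simpa using hr)
    ENNReal.ofReal_ne_top
  rwa [ENNReal.toReal_ofReal hr.le] at this

theorem eLpNorm_eq_integral_abs_rpow {f : α → ℝ} {r : ℝ} (hr : 0 < r)
    (hf : MemLp f (ENNReal.ofReal r) μ) :
    eLpNorm f (ENNReal.ofReal r) μ = ENNReal.ofReal ((∫ x, |f x| ^ r ∂μ) ^ r⁻¹) := by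
  have := hf.eLpNorm_eq_integral_rpow_norm (by simpa using hr) ENNReal.ofReal_ne_top
  rwa [ENNReal.toReal_ofReal hr.le] at this

theorem abs_rpow_le_mul_sq {r M a : ℝ} (hr : 2 ≤ r) (ha : |a| ≤ M) :
    |a| ^ r ≤ M ^ (r - 2) * a ^ 2 := by
  have h0 := abs_nonneg a
  calc |a| ^ r = |a| ^ (r - 2) * |a| ^ (2 : ℝ) := by
        rw [← Real.rpow_add_of_nonneg h0 (by linarith) (by norm_num)]; congr 1; ring
    _ ≤ M ^ (r - 2) * |a| ^ (2 : ℝ) := by gcongr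
    _ = _ := by rw [Real.rpow_two, sq_abs]

theorem MemLp.ofReal_of_bounded {f : α → ℝ} {r M : ℝ} (hf : MemLp f 2 μ) (hr : 2 ≤ r)
    (hM : ∀ᵐ x ∂μ, |f x| ≤ M) : MemLp f (ENNReal.ofReal r) μ := by
  rw [← integrable_abs_rpow_iff (by linarith) hf.1]
  refine (hf.integrable_sq.const_mul (M ^ (r - 2))).mono' ?_ ?_
  · exact ((Real.continuous_rpow_const (by linarith)).comp continuous_abs).comp_aestronglyMeasurable
      hf.1
  · filter_upwards [hM] with x hx
    rw [Real.norm_of_nonneg (by positivity)]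
    exact abs_rpow_le_mul_sq hr hx

theorem integral_abs_rpow_le_of_eLpNorm_le {f : α → ℝ} {r B : ℝ} (hr : 0 < r) (hB : 0 ≤ B)
    (hf : MemLp f (ENNReal.ofReal r) μ)
    (h : eLpNorm f (ENNReal.ofReal r) μ ≤ ENNReal.ofReal B) : ∫ x, |f x| ^ r ∂μ ≤ B ^ r := by
  rw [eLpNorm_eq_integral_abs_rpow hr hf, ENNReal.ofReal_le_ofReal_iff hB] at h
  have h0 : 0 ≤ ∫ x, |f x| ^ r ∂μ := integral_nonneg fun x => by positivity
  have h1 := Real.rpow_le_rpow (Real.rpow_nonneg h0 _) h hr.le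
  rwa [← Real.rpow_mul h0, inv_mul_cancel₀ hr.ne', Real.rpow_one] at h1

end LpTools

/-! ### From hypercontractivity to the logarithmic Sobolev inequality. -/

variable {N : ℕ} {J : RN N → RN N → ℝ}

theorem IsMildSolution.isSolution {u₀ : Lp ℝ 2 (volume : Measure (RN N))}
    {u : ℝ → Lp ℝ 2 (volume : Measure (RN N))} (hu : IsMildSolution J u₀ u) (hJ : IsLevyKernel J)
    {M p : ℝ} (hM : 0 ≤ M) (hp : 2 ≤ p) (h0 : ∀ᵐ x, |u₀ x| ≤ M) :
    IsSolution J p u₀ (fun t => u t) := by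
  refine ⟨MemLp.ofReal_of_bounded (Lp.memLp _) hp h0,
    fun t ht => MemLp.ofReal_of_bounded (Lp.memLp _) hp (hu.abs_le hJ hM h0 ht),
    fun _ => u₀, fun _ => u, fun _ => hu,
    fun _ => MemLp.ofReal_of_bounded (Lp.memLp _) hp h0, ?_, fun t _ => ?_⟩ <;> simp

theorem IsTestFunction.mem_rpow {M r : ℝ} {f : RN N → ℝ} (hf : IsTestFunction J M f)
    (hJ : IsLevyKernel J) (hr : 1 ≤ r) : MemEnergySpace J fun x => f x ^ r := by
  have hr0 : 0 < r := by linarith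
  refine hf.mem.of_lipschitz (K := r * M ^ (r - 1)) hJ
    ((Real.continuous_rpow_const hr0.le).comp_aestronglyMeasurable hf.mem.1.1) ?_ ?_
  · refine Eventually.of_forall fun x => ?_
    have := abs_rpow_sub_rpow_le hr (hf.nonneg x) le_rfl (hf.le x)
      ((hf.nonneg x).trans (hf.le x))
    simpa [Real.zero_rpow hr0.ne'] using this
  · exact Eventually.of_forall fun z =>
      abs_rpow_sub_rpow_le hr (hf.nonneg _) (hf.nonneg _) (hf.le _) (hf.le _)

theorem IsTestFunction.realForm_rpow_le {M r : ℝ} {f : RN N → ℝ} (hf : IsTestFunction J M f)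
    (hJ : IsLevyKernel J) (hr : 1 ≤ r) :
    realForm J (fun x => f x ^ r) (fun x => f x ^ r) ≤ (r * M ^ (r - 1)) ^ 2 * realForm J f f := by
  rw [realForm, realForm, ← integral_const_mul]
  refine integral_mono (integrable_incr_mul hJ (hf.mem_rpow hJ hr) (hf.mem_rpow hJ hr))
    ((integrable_incr_mul hJ hf.mem hf.mem).const_mul _) fun z => ?_
  have h := abs_rpow_sub_rpow_le hr (hf.nonneg z.1) (hf.nonneg z.2) (hf.le z.1) (hf.le z.2)
  calc incr (fun x => f x ^ r) z * incr (fun x => f x ^ r) z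
      = |f z.1 ^ r - f z.2 ^ r| ^ 2 := by rw [sq_abs, pow_two]; rfl
    _ ≤ (r * M ^ (r - 1) * |f z.1 - f z.2|) ^ 2 := by gcongr
    _ = (r * M ^ (r - 1)) ^ 2 * (incr f z * incr f z) := by
        rw [mul_pow, sq_abs, pow_two (f z.1 - f z.2)]; rfl

/-- Mean value theorem for `t ↦ ⟨g, u t⟩` along a mild solution. -/
theorem IsMildSolution.exists_inner_sub_eq {u₀ : Lp ℝ 2 (volume : Measure (RN N))}
    {u : ℝ → Lp ℝ 2 (volume : Measure (RN N))} (hu : IsMildSolution J u₀ u) (hJ : IsLevyKernel J)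
    {t : ℝ} (ht : 0 < t) {g : RN N → ℝ} (hg : MemEnergySpace J g) :
    ∃ c ∈ Ioo 0 t, ∫ x, g x * (u t x - u₀ x) = -(t * realForm J (u c) g) := by
  set G := hg.1.toLp with hG
  obtain ⟨c, hc, h⟩ := exists_hasDerivAt_eq_slope (fun s => inner ℝ G (u s))
    (fun s => inner ℝ G (deriv u s)) ht
    (continuousOn_const.inner (hu.continuousOn.mono Icc_subset_Ici_self)) fun s hs => by
      have := (hasDerivAt_const s G).inner ℝ (hu.hasDerivAt hs.1)
      simpa using this
  refine ⟨c, hc, ?_⟩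
  have h1 := hu.realForm_eq_integral hJ hc.1 hg
  have h2 : inner ℝ G (deriv u c) = ∫ x, g x * deriv u c x := by
    rw [L2.inner_def]
    refine integral_congr_ae ?_
    filter_upwards [hg.1.coeFn_toLp] with x hx
    rw [hG, hx]; simp [mul_comm]
  have h3 : inner ℝ G (u t) - inner ℝ G (u 0) = ∫ x, g x * (u t x - u₀ x) := by
    rw [← inner_sub_right, hu.initial, L2.inner_def]
    refine integral_congr_ae ?_
    filter_upwards [hg.1.coeFn_toLp, Lp.coeFn_sub (u t) u₀] with x hx h
    rw [hG, hx, h]; simp [mul_comm]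
  rw [h2, h3, sub_zero, eq_div_iff ht.ne'] at h
  rw [h1, ← h]; ring

/-- Lower bound for `∫ |u(t)|^q` near `t = 0`. -/
theorem eventually_le_integral_abs_rpow {M p ε : ℝ} {f : RN N → ℝ} (hJ : IsLevyKernel J)
    (hp : 2 ≤ p) (hM : 1 ≤ M) (hf : IsTestFunction J M f) (hε : 0 < ε)
    {u : ℝ → Lp ℝ 2 (volume : Measure (RN N))} (hu : IsMildSolution J hf.mem.1.toLp u)
    (huE : Tendsto (fun s => energy J (⇑(u s) - ⇑(hf.mem.1.toLp))) (𝓝[>] 0) (𝓝 0)) :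
    ∀ᶠ t in 𝓝[>] 0, ∀ q, p ≤ q → q ≤ p + 1 → Integrable (fun x => |u t x| ^ q) →
      (∫ x, f x ^ p) + (q - p) * (∫ x, f x ^ p * Real.log (f x))
        - q * t * (realForm J (fun x => f x ^ (q - 1)) f + ε) ≤ ∫ x, |u t x| ^ q := by
  have hfe := hf.mem.1.coeFn_toLp
  have hf₀ : MemEnergySpace J hf.mem.1.toLp := hf.mem.congr hJ hfe.symm
  -- `K` dominates the Lipschitz constants `(q-1) M^(q-2)` of `s^(q-1)` on `[0, M]` for all `q ∈ [p,
  -- p+1]`. The time threshold below is thereby independent of `q`, which later depends on `t`.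
  set K := p * M ^ p with hK
  have hK0 : 0 < K := by have : 0 < M := by linarith
                         positivity
  set E := realForm J f f
  have hE0 : 0 ≤ E := realForm_self_nonneg f
  have hsmall : ∀ᶠ s in 𝓝[>] (0 : ℝ),
      (energy J (⇑(u s) - ⇑(hf.mem.1.toLp))).toReal * (K ^ 2 * E + 1) < ε ^ 2 := by
    have h1 := (ENNReal.tendsto_toReal ENNReal.zero_ne_top).comp huE
    have h2 := h1.mul_const (K ^ 2 * E + 1)
    simp only [ENNReal.toReal_zero, zero_mul] at h2
    exact h2.eventually (gt_mem_nhds (by positivity))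
  rw [eventually_nhdsWithin_iff, Metric.eventually_nhds_iff] at hsmall
  obtain ⟨δ, hδ, hsmall⟩ := hsmall
  filter_upwards [Ioo_mem_nhdsGT hδ] with t ht q hpq hqp hint
  have hq1 : 1 ≤ q - 1 := by linarith
  have hq0 : 0 < q := by linarith
  have hg := hf.mem_rpow hJ hq1
  obtain ⟨c, hc, hMVT⟩ := hu.exists_inner_sub_eq hJ ht.1 hg
  -- the error in the form
  have hform : realForm J (u c) (fun x => f x ^ (q - 1))
      ≤ realForm J (fun x => f x ^ (q - 1)) f + ε := by
    have hum := hu.memEnergySpace c hc.1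
    have hd : MemEnergySpace J (⇑(u c) - ⇑(hf.mem.1.toLp)) := hum.sub hJ hf₀
    have h1 := realForm_sub_left hJ hum hf₀ hg
    rw [realForm_congr (f := ⇑(hf.mem.1.toLp)) hfe (EventuallyEq.refl _ fun x => f x ^ (q - 1)),
      realForm_comm f] at h1
    have h2 := sq_realForm_le hJ hd hg
    have h3 := hsmall (y := c) (by rw [Real.dist_eq, sub_zero, abs_of_pos hc.1]
                                   exact hc.2.trans ht.2) hc.1
    rw [energy_toReal hJ hd] at h3
    have h4 := hf.realForm_rpow_le hJ hq1
    have h5 : (q - 1) * M ^ (q - 1 - 1) ≤ K := by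
      rw [hK]
      have : M ^ (q - 1 - 1) ≤ M ^ p := Real.rpow_le_rpow_of_exponent_le hM (by linarith)
      have h0 : 0 ≤ M ^ (q - 1 - 1) := by positivity
      apply mul_le_mul (by linarith) this h0 (by linarith)
    have h5' : 0 ≤ (q - 1) * M ^ (q - 1 - 1) := by
      have : 0 ≤ M ^ (q - 1 - 1) := by positivity
      exact mul_nonneg (by linarith) this
    have h6 : realForm J (fun x => f x ^ (q - 1)) (fun x => f x ^ (q - 1)) ≤ K ^ 2 * E := by
      refine h4.trans ?_
      gcongr
    have h7 : realForm J (⇑(u c) - ⇑(hf.mem.1.toLp)) (fun x => f x ^ (q - 1)) ^ 2 ≤ ε ^ 2 := by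
      refine h2.trans (le_trans ?_ h3.le)
      have := realForm_self_nonneg (J := J) (⇑(u c) - ⇑(hf.mem.1.toLp))
      gcongr
      linarith
    have h8 := abs_le_of_sq_le_sq h7 hε.le
    have h9 := le_of_abs_le h8
    linarith
  -- integrability
  have i1 := hf.integrable_rpow hq0
  have i2 := hf.integrable_rpow (r := p) (by linarith)
  have i3 : Integrable fun x => f x ^ p * Real.log (f x) := by
    have := (hf.integrable_entFun (r := p) (by linarith)).const_mul p⁻¹
    refine this.congr (Eventually.of_forall fun x => ?_)
    simp only [entFun]
    rcases (hf.nonneg x).eq_or_lt with h | h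
    · rw [← h, Real.zero_rpow (by linarith)]; simp
    · rw [Real.log_rpow h]
      have : p ≠ 0 := by linarith
      field_simp
  have i4 : Integrable fun x => f x ^ (q - 1) * (u t x - hf.mem.1.toLp f x) :=
    hg.1.integrable_mul ((Lp.memLp (u t)).sub (Lp.memLp _))
  -- Tangent line in the function at fixed exponent; `s2` is the tangent line in the exponent at
  -- fixed function.
  have s1 : (∫ x, f x ^ q) + q * ∫ x, f x ^ (q - 1) * (u t x - hf.mem.1.toLp f x)
      ≤ ∫ x, |u t x| ^ q := by
    rw [← integral_const_mul, ← integral_add i1 (i4.const_mul q)]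
    refine integral_mono_ae (i1.add (i4.const_mul q)) hint ?_
    filter_upwards [hfe] with x hx
    rw [hx, ← mul_assoc]
    exact rpow_tangent_le (by linarith) (hf.nonneg x)
  have s2 : (∫ x, f x ^ p) + (q - p) * (∫ x, f x ^ p * Real.log (f x)) ≤ ∫ x, f x ^ q := by
    rw [← integral_const_mul, ← integral_add i2 (i3.const_mul _)]
    refine integral_mono (i2.add (i3.const_mul _)) i1 fun x => ?_
    simp only
    rcases (hf.nonneg x).eq_or_lt with h | h
    · rw [← h, Real.zero_rpow (by linarith), Real.zero_rpow (by linarith)]; simp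
    · have e : f x ^ q = f x ^ p * Real.exp ((q - p) * Real.log (f x)) := by
        rw [mul_comm (q - p), ← Real.rpow_def_of_pos h, ← Real.rpow_add h]; congr 1; ring
      rw [e]
      have := Real.add_one_le_exp ((q - p) * Real.log (f x))
      have h0 : 0 < f x ^ p := Real.rpow_pos_of_pos h _
      nlinarith
  rw [hMVT] at s1
  have s3 : q * t * realForm J (u c) (fun x => f x ^ (q - 1))
      ≤ q * t * (realForm J (fun x => f x ^ (q - 1)) f + ε) := by
    have := ht.1
    gcongr
  linarith

theorem IsTestFunction.tendsto_realForm_rpow {M p : ℝ} {f : RN N → ℝ} (hJ : IsLevyKernel J)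
    (hp : 2 ≤ p) (hM : 1 ≤ M) (hf : IsTestFunction J M f) {l : Filter ℝ} [l.IsCountablyGenerated]
    {q : ℝ → ℝ} (hq : Tendsto q l (𝓝 p)) (hpq : ∀ᶠ t in l, p ≤ q t) :
    Tendsto (fun t => realForm J (fun x => f x ^ (q t - 1)) f) l
      (𝓝 (realForm J (fun x => f x ^ (p - 1)) f)) := by
  have hlt : ∀ᶠ t in l, q t < p + 1 := hq.eventually (gt_mem_nhds (by linarith))
  refine tendsto_integral_filter_of_dominated_convergence
    (fun z => p * M ^ p * (incr f z * incr f z)) ?_ ?_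
    ((integrable_incr_mul hJ hf.mem hf.mem).const_mul _) ?_
  · filter_upwards [hpq] with t ht
    exact (integrable_incr_mul hJ (hf.mem_rpow hJ (by linarith)) hf.mem).aestronglyMeasurable
  · filter_upwards [hpq, hlt] with t ht ht'
    refine Eventually.of_forall fun z => ?_
    have h := abs_rpow_sub_rpow_le (r := q t - 1) (by linarith) (hf.nonneg z.1) (hf.nonneg z.2)
      (hf.le z.1) (hf.le z.2)
    have h5 : (q t - 1) * M ^ (q t - 1 - 1) ≤ p * M ^ p := by
      have h1 : M ^ (q t - 1 - 1) ≤ M ^ p := Real.rpow_le_rpow_of_exponent_le hM (by linarith)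
      have h0 : 0 ≤ M ^ (q t - 1 - 1) := by positivity
      apply mul_le_mul (by linarith) h1 h0 (by linarith)
    rw [norm_mul, Real.norm_eq_abs, Real.norm_eq_abs, ← abs_mul_abs_self (incr f z), ← mul_assoc]
    gcongr
    exact h.trans (mul_le_mul_of_nonneg_right h5 (abs_nonneg _))
  · refine Eventually.of_forall fun z => ?_
    have h : ∀ y, Tendsto (fun t => f y ^ (q t - 1)) l (𝓝 (f y ^ (p - 1))) := fun y =>
      ((Real.continuousAt_const_rpow' (by linarith)).tendsto).comp (hq.sub_const 1)
    exact ((h z.1).sub (h z.2)).mul_const _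

/-- Differentiating the hypercontractive bound at `t = 0` along the solution starting at a test
function. -/
theorem entFun_integral_le_of_hypercontractive {M p T k a : ℝ} {q A : ℝ → ℝ} {f : RN N → ℝ}
    (hJ : IsLevyKernel J) (hp : 2 ≤ p) (hM : 1 ≤ M) (hf : IsTestFunction J M f)
    (hI : 0 < ∫ x, f x ^ p)
    (hyp : IsStronglyHypercontractiveWith J p T q A) (hk : 0 < k)
    (hq : HasDerivWithinAt q k (Ici 0) 0) (hA : ∀ᶠ t in 𝓝[>] 0, A t ≤ 1 + a * t) :
    ∫ x, entFun (f x ^ p) ≤ entFun (∫ x, f x ^ p) + p ^ 2 / k * a * (∫ x, f x ^ p)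
      + p ^ 2 / k * realForm J (fun x => f x ^ (p - 1)) f := by
  have hp0 : 0 < p := by linarith
  have hq0 := hyp.initial
  set I := ∫ x, f x ^ p with hIdef
  set L := ∫ x, f x ^ p * Real.log (f x) with hL
  set E := realForm J (fun x => f x ^ (p - 1)) f with hE
  set n := I ^ p⁻¹ with hn
  have hn0 : 0 < n := Real.rpow_pos_of_pos hI _
  have hnp : n ^ p = I := by
    rw [hn, ← Real.rpow_mul hI.le, inv_mul_cancel₀ hp0.ne', Real.rpow_one]
  have hT := hyp.time_pos
  have hqt : Tendsto q (𝓝[>] 0) (𝓝 p) := by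
    have := hq.continuousWithinAt.mono_left (nhdsWithin_mono _ Ioi_subset_Ici_self)
    rwa [hq0] at this
  have hpq : ∀ᶠ t in 𝓝[>] (0 : ℝ), p ≤ q t := by
    filter_upwards [Ioo_mem_nhdsGT hT] with t ht using hyp.mapsTo ⟨ht.1.le, ht.2⟩
  have hlt : ∀ᶠ t in 𝓝[>] (0 : ℝ), q t < p + 1 := hqt.eventually (gt_mem_nhds (by linarith))
  have hf₀ : MemEnergySpace J hf.mem.1.toLp := hf.mem.congr hJ hf.mem.1.coeFn_toLp.symm
  obtain ⟨u, hu, huE⟩ := exists_isMildSolution hJ _ hf₀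
  have hbd : ∀ᵐ x, |hf.mem.1.toLp f x| ≤ M := by
    filter_upwards [hf.mem.1.coeFn_toLp] with x hx
    rw [hx, abs_of_nonneg (hf.nonneg x)]
    exact hf.le x
  have hsol := hu.isSolution hJ (by linarith) hp hbd
  have hnorm : eLpNorm (hf.mem.1.toLp) (ENNReal.ofReal p) volume = ENNReal.ofReal n := by
    rw [eLpNorm_congr_ae hf.mem.1.coeFn_toLp, eLpNorm_eq_integral_abs_rpow hp0
      ((integrable_abs_rpow_iff hp0 hf.mem.1.1).1
        ((hf.integrable_rpow hp0).congr (Eventually.of_forall fun x => by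
          simp only [abs_of_nonneg (hf.nonneg x)])))]
    simp only [abs_of_nonneg (hf.nonneg _)]
    rfl
  -- the function bounding the norm
  set R : ℝ → ℝ := fun t => ((1 + a * t) * n) ^ q t with hR
  have hRd : HasDerivWithinAt R (I * (k * Real.log n + p * a)) (Ici 0) 0 := by
    have h1 : HasDerivWithinAt (fun t : ℝ => (1 + a * t) * n) (a * n) (Ici 0) 0 := by
      have := (((hasDerivAt_id (0 : ℝ)).const_mul a).const_add 1).mul_const n
      simpa using this.hasDerivWithinAt
    have h2 := h1.rpow hq (by simpa using hn0)
    refine h2.congr_deriv ?_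
    have : n ^ (p - 1) * n = I := by
      rw [← hnp, ← Real.rpow_add_one hn0.ne']; simp
    simp only [mul_zero, add_zero, one_mul, hq0, hnp]
    linear_combination (a * p) * this
  have hR0 : R 0 = I := by simp [hR, hq0, hnp]
  have hslope : ∀ {φ : ℝ → ℝ} {d : ℝ}, HasDerivWithinAt φ d (Ici 0) 0 →
      Tendsto (fun t => (φ t - φ 0) / t) (𝓝[>] 0) (𝓝 d) := by
    intro φ d h
    have h' := hasDerivWithinAt_iff_tendsto_slope.1 h
    rw [Ici_sdiff_left] at h'
    refine h'.congr fun t => ?_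
    simp [slope_def_field]
  have key : ∀ ε > 0, k * L - p * (E + ε) ≤ I * (k * Real.log n + p * a) := by
    intro ε hε
    have hlow := eventually_le_integral_abs_rpow hJ hp hM hf hε hu huE
    have hlim1 : Tendsto (fun t => (q t - q 0) / t * L
        - q t * (realForm J (fun x => f x ^ (q t - 1)) f + ε)) (𝓝[>] 0)
        (𝓝 (k * L - p * (E + ε))) :=
      ((hslope hq).mul_const L).sub (hqt.mul
        ((hf.tendsto_realForm_rpow hJ hp hM hqt hpq).add_const ε))
    refine le_of_tendsto_of_tendsto hlim1 (hslope hRd) ?_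
    filter_upwards [hlow, hpq, hlt, hA, Ioo_mem_nhdsGT hT] with t h1 h2 h3 h4 h5
    have hAt := hyp.coeff_nonneg t ⟨h5.1.le, h5.2⟩
    have hb := hyp.bound _ _ hsol t h5
    rw [hnorm, ← ENNReal.ofReal_mul hAt] at hb
    have hqp : 0 < q t := by linarith
    have hmem : MemLp (u t) (ENNReal.ofReal (q t)) volume :=
      ⟨Lp.aestronglyMeasurable _, hb.trans_lt ENNReal.ofReal_lt_top⟩
    have h6 := integral_abs_rpow_le_of_eLpNorm_le hqp (by positivity) hmem hb
    have h7 := h1 (q t) h2 h3.le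
      ((integrable_abs_rpow_iff hqp (Lp.aestronglyMeasurable _)).2 hmem)
    have h8 : (A t * n) ^ q t ≤ R t := by
      simp only [hR]
      gcongr
    rw [hR0, hq0, ← sub_nonneg]
    have h9 : (R t - I) / t - ((q t - p) / t * L
        - q t * (realForm J (fun x => f x ^ (q t - 1)) f + ε))
        = (R t - (I + (q t - p) * L
          - q t * t * (realForm J (fun x => f x ^ (q t - 1)) f + ε))) / t := by
      have := h5.1.ne'
      field_simp
      ring
    rw [h9]
    exact div_nonneg (by linarith) h5.1.le
  have key' : k * L - p * E ≤ I * (k * Real.log n + p * a) := by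
    refine le_of_forall_pos_le_add fun ε hε => ?_
    have := key (ε / p) (by positivity)
    have e : p * (E + ε / p) = p * E + ε := by field_simp
    linarith
  have e1 : ∫ x, entFun (f x ^ p) = p * L := by
    rw [hL, ← integral_const_mul]
    refine integral_congr_ae (Eventually.of_forall fun x => ?_)
    simp only [entFun]
    rcases (hf.nonneg x).eq_or_lt with h | h
    · rw [← h, Real.zero_rpow hp0.ne']; simp
    · rw [Real.log_rpow h]; ring
  have e2 : entFun I = p * (I * Real.log n) := by
    rw [entFun, hn, Real.log_rpow hI]; field_simp
  rw [e1, e2]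
  have := mul_le_mul_of_nonneg_left key' (by positivity : 0 ≤ p / k)
  have e3 : p / k * (k * L - p * E) = p * L - p ^ 2 / k * E := by field_simp
  have e4 : p / k * (I * (k * Real.log n + p * a)) = p * (I * Real.log n) + p ^ 2 / k * a * I := by
    field_simp
  linarith

/-- Strong hypercontractivity implies the logarithmic Sobolev inequality. -/
theorem logSobolev_of_hypercontractive {p T k : ℝ} {q A : ℝ → ℝ} {a : EReal} (hJ : IsLevyKernel J)
    (hp : 2 ≤ p) (hyp : IsStronglyHypercontractiveWith J p T q A) (hk : 0 < k)
    (hq : HasDerivWithinAt q k (Ici 0) 0)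
    (hA : Tendsto (fun s : ℝ => (((A s - 1) / s : ℝ) : EReal)) (𝓝[>] 0) (𝓝 a))
    {C : ℝ} (hC : ((p ^ 2 / k : ℝ) : EReal) * a ≤ (C : EReal)) :
    LogSobolev J p C (p ^ 2 / k) := by
  have hp0 : 0 < p := by linarith
  have hD : 0 < p ^ 2 / k := by positivity
  refine logSobolev_of_isTestFunction hJ hp hD fun M f hf => ?_
  have hI0 : 0 ≤ ∫ x, f x ^ p := integral_nonneg fun x => Real.rpow_nonneg (hf.nonneg x) _
  have hf' : IsTestFunction J (max M 1) f :=
    ⟨hf.nonneg, fun x => (hf.le x).trans (le_max_left _ _), hf.measure_lt, hf.mem⟩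
  rcases hI0.eq_or_lt with h0 | h0
  · have hz : ∀ᵐ x, f x = 0 := by
      have := (integral_eq_zero_iff_of_nonneg (fun x => Real.rpow_nonneg (hf.nonneg x) _)
        (hf.integrable_rpow hp0)).1 h0.symm
      filter_upwards [this] with x hx
      exact (Real.rpow_eq_zero (hf.nonneg x) hp0.ne').1 hx
    have h1 : ∫ x, entFun (f x ^ p) = 0 := by
      refine integral_eq_zero_of_ae ?_
      filter_upwards [hz] with x hx
      simp [hx, Real.zero_rpow hp0.ne', entFun]
    rw [h1, ← h0]
    have h2 : 0 ≤ realForm J (fun x => f x ^ (p - 1)) f :=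
      integral_nonneg fun z =>
        rpow_sub_mul_sub_nonneg (by linarith) (hf.nonneg _) (hf.nonneg _)
    simp only [entFun, zero_mul, mul_zero, zero_add]
    positivity
  · refine le_of_forall_pos_le_add fun ε hε => ?_
    set I := ∫ x, f x ^ p
    -- Any real slope above `a` is admissible, which also covers `a = -∞`. With this `b` the
    -- constant becomes `C + ε / I`, an excess of exactly `ε` after multiplication by `I`.
    set b := (C + ε / I) / (p ^ 2 / k) with hb
    have hab : a < (b : EReal) := by
      by_contra! h
      have h1 : ((p ^ 2 / k : ℝ) : EReal) * (b : EReal) ≤ ((p ^ 2 / k : ℝ) : EReal) * a :=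
        mul_le_mul_of_nonneg_left h (by exact_mod_cast hD.le)
      have h2 := h1.trans hC
      rw [← EReal.coe_mul, EReal.coe_le_coe_iff, hb, mul_div_cancel₀ _ hD.ne'] at h2
      have : 0 < ε / I := by positivity
      linarith
    have hev : ∀ᶠ t in 𝓝[>] (0 : ℝ), A t ≤ 1 + b * t := by
      filter_upwards [hA.eventually (gt_mem_nhds hab), self_mem_nhdsWithin] with t ht ht0
      rw [EReal.coe_lt_coe_iff, div_lt_iff₀ ht0] at ht
      linarith
    have h := entFun_integral_le_of_hypercontractive hJ hp (le_max_right M 1) hf' h0 hyp hk hq hev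
    rw [hb, mul_div_cancel₀ _ hD.ne', add_mul, div_mul_cancel₀ _ h0.ne'] at h
    linarith

end StrongHyper

namespace StrongHyper

/-! ### Uniform estimates for `|s|^r` and `|s|^r log |s|` on bounded intervals. -/

section PowerEstimates

variable {M a b : ℝ}

/-- `s^η log s` is `η⁻¹ Φ(s^η)`, and `-1 ≤ Φ(t) ≤ t²`. Any spare positive power thus absorbs a
logarithm. -/
theorem abs_rpow_log_le {η s : ℝ} (hη : 0 < η) (hs : 0 ≤ s) (hsM : s ≤ M) :
    |s ^ η * Real.log s| ≤ η⁻¹ * (1 + (M ^ η) ^ 2) := by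
  have e : s ^ η * Real.log s = η⁻¹ * entFun (s ^ η) := by
    rcases hs.eq_or_lt with rfl | h
    · rw [Real.zero_rpow hη.ne']; simp [entFun]
    · rw [entFun, Real.log_rpow h]; field_simp
  have h0 : 0 ≤ s ^ η := by positivity
  have h1 := neg_entFun_le_one h0
  have h2 := entFun_le_sq h0
  have h3 : (s ^ η) ^ 2 ≤ (M ^ η) ^ 2 := by gcongr
  rw [e, abs_mul, abs_of_pos (inv_pos.2 hη)]
  gcongr
  rw [abs_le]
  constructor <;> nlinarith

theorem rpow_split {r s t : ℝ} (ht : 0 ≤ t) (hs : 0 ≤ s) (hr : 0 ≤ r) : t ^ (s + r) = t ^ s * t ^ r :=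
  Real.rpow_add_of_nonneg ht hs hr

theorem rpow_sub_two_mul {r t : ℝ} (hr : 2 ≤ r) (ht : 0 ≤ t) : t ^ (r - 2) * t = t ^ (r - 1) := by
  nth_rw 2 [← Real.rpow_one t]
  rw [← rpow_split ht (by linarith) zero_le_one]
  congr 1; ring

/-- For equal signs this is the estimate for `s^(r-1)`. For opposite signs the two terms add up, and
each is at most `M^(r-2)` times its argument. -/
theorem abs_signed_rpow_sub_le {r : ℝ} (hr : 2 ≤ r) (ha : |a| ≤ M) (hb : |b| ≤ M) :
    |(|a| ^ (r - 2) * a - |b| ^ (r - 2) * b)| ≤ (r - 1) * M ^ (r - 2) * |a - b| := by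
  have pos : ∀ x y : ℝ, 0 ≤ x → 0 ≤ y → x ≤ M → y ≤ M →
      |x ^ (r - 2) * x - y ^ (r - 2) * y| ≤ (r - 1) * M ^ (r - 2) * |x - y| := by
    intro x y hx hy hxM hyM
    rw [rpow_sub_two_mul hr hx, rpow_sub_two_mul hr hy]
    have := abs_rpow_sub_rpow_le (r := r - 1) (by linarith) hx hy hxM hyM
    rwa [show r - 1 - 1 = r - 2 by ring] at this
  have opp : ∀ x y : ℝ, 0 ≤ x → 0 ≤ y → x ≤ M → y ≤ M →
      x ^ (r - 2) * x + y ^ (r - 2) * y ≤ (r - 1) * M ^ (r - 2) * (x + y) := by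
    intro x y hx hy hxM hyM
    have h1 : x ^ (r - 2) * x ≤ M ^ (r - 2) * x := by gcongr
    have h2 : y ^ (r - 2) * y ≤ M ^ (r - 2) * y := by gcongr
    have h3 : 0 ≤ M ^ (r - 2) * (x + y) := by
      have : 0 ≤ M := hx.trans hxM
      positivity
    nlinarith
  rcases le_total 0 a with h | h <;> rcases le_total 0 b with h' | h'
  · rw [abs_of_nonneg h, abs_of_nonneg h'] at *
    exact pos a b h h' ha hb
  · have := opp a (-b) h (by linarith) ((le_abs_self a).trans ha) ((neg_le_abs b).trans hb)
    rw [abs_of_nonneg h, abs_of_nonpos h', abs_of_nonneg (by linarith : 0 ≤ a - b)]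
    rw [abs_of_nonneg]
    · linarith
    · have h1 : 0 ≤ a ^ (r - 2) * a := by positivity
      have h2 : 0 ≤ (-b) ^ (r - 2) * (-b) := mul_nonneg (Real.rpow_nonneg (by linarith) _)
        (by linarith)
      linarith
  · have := opp (-a) b (by linarith) h' ((neg_le_abs a).trans ha) ((le_abs_self b).trans hb)
    rw [abs_of_nonpos h, abs_of_nonneg h', abs_of_nonpos (by linarith : a - b ≤ 0)]
    rw [abs_of_nonpos]
    · linarith
    · have h1 : 0 ≤ b ^ (r - 2) * b := by positivity
      have h2 : 0 ≤ (-a) ^ (r - 2) * (-a) := mul_nonneg (Real.rpow_nonneg (by linarith) _)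
        (by linarith)
      linarith
  · have := pos (-a) (-b) (by linarith) (by linarith) ((neg_le_abs a).trans ha)
      ((neg_le_abs b).trans hb)
    rw [abs_of_nonpos h, abs_of_nonpos h']
    rw [show -a - -b = -(a - b) by ring, abs_neg] at this
    rw [show (-a) ^ (r - 2) * -a - (-b) ^ (r - 2) * -b
      = -((-a) ^ (r - 2) * a - (-b) ^ (r - 2) * b) by ring, abs_neg] at this
    exact this

theorem abs_rpow_tangent_le {r : ℝ} (hr : 2 ≤ r) (a b : ℝ) :
    |a| ^ r + r * (|a| ^ (r - 2) * a) * (b - a) ≤ |b| ^ r := by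
  rcases le_total 0 a with h | h
  · have := rpow_tangent_le (r := r) (y := b) (by linarith) h
    rw [abs_of_nonneg h, rpow_sub_two_mul hr h]
    exact this
  · have h' : 0 ≤ -a := by linarith
    have := rpow_tangent_le (r := r) (y := -b) (by linarith) h'
    rw [abs_neg, ← rpow_sub_two_mul hr h'] at this
    rw [abs_of_nonpos h]
    linarith

/-- The Taylor remainder is nonnegative by convexity. Adding the tangent inequality at the other
endpoint bounds it by the increment of the derivative times `b - a`, hence quadratically. -/
theorem quadraticTaylor_abs_rpow {r : ℝ} (hr : 2 ≤ r) (hM : 0 ≤ M) :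
    QuadraticTaylor {s | |s| ≤ M} (fun s => |s| ^ r) (fun s => r * (|s| ^ (r - 2) * s))
      (r * ((r - 1) * M ^ (r - 2))) := by
  have hM' : 0 ≤ M ^ (r - 2) := by positivity
  have hr1 : M ^ (r - 2) ≤ (r - 1) * M ^ (r - 2) := by nlinarith
  have hr2 : (r - 1) * M ^ (r - 2) ≤ r * ((r - 1) * M ^ (r - 2)) := by
    nlinarith
  refine ⟨by fun_prop, by fun_prop, fun a ha => ?_, fun a ha => ?_, fun a ha b hb => ?_⟩
  · rw [abs_of_nonneg (by positivity)]
    refine (abs_rpow_le_mul_sq hr ha).trans ?_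
    gcongr
    linarith
  · have := abs_signed_rpow_sub_le (b := 0) hr ha (by simpa using hM)
    rw [mul_zero, sub_zero, sub_zero] at this
    rw [abs_mul, abs_of_nonneg (by linarith : 0 ≤ r), mul_assoc]
    gcongr
  · have h1 := abs_rpow_tangent_le hr a b
    have h2 := abs_rpow_tangent_le hr b a
    have h3 := abs_signed_rpow_sub_le hr hb ha
    rw [abs_of_nonneg (by linarith)]
    calc |b| ^ r - |a| ^ r - r * (|a| ^ (r - 2) * a) * (b - a)
        ≤ r * ((|b| ^ (r - 2) * b - |a| ^ (r - 2) * a) * (b - a)) := by linarith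
      _ ≤ r * (|(|b| ^ (r - 2) * b - |a| ^ (r - 2) * a)| * |b - a|) := by
          rw [← abs_mul]
          exact mul_le_mul_of_nonneg_left (le_abs_self _) (by linarith)
      _ ≤ r * ((r - 1) * M ^ (r - 2) * |b - a| * |b - a|) := by gcongr
      _ = _ := by rw [← sq_abs (b - a)]; ring

theorem abs_abs_rpow_sub_le {r : ℝ} (hr : 1 ≤ r) (ha : |a| ≤ M) (hb : |b| ≤ M) :
    |(|a| ^ r - |b| ^ r)| ≤ r * M ^ (r - 1) * |a - b| := by
  have hM : 0 ≤ M := (abs_nonneg a).trans ha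
  refine (abs_rpow_sub_rpow_le hr (abs_nonneg a) (abs_nonneg b) ha hb).trans ?_
  exact mul_le_mul_of_nonneg_left (abs_abs_sub_abs_le a b) (by positivity)

theorem abs_abs_rpow_sub_le_mul {r : ℝ} (hr : 2 ≤ r) (ha : |a| ≤ M) (hb : |b| ≤ M) :
    |(|b| ^ r - |a| ^ r)| ≤ r * M ^ (r - 2) * (|b - a| * (|b| + |a|)) := by
  have hM : 0 ≤ M := (abs_nonneg a).trans ha
  set c := max |a| |b|
  have hc : 0 ≤ c := (abs_nonneg a).trans (le_max_left _ _)
  have h1 := abs_abs_rpow_sub_le (M := c) (r := r) (by linarith) (le_max_right |a| |b|)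
    (le_max_left _ _)
  refine h1.trans ?_
  rw [← rpow_sub_two_mul hr hc]
  have h2 : c ^ (r - 2) ≤ M ^ (r - 2) := Real.rpow_le_rpow hc (max_le ha hb) (by linarith)
  have h3 : c ≤ |b| + |a| := max_le (by linarith [abs_nonneg b]) (by linarith [abs_nonneg a])
  calc r * (c ^ (r - 2) * c) * |b - a| = r * c ^ (r - 2) * (|b - a| * c) := by ring
    _ ≤ _ := by gcongr

/-- The function `|s|^r log |s|` on `[-M, M]`, `r > 2`: quadratic bound. -/
theorem abs_rpow_log_le_sq {r : ℝ} (hr : 2 < r) (ha : |a| ≤ M) :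
    |(|a| ^ r * Real.log |a|)| ≤ (r - 2)⁻¹ * (1 + (M ^ (r - 2)) ^ 2) * a ^ 2 := by
  have h := abs_rpow_log_le (η := r - 2) (by linarith) (abs_nonneg a) ha
  have e : |a| ^ r = |a| ^ 2 * |a| ^ (r - 2) := by
    rw [← Real.rpow_two, ← rpow_split (abs_nonneg a) (by norm_num) (by linarith)]; congr 1; ring
  rw [e, mul_assoc, abs_mul, sq_abs, abs_of_nonneg (sq_nonneg a), mul_comm]
  gcongr

theorem abs_rpow_log_sub_le {r : ℝ} (hr : 2 < r) (ha : |a| ≤ M) (hb : |b| ≤ M) :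
    |(|b| ^ r * Real.log |b| - |a| ^ r * Real.log |a|)|
      ≤ (r * ((r - 2)⁻¹ * (1 + (M ^ (r - 2)) ^ 2)) + M ^ (r - 2)) * (|b - a| * (|b| + |a|)) := by
  have hM : 0 ≤ M := (abs_nonneg a).trans ha
  have pos : ∀ x y : ℝ, 0 ≤ x → x ≤ y → y ≤ M →
      |y ^ r * Real.log y - x ^ r * Real.log x|
        ≤ (r * ((r - 2)⁻¹ * (1 + (M ^ (r - 2)) ^ 2)) + M ^ (r - 2)) * ((y - x) * y) := by
    intro x y hx hxy hyM
    have hy : 0 ≤ y := hx.trans hxy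
    have h1 : |(y ^ r - x ^ r) * Real.log y|
        ≤ r * ((r - 2)⁻¹ * (1 + (M ^ (r - 2)) ^ 2)) * ((y - x) * y) := by
      have h2 := abs_rpow_sub_rpow_le (M := y) (r := r) (by linarith) hy hx le_rfl hxy
      have h3 := abs_rpow_log_le (η := r - 2) (by linarith) hy hyM
      have h4 : 0 ≤ y ^ (r - 2) := by positivity
      rw [abs_mul, abs_of_nonneg h4] at h3
      rw [abs_of_nonneg (by linarith : 0 ≤ y - x)] at h2
      rw [abs_mul]
      have h5 : 0 ≤ (y - x) * y := mul_nonneg (by linarith) hy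
      calc _ ≤ r * y ^ (r - 1) * (y - x) * |Real.log y| := by gcongr
        _ = r * (y ^ (r - 2) * |Real.log y|) * ((y - x) * y) := by
            rw [← rpow_sub_two_mul hr.le hy]; ring
        _ ≤ _ := by gcongr
    have h6 : |x ^ r * (Real.log y - Real.log x)| ≤ M ^ (r - 2) * ((y - x) * y) := by
      rcases hx.eq_or_lt with rfl | hx0
      · rw [Real.zero_rpow (by linarith)]; simp; positivity
      · have hy0 : 0 < y := hx0.trans_le hxy
        have h7 := Real.log_le_sub_one_of_pos (div_pos hy0 hx0)
        rw [Real.log_div hy0.ne' hx0.ne'] at h7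
        have h8 := Real.log_le_log hx0 hxy
        rw [abs_of_nonneg (mul_nonneg (by positivity) (by linarith))]
        have e : x ^ r = x ^ (r - 2) * x * x := by
          rw [rpow_sub_two_mul hr.le hx, ← Real.rpow_add_one hx0.ne']; simp
        have h9 : x ^ (r - 2) ≤ M ^ (r - 2) :=
          Real.rpow_le_rpow hx (hxy.trans hyM) (by linarith)
        have h10 : 0 ≤ x ^ (r - 2) := by positivity
        have h11 : 0 ≤ y - x := by linarith
        calc x ^ r * (Real.log y - Real.log x) ≤ x ^ r * (y / x - 1) := by gcongr
          _ = x ^ (r - 2) * ((y - x) * x) := by rw [e]; field_simp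
          _ ≤ _ := by gcongr
    have e : y ^ r * Real.log y - x ^ r * Real.log x
        = (y ^ r - x ^ r) * Real.log y + x ^ r * (Real.log y - Real.log x) := by ring
    rw [e]
    refine (abs_add_le _ _).trans ?_
    rw [add_mul]
    exact add_le_add h1 h6
  set K := r * ((r - 2)⁻¹ * (1 + (M ^ (r - 2)) ^ 2)) + M ^ (r - 2)
  have hK : 0 ≤ K := by
    have : 0 < r - 2 := by linarith
    positivity
  have hab := abs_abs_sub_abs_le b a
  rcases le_total |a| |b| with h | h
  · refine (pos _ _ (abs_nonneg a) h hb).trans ?_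
    rw [abs_of_nonneg (by linarith : 0 ≤ |b| - |a|)] at hab
    gcongr
    linarith [abs_nonneg a]
  · rw [abs_sub_comm]
    refine (pos _ _ (abs_nonneg b) h ha).trans ?_
    rw [abs_of_nonpos (by linarith : |b| - |a| ≤ 0)] at hab
    gcongr
    · linarith
    · linarith [abs_nonneg b]

theorem abs_exp_sub_one_sub_le (y : ℝ) : |Real.exp y - 1 - y| ≤ y ^ 2 * max 1 (Real.exp y) := by
  have h4 := Real.add_one_le_exp y
  have h5 : Real.exp y - 1 ≤ y * Real.exp y := by
    have h := Real.add_one_le_exp (-y)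
    have h' : Real.exp (-y) * Real.exp y = 1 := by rw [← Real.exp_add]; simp
    have := Real.exp_pos y
    nlinarith
  rw [abs_of_nonneg (by linarith)]
  rcases le_total 0 y with h | h
  · have h6 : Real.exp y ≤ max 1 (Real.exp y) := le_max_right _ _
    have := mul_le_mul_of_nonneg_left h6 (sq_nonneg y)
    nlinarith
  · have h6 : 1 ≤ max 1 (Real.exp y) := le_max_left _ _
    have := mul_le_mul_of_nonneg_left h6 (sq_nonneg y)
    nlinarith

/-- Taylor expansion of `r ↦ |a|^r`, uniformly for `|a| ≤ M`. -/
theorem abs_rpow_taylor_exponent_le {r s : ℝ} (hr : 2 < r) (hM : 1 ≤ M) (ha : |a| ≤ M)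
    (hs1 : (r + 2) / 2 ≤ s) (hs2 : s ≤ r + 1) :
    |(|a| ^ s - |a| ^ r - (s - r) * (|a| ^ r * Real.log |a|))|
      ≤ M ^ (r + 1) * (((r - 2) / 4)⁻¹ * (1 + (M ^ ((r - 2) / 4)) ^ 2)) ^ 2 * (s - r) ^ 2 * a ^ 2 := by
  have hη : 0 < (r - 2) / 4 := by linarith
  have hM0 : 0 < M := by linarith
  rcases (abs_nonneg a).eq_or_lt with h | h
  · rw [← h, Real.zero_rpow (by linarith), Real.zero_rpow (by linarith)]
    simp; positivity
  set t := |a| with ht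
  -- Chosen so that `t^((r+2)/2) = t² (t^η)²`: over the range of exponents one keeps `t²` for
  -- integrability and two factors `t^η` for the square of the logarithm.
  set η := (r - 2) / 4 with hη'
  set K := η⁻¹ * (1 + (M ^ η) ^ 2)
  have e : t ^ s = t ^ r * Real.exp ((s - r) * Real.log t) := by
    rw [mul_comm (s - r), ← Real.rpow_def_of_pos h, ← Real.rpow_add h]; congr 1; ring
  have hpow : ∀ c, (r + 2) / 2 ≤ c → c ≤ r + 1 → t ^ c ≤ M ^ (r + 1) * (t ^ 2 * (t ^ η) ^ 2) := by
    intro c h1 h2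
    have e1 : t ^ c = t ^ (c - (r + 2) / 2) * (t ^ 2 * (t ^ η) ^ 2) := by
      rw [← Real.rpow_two, ← Real.rpow_two, ← Real.rpow_mul h.le, ← Real.rpow_add h,
        ← Real.rpow_add h]
      congr 1; rw [hη']; ring
    rw [e1]
    have h3 : t ^ (c - (r + 2) / 2) ≤ M ^ (c - (r + 2) / 2) :=
      Real.rpow_le_rpow h.le ha (by linarith)
    have h4 : M ^ (c - (r + 2) / 2) ≤ M ^ (r + 1) :=
      Real.rpow_le_rpow_of_exponent_le hM (by linarith)
    gcongr
    exact h3.trans h4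
  have hmax : t ^ r * max 1 (Real.exp ((s - r) * Real.log t))
      ≤ M ^ (r + 1) * (t ^ 2 * (t ^ η) ^ 2) := by
    rw [mul_max_of_nonneg _ _ (by positivity), mul_one, ← e]
    exact max_le (hpow r (by linarith) (by linarith)) (hpow s hs1 hs2)
  have hlog := abs_rpow_log_le hη h.le ha
  have hlog2 : (t ^ η * Real.log t) ^ 2 ≤ K ^ 2 := by
    rw [← sq_abs]; gcongr
  have e2 : t ^ s - t ^ r - (s - r) * (t ^ r * Real.log t)
      = t ^ r * (Real.exp ((s - r) * Real.log t) - 1 - (s - r) * Real.log t) := by rw [e]; ring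
  rw [e2, abs_mul, abs_of_nonneg (by positivity : 0 ≤ t ^ r)]
  calc _ ≤ t ^ r * (((s - r) * Real.log t) ^ 2 * max 1 (Real.exp ((s - r) * Real.log t))) := by
        gcongr; exact abs_exp_sub_one_sub_le _
    _ = ((s - r) * Real.log t) ^ 2 * (t ^ r * max 1 (Real.exp ((s - r) * Real.log t))) := by ring
    _ ≤ ((s - r) * Real.log t) ^ 2 * (M ^ (r + 1) * (t ^ 2 * (t ^ η) ^ 2)) := by gcongr
    _ = M ^ (r + 1) * (t ^ η * Real.log t) ^ 2 * (s - r) ^ 2 * t ^ 2 := by ring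
    _ ≤ M ^ (r + 1) * K ^ 2 * (s - r) ^ 2 * t ^ 2 := by gcongr
    _ = _ := by rw [ht, sq_abs]

end PowerEstimates

/-! ### The integrals `∫ |w r|^r` with moving exponent and moving function. -/

section PowerIntegrals

variable {α : Type*} [MeasurableSpace α] {μ : Measure α}

/-- The pointwise increment bound is integrated with Cauchy–Schwarz. -/
theorem abs_integral_comp_sub_le {θ : ℝ → ℝ} {I : Set ℝ} {K : ℝ} (hθ : Measurable θ)
    (h0 : ∃ L, ∀ a ∈ I, |θ a| ≤ L * a ^ 2) (hK : 0 ≤ K)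
    (hθK : ∀ a ∈ I, ∀ b ∈ I, |θ b - θ a| ≤ K * (|b - a| * (|b| + |a|)))
    (v w : Lp ℝ 2 μ) (hv : ∀ᵐ x ∂μ, v x ∈ I) (hw : ∀ᵐ x ∂μ, w x ∈ I) :
    |∫ x, θ (v x) ∂μ - ∫ x, θ (w x) ∂μ| ≤ K * (‖v - w‖ * (‖v‖ + ‖w‖)) := by
  obtain ⟨L, hL⟩ := h0
  have hi : ∀ z : Lp ℝ 2 μ, (∀ᵐ x ∂μ, z x ∈ I) → Integrable (fun x => θ (z x)) μ := fun z hz =>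
    ((integrable_sq_coeFn z).const_mul L).mono'
      (hθ.comp_aemeasurable (Lp.aestronglyMeasurable z).aemeasurable).aestronglyMeasurable
      (hz.mono fun x hx => hL _ hx)
  have hin : ∀ y z : Lp ℝ 2 μ, Integrable (fun x => |y x| * |z x|) μ ∧
      ∫ x, |y x| * |z x| ∂μ ≤ ‖y‖ * ‖z‖ := by
    intro y z
    have h1 := L2.integrable_inner (𝕜 := ℝ) |y| |z|
    have e : (fun x => inner ℝ (|y| x) (|z| x)) =ᵐ[μ] fun x => |y x| * |z x| := by
      filter_upwards [Lp.coeFn_abs y, Lp.coeFn_abs z] with x h2 h3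
      rw [h2, h3]; simp [mul_comm]
    refine ⟨h1.congr e, ?_⟩
    rw [← integral_congr_ae e, ← L2.inner_def]
    exact (real_inner_le_norm |y| |z|).trans_eq (by rw [norm_abs_eq_norm, norm_abs_eq_norm])
  have hvw := hin (v - w) v
  have hvw' := hin (v - w) w
  rw [← integral_sub (hi v hv) (hi w hw)]
  calc |∫ x, (θ (v x) - θ (w x)) ∂μ| ≤ ∫ x, |θ (v x) - θ (w x)| ∂μ := abs_integral_le_integral_abs
    _ ≤ ∫ x, K * (|(v - w) x| * |v x| + |(v - w) x| * |w x|) ∂μ := by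
        refine integral_mono_ae ((hi v hv).sub (hi w hw)).abs
          ((hvw.1.add hvw'.1).const_mul K) ?_
        filter_upwards [hv, hw, Lp.coeFn_sub v w] with x h1 h2 h3
        rw [h3, Pi.sub_apply, ← mul_add]
        exact hθK _ h2 _ h1
    _ = K * (∫ x, |(v - w) x| * |v x| ∂μ + ∫ x, |(v - w) x| * |w x| ∂μ) := by
        rw [integral_const_mul, integral_add hvw.1 hvw'.1]
    _ ≤ K * (‖v - w‖ * ‖v‖ + ‖v - w‖ * ‖w‖) := by
        gcongr
        · exact hvw.2
        · exact hvw'.2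
    _ = _ := by ring

variable {M : ℝ}

theorem integrable_abs_rpow_of_bounded {r : ℝ} (hr : 2 ≤ r) (v : Lp ℝ 2 μ)
    (hv : ∀ᵐ x ∂μ, |v x| ≤ M) : Integrable (fun x => |v x| ^ r) μ :=
  (integrable_abs_rpow_iff (by linarith) (Lp.aestronglyMeasurable _)).2
    (MemLp.ofReal_of_bounded (Lp.memLp v) hr hv)

theorem measurable_abs_rpow_log (r : ℝ) : Measurable fun s : ℝ => |s| ^ r * Real.log |s| := by
  have : Measurable fun s : ℝ => |s| := continuous_abs.measurable
  exact (this.pow_const r).mul (Real.measurable_log.comp this)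

theorem integrable_abs_rpow_log {r : ℝ} (hr : 2 < r) (v : Lp ℝ 2 μ)
    (hv : ∀ᵐ x ∂μ, |v x| ≤ M) : Integrable (fun x => |v x| ^ r * Real.log |v x|) μ := by
  refine ((integrable_sq_coeFn v).const_mul _).mono'
    ((measurable_abs_rpow_log r).comp_aemeasurable
      (Lp.aestronglyMeasurable v).aemeasurable).aestronglyMeasurable
    (hv.mono fun x hx => abs_rpow_log_le_sq hr hx)

/-- Derivative of `r ↦ ∫ |w r|^r` for an `L²`-differentiable curve of bounded functions. -/
theorem hasDerivAt_integral_abs_rpow {r : ℝ} (hr : 2 < r) (hM : 1 ≤ M) {w : ℝ → Lp ℝ 2 μ}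
    {d : Lp ℝ 2 μ} (hw : HasDerivAt w d r) (hwM : ∀ s, ∀ᵐ x ∂μ, |w s x| ≤ M) :
    HasDerivAt (fun s => ∫ x, |w s x| ^ s ∂μ)
      (∫ x, |w r x| ^ r * Real.log |w r x| ∂μ
        + ∫ x, r * (|w r x| ^ (r - 2) * w r x) * d x ∂μ) r := by
  have hM0 : 0 ≤ M := by linarith
  have h1 := (quadraticTaylor_abs_rpow hr.le hM0).hasDerivAt hw hwM
  set Λ : ℝ → ℝ := fun s => ∫ x, |w s x| ^ r * Real.log |w s x| ∂μ with hΛ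
  set K := M ^ (r + 1) * (((r - 2) / 4)⁻¹ * (1 + (M ^ ((r - 2) / 4)) ^ 2)) ^ 2 with hK
  have hK0 : 0 ≤ K := by rw [hK]; positivity
  have hwc : Tendsto w (𝓝 r) (𝓝 (w r)) := hw.continuousAt
  have hΛc : Tendsto (fun s => Λ s - Λ r) (𝓝 r) (𝓝 0) := by
    set K' := r * ((r - 2)⁻¹ * (1 + (M ^ (r - 2)) ^ 2)) + M ^ (r - 2)
    have hK' : 0 ≤ K' := by
      have : 0 < r - 2 := by linarith
      positivity
    have hb : ∀ s, ‖Λ s - Λ r‖ ≤ K' * (‖w s - w r‖ * (‖w s‖ + ‖w r‖)) := fun s =>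
      abs_integral_comp_sub_le (measurable_abs_rpow_log r) (I := {s | |s| ≤ M})
        ⟨_, fun a ha => abs_rpow_log_le_sq hr ha⟩ hK'
        (fun a ha b hb => abs_rpow_log_sub_le hr ha hb) (w s) (w r) (hwM s) (hwM r)
    refine squeeze_zero_norm hb ?_
    have h0 : Tendsto (fun s => ‖w s - w r‖) (𝓝 r) (𝓝 0) :=
      tendsto_iff_norm_sub_tendsto_zero.1 hwc
    simpa using (h0.mul (hwc.norm.add_const ‖w r‖)).const_mul K'
  -- The change of exponent is expanded at the moving function `w s`, giving `(s - r) Λ s` up to a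
  -- quadratic error; continuity of `Λ` replaces `Λ s` by `Λ r`.
  have h2 : HasDerivAt (fun s => ∫ x, |w s x| ^ s ∂μ - ∫ x, |w s x| ^ r ∂μ) (Λ r) r := by
    rw [hasDerivAt_iff_isLittleO]
    have ho1 : (fun s => (s - r) * (Λ s - Λ r)) =o[𝓝 r] fun s => s - r := by
      simpa using (Asymptotics.isBigO_refl (fun s : ℝ => s - r) (𝓝 r)).mul_isLittleO
        ((Asymptotics.isLittleO_one_iff ℝ).2 hΛc)
    have ho2 : (fun s => ∫ x, |w s x| ^ s ∂μ - ∫ x, |w s x| ^ r ∂μ - (s - r) * Λ s)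
        =o[𝓝 r] fun s => s - r := by
      have h0 : Tendsto (fun s => K * ‖w s‖ ^ 2 * (s - r)) (𝓝 r) (𝓝 0) := by
        have hc : Tendsto (fun s : ℝ => s - r) (𝓝 r) (𝓝 0) := by
          have : Continuous fun s : ℝ => s - r := by fun_prop
          simpa using this.tendsto r
        simpa using ((hwc.norm.pow 2).const_mul K).mul hc
      have hlo : (fun s => K * ‖w s‖ ^ 2 * (s - r) * (s - r)) =o[𝓝 r] fun s => s - r := by
        simpa using ((Asymptotics.isLittleO_one_iff ℝ).2 h0).mul_isBigO
          (Asymptotics.isBigO_refl (fun s : ℝ => s - r) (𝓝 r))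
      refine Asymptotics.IsBigO.trans_isLittleO (Asymptotics.IsBigO.of_bound 1 ?_) hlo
      filter_upwards [lt_mem_nhds (show (r + 2) / 2 < r by linarith),
        gt_mem_nhds (show r < r + 1 by linarith)] with s hs1 hs2
      have i1 := integrable_abs_rpow_of_bounded (r := s) (by linarith) (w s) (hwM s)
      have i2 := integrable_abs_rpow_of_bounded hr.le (w s) (hwM s)
      have i3 := (integrable_abs_rpow_log hr (w s) (hwM s)).const_mul (s - r)
      have i12 : Integrable (fun x => |w s x| ^ s - |w s x| ^ r) μ := i1.sub i2
      rw [hΛ]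
      simp only
      rw [← integral_const_mul, ← integral_sub i1 i2, ← integral_sub i12 i3, one_mul]
      have e : K * ‖w s‖ ^ 2 * (s - r) * (s - r) = ∫ x, K * (s - r) ^ 2 * w s x ^ 2 ∂μ := by
        rw [integral_const_mul, integral_sq_eq_norm_sq]; ring
      rw [e, Real.norm_eq_abs]
      refine (abs_integral_le_integral_abs.trans ?_).trans (le_abs_self _)
      refine integral_mono_ae (i12.sub i3).abs ((integrable_sq_coeFn _).const_mul _) ?_
      filter_upwards [hwM s] with x hx
      exact abs_rpow_taylor_exponent_le hr hM hx hs1.le hs2.le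
    refine (ho1.add ho2).congr_left fun s => ?_
    simp only [smul_eq_mul, sub_self, sub_zero]
    ring
  have h3 := h2.add h1
  refine h3.congr_of_eventuallyEq (Eventually.of_forall fun s => ?_)
  simp

/-- Continuity of `r ↦ ∫ |w r|^r` at `p ≥ 2`, from the right. -/
theorem tendsto_integral_abs_rpow {p : ℝ} (hp : 2 ≤ p) (hM : 1 ≤ M) {w : ℝ → Lp ℝ 2 μ}
    (hw : Tendsto w (𝓝[>] p) (𝓝 (w p))) (hwM : ∀ s, ∀ᵐ x ∂μ, |w s x| ≤ M) :
    Tendsto (fun s => ∫ x, |w s x| ^ s ∂μ) (𝓝[>] p) (𝓝 (∫ x, |w p x| ^ p ∂μ)) := by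
  have hid : Tendsto (fun s : ℝ => s) (𝓝[>] p) (𝓝 p) := nhdsWithin_le_nhds
  have hlt : ∀ᶠ s in 𝓝[>] p, s < p + 1 := hid.eventually (gt_mem_nhds (by linarith))
  -- No logarithm is differentiated here, so `p = 2` is allowed: the exponent moves at the fixed
  -- function `w p`, and the change of function is estimated separately in `h2`.
  have h1 : Tendsto (fun s => ∫ x, |w p x| ^ s ∂μ) (𝓝[>] p) (𝓝 (∫ x, |w p x| ^ p ∂μ)) := by
    refine tendsto_integral_filter_of_dominated_convergence (fun x => M ^ (p - 1) * w p x ^ 2)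
      ?_ ?_ ((integrable_sq_coeFn _).const_mul _) ?_
    · filter_upwards [self_mem_nhdsWithin] with s hs
      exact (integrable_abs_rpow_of_bounded (hp.trans (le_of_lt hs)) (w p)
        (hwM p)).aestronglyMeasurable
    · filter_upwards [self_mem_nhdsWithin, hlt] with s hs hs'
      have hs : p < s := hs
      filter_upwards [hwM p] with x hx
      rw [Real.norm_of_nonneg (by positivity)]
      have h : M ^ (s - 2) ≤ M ^ (p - 1) := Real.rpow_le_rpow_of_exponent_le hM (by linarith)
      exact (abs_rpow_le_mul_sq (by linarith) hx).trans (by gcongr)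
    · refine Eventually.of_forall fun x => ?_
      exact ((Real.continuousAt_const_rpow' (by linarith)).tendsto).comp hid
  have h2 : Tendsto (fun s => ∫ x, |w s x| ^ s ∂μ - ∫ x, |w p x| ^ s ∂μ) (𝓝[>] p) (𝓝 0) := by
    refine squeeze_zero_norm' (a := fun s => (p + 1) * M ^ (p - 1) *
      (‖w s - w p‖ * (‖w s‖ + ‖w p‖))) ?_ ?_
    · filter_upwards [self_mem_nhdsWithin, hlt] with s hs hs'
      have hs : p < s := hs
      have hs2 : 2 ≤ s := by linarith
      refine abs_integral_comp_sub_le (θ := fun a => |a| ^ s) (I := {a | |a| ≤ M}) (by fun_prop)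
        ⟨M ^ (s - 2), fun a ha => ?_⟩ (by positivity) (fun a ha b hb => ?_) (w s) (w p)
        (hwM s) (hwM p)
      · rw [abs_of_nonneg (by positivity)]
        exact abs_rpow_le_mul_sq hs2 ha
      · have h : M ^ (s - 2) ≤ M ^ (p - 1) := Real.rpow_le_rpow_of_exponent_le hM (by linarith)
        exact (abs_abs_rpow_sub_le_mul hs2 ha hb).trans (by gcongr)
    · have h0 : Tendsto (fun s => ‖w s - w p‖) (𝓝[>] p) (𝓝 0) :=
        tendsto_iff_norm_sub_tendsto_zero.1 hw
      simpa using (h0.mul (hw.norm.add_const ‖w p‖)).const_mul ((p + 1) * M ^ (p - 1))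
  simpa using h2.add h1

end PowerIntegrals

end StrongHyper

namespace StrongHyper

/-! ### Hypercontractivity for bounded data. -/

section BoundedData

variable {N : ℕ} {J : RN N → RN N → ℝ} {M r : ℝ} {v : RN N → ℝ}

theorem MemEnergySpace.abs_rpow (hv : MemEnergySpace J v) (hJ : IsLevyKernel J) (hM : 0 ≤ M)
    (hvM : ∀ᵐ x, |v x| ≤ M) (hr : 1 ≤ r) : MemEnergySpace J fun x => |v x| ^ r := by
  refine hv.of_lipschitz (K := r * M ^ (r - 1)) hJ
    (((Real.continuous_rpow_const (by linarith)).comp continuous_abs).comp_aestronglyMeasurable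
      hv.1.1) ?_ ?_
  · filter_upwards [hvM] with x hx
    have := abs_abs_rpow_sub_le (b := 0) hr hx (by simpa using hM)
    simpa [Real.zero_rpow (by linarith : r ≠ 0)] using this
  · filter_upwards [ae_jump_of_ae hvM] with z hz
    exact abs_abs_rpow_sub_le hr hz.1 hz.2

theorem MemEnergySpace.signed_rpow (hv : MemEnergySpace J v) (hJ : IsLevyKernel J) (hM : 0 ≤ M)
    (hvM : ∀ᵐ x, |v x| ≤ M) (hr : 2 ≤ r) : MemEnergySpace J fun x => |v x| ^ (r - 2) * v x := by
  refine hv.of_lipschitz (K := (r - 1) * M ^ (r - 2)) hJ ?_ ?_ ?_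
  · exact (((Real.continuous_rpow_const (by linarith)).comp
      continuous_abs).comp_aestronglyMeasurable hv.1.1).mul hv.1.1
  · filter_upwards [hvM] with x hx
    have := abs_signed_rpow_sub_le (b := 0) hr hx (by simpa using hM)
    simpa using this
  · filter_upwards [ae_jump_of_ae hvM] with z hz
    exact abs_signed_rpow_sub_le hr hz.1 hz.2

/-- For bounded functions of finite energy and integrable `Φ(|v|^r)` every extended-real term is
finite, so the inequality can be used in `ℝ`. -/
theorem LogSobolev.integral_entFun_le {C D : ℝ} (h : LogSobolev J r C D) (hJ : IsLevyKernel J)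
    (hr : 2 < r) (hM : 0 ≤ M) (hv : MemEnergySpace J v) (hvM : ∀ᵐ x, |v x| ≤ M)
    (hi : Integrable fun x => entFun (|v x| ^ r)) :
    ∫ x, entFun (|v x| ^ r) ≤ entFun (∫ x, |v x| ^ r) + C * (∫ x, |v x| ^ r)
      + D * realForm J (fun x => |v x| ^ (r - 2) * v x) v := by
  have h1 := (h.2 v hv.1.1 (hv.abs_rpow hJ hM hvM (by linarith))).2
  have habs : ∀ x, |(|v x| ^ r)| = |v x| ^ r := fun x => abs_of_nonneg (by positivity)
  unfold entropy at h1
  simp only [habs] at h1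
  rw [ereal_coe_sub_eq_integral hi, dirichletForm_eq_coe hJ
    (integrable_incr_mul hJ (hv.signed_rpow hJ hM hvM hr.le) hv), ← EReal.coe_sub, ← EReal.coe_mul,
    ← EReal.coe_add, EReal.coe_le_coe_iff] at h1
  linarith

variable {u₀ : Lp ℝ 2 (volume : Measure (RN N))} {u : ℝ → Lp ℝ 2 (volume : Measure (RN N))}

/-- Hypercontractivity along a bounded mild solution, with the exponent as the parameter. -/
theorem IsMildSolution.integral_rpow_le {p s : ℝ} {C D H : ℝ → ℝ} (hu : IsMildSolution J u₀ u)
    (hJ : IsLevyKernel J) (hM : 1 ≤ M) (h0 : ∀ᵐ x, |u₀ x| ≤ M) (hp : 2 ≤ p) (hps : p ≤ s)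
    (hC : IntegrableOn C (Icc p s)) (hLS : ∀ r ∈ Ici p, LogSobolev J r (C r) (D r))
    (hHp : H p = 0) (hH : StrictMonoOn H (Ici p))
    (hHd : ∀ r ∈ Ici p, HasDerivAt H (D r / r ^ 2) r) :
    (∫ x, |u (H s) x| ^ s) ^ s⁻¹
      ≤ Real.exp (∫ r in p..s, C r / r ^ 2) * (∫ x, |u₀ x| ^ p) ^ p⁻¹ := by
  have hM0 : 0 ≤ M := by linarith
  have hH0 : ∀ r ∈ Ici p, 0 ≤ H r := fun r hr => hHp ▸ hH.monotoneOn self_mem_Ici hr hr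
  have hHpos : ∀ r ∈ Ioi p, 0 < H r := fun r hr =>
    hHp ▸ hH self_mem_Ici (mem_Ici.2 (le_of_lt hr)) hr
  have hs0 : 0 < s := by linarith
  -- The `L²` norm does not increase, so `u (H s) ≠ 0` makes `u (H r)` nonzero for all `r ≤ s`, and
  -- the logarithm of `F` is legitimate.
  by_cases hz : u (H s) = 0
  · have e : ∫ x, |u (H s) x| ^ s = 0 := by
      refine integral_eq_zero_of_ae ?_
      filter_upwards [(Lp.eq_zero_iff_ae_eq_zero).1 hz] with x hx
      simp [hx, Real.zero_rpow hs0.ne']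
    rw [e, Real.zero_rpow (inv_ne_zero hs0.ne')]
    have : 0 ≤ ∫ x, |u₀ x| ^ p := integral_nonneg fun x => by positivity
    positivity
  -- the curve, truncated to nonnegative times
  set w : ℝ → Lp ℝ 2 (volume : Measure (RN N)) := fun r => u (max (H r) 0) with hw
  have hwM : ∀ r, ∀ᵐ x, |w r x| ≤ M := fun r => hu.abs_le hJ hM0 h0 (le_max_right _ _)
  have hwH : ∀ r ∈ Ici p, w r = u (H r) := fun r hr => by
    simp only [hw, max_eq_left (hH0 r hr)]
  have hwp : w p = u₀ := by rw [hwH p self_mem_Ici, hHp, hu.initial]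
  set F : ℝ → ℝ := fun r => ∫ x, |w r x| ^ r with hF
  have hFpos : ∀ r ∈ Icc p s, 0 < F r := by
    intro r hr
    have hr0 : 0 < r := by linarith [hr.1]
    have h1 := hu.antitoneOn_norm hJ (hH0 r hr.1) (hH0 s hps)
      (hH.monotoneOn hr.1 (mem_Ici.2 hps) hr.2)
    have hne : u (H r) ≠ 0 := by
      intro h
      simp only [h, norm_zero] at h1
      exact hz (norm_le_zero_iff.1 h1)
    have hi := integrable_abs_rpow_of_bounded (r := r) (by linarith [hr.1]) (w r) (hwM r)
    have h2 : 0 ≤ F r := integral_nonneg fun x => by positivity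
    refine h2.lt_of_ne' fun h3 => hne ?_
    rw [hF] at h3
    simp only at h3
    rw [integral_eq_zero_iff_of_nonneg (fun x => by positivity) hi, hwH r hr.1] at h3
    rw [Lp.eq_zero_iff_ae_eq_zero]
    filter_upwards [h3] with x hx
    simpa using (Real.rpow_eq_zero (abs_nonneg _) hr0.ne').1 hx
  -- derivative of `F`
  have hFd : ∀ r ∈ Ioc p s, ∃ F', HasDerivAt F F' r ∧
      F' ≤ r⁻¹ * (F r * Real.log (F r) + C r * F r) := by
    intro r hr
    have hr2 : 2 < r := by linarith [hr.1]
    have hrp : r ∈ Ici p := hr.1.le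
    have ht := hHpos r hr.1
    have hwd : HasDerivAt w ((D r / r ^ 2) • deriv u (H r)) r := by
      have h1 := (hu.hasDerivAt ht).scomp r (hHd r hrp)
      refine h1.congr_of_eventuallyEq ?_
      filter_upwards [(hHd r hrp).continuousAt.eventually (lt_mem_nhds ht)] with y hy
      simp only [hw, Function.comp, max_eq_left hy.le]
    -- With speed `H' = D/r²` the derivative equals `r⁻¹ (∫ Φ(|w|^r) - D 𝓔(|w|^(r-2) w, w))`, which
    -- is the quantity bounded by the logarithmic Sobolev inequality at exponent `r`.
    refine ⟨_, hasDerivAt_integral_abs_rpow hr2 hM hwd hwM, ?_⟩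
    have hum : MemEnergySpace J (w r) := by
      rw [hwH r hrp]; exact hu.memEnergySpace _ ht
    have hg := hum.signed_rpow hJ hM0 (hwM r) hr2.le
    have hform := hu.realForm_eq_integral hJ ht hg
    rw [← hwH r hrp] at hform
    have hilog := integrable_abs_rpow_log hr2 (w r) (hwM r)
    have eent : ∀ x, entFun (|w r x| ^ r) = r * (|w r x| ^ r * Real.log |w r x|) := by
      intro x
      simp only [entFun]
      rcases (abs_nonneg (w r x)).eq_or_lt with h | h
      · rw [← h, Real.zero_rpow (by linarith)]; simp
      · rw [Real.log_rpow h]; ring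
    have hient : Integrable fun x => entFun (|w r x| ^ r) := by
      simp only [eent]; exact hilog.const_mul r
    have hls := (hLS r hrp).integral_entFun_le hJ hr2 hM0 hum (hwM r) hient
    simp only [eent] at hls
    rw [integral_const_mul, realForm_comm, hform] at hls
    have e2 : ∫ x, r * (|w r x| ^ (r - 2) * w r x) * ((D r / r ^ 2) • deriv u (H r)
        : Lp ℝ 2 (volume : Measure (RN N))) x
        = D r / r * ∫ x, |w r x| ^ (r - 2) * w r x * deriv u (H r) x := by
      rw [← integral_const_mul]
      refine integral_congr_ae ?_
      filter_upwards [Lp.coeFn_smul (D r / r ^ 2) (deriv u (H r))] with x hx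
      rw [hx, Pi.smul_apply, smul_eq_mul]
      have : r ≠ 0 := by linarith
      field_simp
    rw [e2, inv_mul_eq_div, le_div_iff₀ (by linarith)]
    have hr0 : r ≠ 0 := by linarith
    have e4 : D r / r * (∫ x, |w r x| ^ (r - 2) * w r x * deriv u (H r) x) * r
        = D r * ∫ x, |w r x| ^ (r - 2) * w r x * deriv u (H r) x := by field_simp
    rw [add_mul, e4]
    unfold entFun at hls
    linarith
  -- the logarithm of the norm
  choose! F' hF' hF'le using hFd
  set G : ℝ → ℝ := fun r => r⁻¹ * Real.log (F r) with hG
  have hGd : ∀ r ∈ Ioc p s, HasDerivAt G (-(r ^ 2)⁻¹ * Real.log (F r) + r⁻¹ * (F' r / F r)) r :=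
    fun r hr => (hasDerivAt_inv (by linarith [hr.1] : r ≠ 0)).mul
      ((hF' r hr).log (hFpos r ⟨hr.1.le, hr.2⟩).ne')
  -- The `log F` coming from the entropy of the mass cancels the derivative of the prefactor `r⁻¹`.
  have hGle : ∀ r ∈ Ioo p s, -(r ^ 2)⁻¹ * Real.log (F r) + r⁻¹ * (F' r / F r) ≤ C r / r ^ 2 := by
    intro r hr
    have h1 := hF'le r ⟨hr.1, hr.2.le⟩
    have h2 := hFpos r ⟨hr.1.le, hr.2.le⟩
    have hr0 : 0 < r := by linarith [hr.1]
    have h3 : F' r / F r ≤ r⁻¹ * (Real.log (F r) + C r) := by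
      rw [div_le_iff₀ h2]
      linarith
    calc _ ≤ -(r ^ 2)⁻¹ * Real.log (F r) + r⁻¹ * (r⁻¹ * (Real.log (F r) + C r)) := by gcongr
      _ = C r / r ^ 2 := by field_simp; ring
  have hCi : IntegrableOn (fun r => C r / r ^ 2) (Icc p s) := by
    have hc : ContinuousOn (fun r : ℝ => (r ^ 2)⁻¹) (Icc p s) := by
      refine ContinuousOn.inv₀ (by fun_prop) fun r hr => ?_
      have : 0 < r := by linarith [hr.1]
      positivity
    simpa only [div_eq_mul_inv] using hC.mul_continuousOn hc isCompact_Icc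
  rcases hps.eq_or_lt with rfl | hlt
  · rw [intervalIntegral.integral_same, Real.exp_zero, one_mul, hHp, hu.initial]
  have hGc : ContinuousOn G (Icc p s) := by
    intro r hr
    rcases hr.1.eq_or_lt with rfl | h
    · have hwc : Tendsto w (𝓝[>] p) (𝓝 (w p)) := by
        have h1 : Tendsto (fun r => max (H r) 0) (𝓝[>] p) (𝓝[≥] 0) := by
          refine tendsto_nhdsWithin_iff.2 ⟨?_, Eventually.of_forall fun r => mem_Ici.2 (le_max_right _ _)⟩
          have h2 := ((hHd p self_mem_Ici).continuousAt.tendsto.mono_left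
            (nhdsWithin_le_nhds (s := Ioi p))).max (tendsto_const_nhds (x := (0 : ℝ)))
          simpa [hHp] using h2
        have h3 := (hu.continuousOn 0 self_mem_Ici).tendsto.comp h1
        rwa [hu.initial, ← hwp] at h3
      have hFc : ContinuousWithinAt F (Icc p s) p :=
        (continuousWithinAt_Ioi_iff_Ici.1 (tendsto_integral_abs_rpow hp hM hwc hwM)).mono
          Icc_subset_Ici_self
      exact (continuousWithinAt_id.inv₀ (by simp; linarith)).mul (hFc.log (hFpos p hr).ne')
    · exact (hGd r ⟨h, hr.2⟩).continuousAt.continuousWithinAt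
  -- `C` is merely integrable, so the differential inequality is integrated in this form, without
  -- requiring `G'` to be integrable. At `p` only continuity of `G` is used.
  have hmain := intervalIntegral.sub_le_integral_of_hasDeriv_right_of_le hps hGc
    (fun r hr => (hGd r ⟨hr.1, hr.2.le⟩).hasDerivWithinAt) hCi hGle
  have eG : ∀ r ∈ Icc p s, F r ^ r⁻¹ = Real.exp (G r) := fun r hr => by
    rw [Real.rpow_def_of_pos (hFpos r hr), hG]; ring_nf
  have e1 := eG s ⟨hps, le_rfl⟩
  have e2 := eG p ⟨le_rfl, hps⟩
  simp only [hF] at e1 e2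
  rw [hwH s hps] at e1
  rw [hwp] at e2
  rw [e1, e2, ← Real.exp_add, Real.exp_le_exp]
  linarith

end BoundedData

end StrongHyper

namespace StrongHyper

/-! ### Extension from bounded data to all solutions. -/

section Approximation

/-- Convergence in `L^r` gives an almost everywhere convergent subsequence, and Fatou's lemma then
acts on the unrelated `L^q` norms. -/
theorem eLpNorm_le_of_tendsto {α : Type*} [MeasurableSpace α] {μ : Measure α} {f : ℕ → α → ℝ}
    {g : α → ℝ} {r q : ℝ≥0∞} {c : ℕ → ℝ≥0∞} {b : ℝ≥0∞} (hr : r ≠ 0)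
    (hf : ∀ n, AEStronglyMeasurable (f n) μ) (hg : AEStronglyMeasurable g μ)
    (h : Tendsto (fun n => eLpNorm (f n - g) r μ) atTop (𝓝 0))
    (hc : ∀ n, eLpNorm (f n) q μ ≤ c n) (hb : Tendsto c atTop (𝓝 b)) : eLpNorm g q μ ≤ b := by
  obtain ⟨ns, hns, hlim⟩ := (tendstoInMeasure_of_tendsto_eLpNorm hr hf hg h).exists_seq_tendsto_ae
  refine (Lp.eLpNorm_lim_le_liminf_eLpNorm (fun n => hf (ns n)) g hlim).trans ?_
  rw [← (hb.comp hns.tendsto_atTop).liminf_eq]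
  exact liminf_le_liminf (Eventually.of_forall fun n => hc (ns n))

theorem lipschitzWith_clamp {M : ℝ} (hM : 0 ≤ M) : LipschitzWith 1 (clamp M) :=
  LipschitzWith.of_dist_le_mul fun a b => by
    simpa [Real.dist_eq] using abs_clamp_sub_le hM a b

theorem clamp_zero {M : ℝ} (hM : 0 ≤ M) : clamp M 0 = 0 := clamp_eq_self (by simpa using hM)

variable {N : ℕ} {J : RN N → RN N → ℝ}

theorem tendsto_clamp_compLp (v : Lp ℝ 2 (volume : Measure (RN N))) :
    Tendsto (fun n : ℕ => (lipschitzWith_clamp n.cast_nonneg).compLp (clamp_zero n.cast_nonneg) v)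
      atTop (𝓝 v) := by
  rw [tendsto_iff_norm_sub_tendsto_zero]
  have h : Tendsto (fun n : ℕ => ∫ x, (clamp n (v x) - v x) ^ 2) atTop (𝓝 (∫ x : RN N, (0 : ℝ))) := by
    refine tendsto_integral_of_dominated_convergence (fun x => (2 * |v x|) ^ 2) (fun n => ?_) ?_ ?_ ?_
    · have := Lp.aestronglyMeasurable v
      exact (((continuous_clamp n).comp_aestronglyMeasurable this).sub this).pow 2
    · simpa [mul_pow] using (integrable_sq_coeFn v).const_mul (2 ^ 2)
    · refine fun n => Eventually.of_forall fun x => ?_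
      rw [norm_pow, Real.norm_eq_abs]
      have h1 := abs_clamp_le_abs (n.cast_nonneg (α := ℝ)) (v x)
      have h2 := abs_sub (clamp n (v x)) (v x)
      gcongr
      linarith
    · refine Eventually.of_forall fun x => ?_
      refine tendsto_const_nhds.congr' ?_
      obtain ⟨n₀, hn₀⟩ := exists_nat_ge |v x|
      filter_upwards [eventually_ge_atTop n₀] with n hn
      have : |v x| ≤ n := hn₀.trans (by exact_mod_cast hn)
      simp [clamp_eq_self this]
  have e : ∀ n : ℕ, ∫ x, (clamp n (v x) - v x) ^ 2
      = ‖(lipschitzWith_clamp n.cast_nonneg).compLp (clamp_zero n.cast_nonneg) v - v‖ ^ 2 := by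
    intro n
    rw [← integral_sq_eq_norm_sq]
    refine integral_congr_ae ?_
    filter_upwards [Lp.coeFn_sub ((lipschitzWith_clamp n.cast_nonneg).compLp
      (clamp_zero n.cast_nonneg) v) v, (lipschitzWith_clamp n.cast_nonneg).coeFn_compLp
      (clamp_zero n.cast_nonneg) v] with x h1 h2
    rw [h1, Pi.sub_apply, h2]; rfl
  simp only [e, integral_zero] at h
  have h3 := h.sqrt
  simpa [Real.sqrt_sq (norm_nonneg _)] using h3

variable {u₀ : Lp ℝ 2 (volume : Measure (RN N))} {u : ℝ → Lp ℝ 2 (volume : Measure (RN N))}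

/-- The initial datum of a mild solution is approximated by bounded functions of finite energy,
without increasing the `L^p` norm much. -/
theorem IsMildSolution.exists_approx_initial {p ε : ℝ} (hu : IsMildSolution J u₀ u)
    (hJ : IsLevyKernel J) (hp : 2 ≤ p) (hε : 0 < ε) :
    ∃ M, 1 ≤ M ∧ ∃ g : Lp ℝ 2 (volume : Measure (RN N)), MemEnergySpace J g ∧
      (∀ᵐ x, |g x| ≤ M) ∧ ‖g - u₀‖ ≤ ε ∧
      eLpNorm g (ENNReal.ofReal p) volume
        ≤ eLpNorm u₀ (ENNReal.ofReal p) volume + ENNReal.ofReal ε := by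
  have hp0 : 0 < p := by linarith
  have h1 := (tendsto_iff_norm_sub_tendsto_zero.1 (tendsto_clamp_compLp u₀)).eventually
    (gt_mem_nhds (half_pos hε))
  obtain ⟨n, hn, hn1⟩ := (h1.and (eventually_ge_atTop 1)).exists
  have hn0 : (0 : ℝ) ≤ n := n.cast_nonneg
  have hn1' : (1 : ℝ) ≤ n := by exact_mod_cast hn1
  set L := lipschitzWith_clamp hn0
  set c := L.compLp (clamp_zero hn0) u₀ with hc
  have hlim : Tendsto (fun t => ‖u t - u₀‖) (𝓝[>] 0) (𝓝 0) :=
    tendsto_iff_norm_sub_tendsto_zero.1 hu.tendsto_zero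
  -- The approximant is `clamp n (u t)` for small `t`: the flow provides finite energy, the clamp
  -- boundedness. It differs from `clamp n u₀` by at most `2n` pointwise, so `L²` smallness turns
  -- into `L^p` smallness with this bound.
  have hlim2 : Tendsto (fun t => ((2 * n : ℝ) ^ (p - 2) * ‖u t - u₀‖ ^ 2) ^ p⁻¹) (𝓝[>] 0)
      (𝓝 0) := by
    have h2 := ((hlim.pow 2).const_mul ((2 * n : ℝ) ^ (p - 2))).rpow_const
      (p := p⁻¹) (Or.inr (by positivity))
    simpa [Real.zero_rpow (inv_ne_zero hp0.ne')] using h2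
  obtain ⟨t, ⟨ht1, ht2⟩, ht0⟩ := (((hlim.eventually (gt_mem_nhds (half_pos hε))).and
    (hlim2.eventually (gt_mem_nhds hε))).and self_mem_nhdsWithin).exists
  set g := L.compLp (clamp_zero hn0) (u t) with hg
  have hge : ∀ᵐ x, g x = clamp n (u t x) := L.coeFn_compLp (clamp_zero hn0) (u t)
  have hce : ∀ᵐ x, c x = clamp n (u₀ x) := L.coeFn_compLp (clamp_zero hn0) u₀
  have hgc : ‖g - c‖ ≤ ‖u t - u₀‖ := by
    have := L.norm_compLp_sub_le (clamp_zero hn0) (u t) u₀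
    simpa using this
  have hsub : ∀ᵐ x, (g - c : Lp ℝ 2 (volume : Measure (RN N))) x
      = clamp n (u t x) - clamp n (u₀ x) := by
    filter_upwards [Lp.coeFn_sub g c, hge, hce] with x k1 k2 k3
    rw [k1, Pi.sub_apply, k2, k3]
  have hb : ∀ᵐ x, |(g - c : Lp ℝ 2 (volume : Measure (RN N))) x| ≤ 2 * n := by
    filter_upwards [hsub] with x hx
    rw [hx]
    have k1 := abs_sub (clamp n (u t x)) (clamp n (u₀ x))
    have k2 := abs_clamp_le hn0 (u t x)
    have k3 := abs_clamp_le hn0 (u₀ x)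
    linarith
  refine ⟨n, hn1', g, ?_, ?_, ?_, ?_⟩
  · refine (hu.memEnergySpace t ht0).of_lipschitz (K := 1) hJ (Lp.aestronglyMeasurable _) ?_ ?_
    · filter_upwards [hge] with x hx
      rw [hx, one_mul]
      exact abs_clamp_le_abs hn0 _
    · filter_upwards [ae_jump_of_ae hge] with z hz
      rw [incr, hz.1, hz.2, one_mul]
      exact abs_clamp_sub_le hn0 _ _
  · filter_upwards [hge] with x hx
    rw [hx]
    exact abs_clamp_le hn0 _
  · have : g - u₀ = (g - c) + (c - u₀) := by abel
    rw [this]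
    refine (norm_add_le _ _).trans ?_
    have hn' : ‖c - u₀‖ < ε / 2 := hn
    linarith
  · have k1 : eLpNorm c (ENNReal.ofReal p) volume ≤ eLpNorm u₀ (ENNReal.ofReal p) volume := by
      refine eLpNorm_mono_ae ?_
      filter_upwards [hce] with x hx
      rw [hx]
      exact abs_clamp_le_abs hn0 _
    have k2 : eLpNorm (g - c : Lp ℝ 2 (volume : Measure (RN N))) (ENNReal.ofReal p) volume
        ≤ ENNReal.ofReal ε := by
      have hm := MemLp.ofReal_of_bounded (Lp.memLp (g - c)) hp hb
      rw [eLpNorm_eq_integral_abs_rpow hp0 hm]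
      refine ENNReal.ofReal_le_ofReal (le_trans ?_ ht2.le)
      have h0 : 0 ≤ ∫ x, |(g - c : Lp ℝ 2 (volume : Measure (RN N))) x| ^ p :=
        integral_nonneg fun x => by positivity
      refine Real.rpow_le_rpow h0 ?_ (by positivity)
      calc _ ≤ ∫ x, (2 * n : ℝ) ^ (p - 2) * (g - c : Lp ℝ 2 (volume : Measure (RN N))) x ^ 2 :=
            integral_mono_ae ((integrable_abs_rpow_iff hp0 (Lp.aestronglyMeasurable _)).2 hm)
              ((integrable_sq_coeFn _).const_mul _) (hb.mono fun x hx => abs_rpow_le_mul_sq hp hx)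
        _ = (2 * n : ℝ) ^ (p - 2) * ‖g - c‖ ^ 2 := by
            rw [integral_const_mul, integral_sq_eq_norm_sq]
        _ ≤ _ := by gcongr
    have k3 : eLpNorm g (ENNReal.ofReal p) volume
        = eLpNorm (⇑c + ⇑(g - c)) (ENNReal.ofReal p) volume := by
      refine eLpNorm_congr_ae ?_
      filter_upwards [Lp.coeFn_sub g c] with x hx
      rw [Pi.add_apply, hx]; simp
    rw [k3]
    refine (eLpNorm_add_le (Lp.aestronglyMeasurable _) (Lp.aestronglyMeasurable _) ?_).trans
      (add_le_add k1 k2)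
    rw [← ENNReal.ofReal_one]
    exact ENNReal.ofReal_le_ofReal (by linarith)

/-- An `L^p`-`L^s` bound for mild solutions with bounded data of finite energy extends to all
solutions. -/
theorem IsSolution.eLpNorm_le {p s t : ℝ} {K : ℝ≥0∞} (hJ : IsLevyKernel J) (hp : 2 ≤ p)
    (ht : 0 ≤ t) (hK : K ≠ ∞)
    (hbd : ∀ (M : ℝ) (g : Lp ℝ 2 (volume : Measure (RN N)))
      (w : ℝ → Lp ℝ 2 (volume : Measure (RN N))), 1 ≤ M → (∀ᵐ x, |g x| ≤ M) →
      IsMildSolution J g w → eLpNorm (w t) (ENNReal.ofReal s) volume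
        ≤ K * eLpNorm g (ENNReal.ofReal p) volume)
    {f : RN N → ℝ} {z : ℝ → RN N → ℝ} (hz : IsSolution J p f z) :
    eLpNorm (z t) (ENNReal.ofReal s) volume ≤ K * eLpNorm f (ENNReal.ofReal p) volume := by
  obtain ⟨hf, hzp, v₀, v, hv, -, hlim₀, hlim⟩ := hz
  have hp1 : 1 ≤ ENNReal.ofReal p := by
    rw [← ENNReal.ofReal_one]
    exact ENNReal.ofReal_le_ofReal (by linarith)
  have hpne : ENNReal.ofReal p ≠ 0 := (zero_lt_one.trans_le hp1).ne'
  have hmild : ∀ n, eLpNorm (v n t) (ENNReal.ofReal s) volume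
      ≤ K * eLpNorm (v₀ n) (ENNReal.ofReal p) volume := by
    intro n
    have hpos : ∀ k : ℕ, (0 : ℝ) < 1 / (k + 1) := fun k => by positivity
    -- The solutions from these data converge to `v n t` in `L²` by contraction, while the `L^p`
    -- norms of the data exceed that of `v₀ n` by at most `1/(k+1)`.
    choose M hM g hgE hgM hgn hgp using fun k => (hv n).exists_approx_initial hJ hp (hpos k)
    choose w hw _ using fun k => exists_isMildSolution hJ (g k) (hgE k)
    have hlim1 := tendsto_one_div_add_atTop_nhds_zero_nat (𝕜 := ℝ)
    have hwv : Tendsto (fun k => w k t) atTop (𝓝 (v n t)) := by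
      rw [tendsto_iff_norm_sub_tendsto_zero]
      exact squeeze_zero (fun _ => norm_nonneg _)
        (fun k => ((hw k).norm_sub_le (hv n) hJ ht).trans (hgn k)) hlim1
    refine eLpNorm_le_of_tendsto (r := 2) (f := fun k => w k t) (by norm_num)
      (fun k => Lp.aestronglyMeasurable _) (Lp.aestronglyMeasurable _)
      ((Lp.tendsto_Lp_iff_tendsto_eLpNorm' _ _).1 hwv)
      (fun k => (hbd _ _ _ (hM k) (hgM k) (hw k)).trans (mul_le_mul_right (hgp k) K)) ?_
    have h2 : Tendsto (fun k : ℕ => ENNReal.ofReal ((1 : ℝ) / (k + 1))) atTop (𝓝 0) := by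
      simpa using ENNReal.tendsto_ofReal hlim1
    have h3 := ENNReal.Tendsto.const_mul (a := K)
      ((tendsto_const_nhds (x := eLpNorm (v₀ n) (ENNReal.ofReal p) volume)).add h2) (Or.inr hK)
    simpa using h3
  have htri : ∀ n, eLpNorm (v₀ n) (ENNReal.ofReal p) volume
      ≤ eLpNorm f (ENNReal.ofReal p) volume + eLpNorm (⇑(v₀ n) - f) (ENNReal.ofReal p) volume := by
    intro n
    have e : ⇑(v₀ n) = f + (⇑(v₀ n) - f) := by ext x; simp
    nth_rw 1 [e]
    exact eLpNorm_add_le hf.1 ((Lp.aestronglyMeasurable _).sub hf.1) hp1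
  refine eLpNorm_le_of_tendsto (r := ENNReal.ofReal p) (f := fun n => v n t) hpne
    (fun n => Lp.aestronglyMeasurable _) (hzp t ht).1 (hlim t ht)
    (fun n => (hmild n).trans (mul_le_mul_right (htri n) K)) ?_
  have h3 := ENNReal.Tendsto.const_mul (a := K)
    ((tendsto_const_nhds (x := eLpNorm f (ENNReal.ofReal p) volume)).add hlim₀) (Or.inr hK)
  simpa using h3

end Approximation

end StrongHyper

namespace StrongHyper

/-! ### Separation of variables: blow-up time and inverse time change. -/

section TimeChange

theorem exists_strictMono_primitive {w : ℝ → ℝ} {p : ℝ} (hw : ContinuousOn w (Ici p))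
    (hpos : ∀ r ∈ Ici p, 0 < w r) :
    ∃ H : ℝ → ℝ, StrictMono H ∧ (∀ r ∈ Ici p, HasStrictDerivAt H (w r) r) ∧
      ∀ r ∈ Ici p, H r = ∫ x in p..r, w x := by
  have hmem : ∀ r : ℝ, max r p ∈ Ici p := fun r => le_max_right r p
  -- Extending `w` by its value at `p` to the left makes the primitive strictly increasing on all of
  -- `ℝ`, with a two-sided derivative at `p`.
  have hc : Continuous fun r => w (max r p) :=
    hw.comp_continuous (continuous_id.max continuous_const) hmem
  have hd := fun r => hc.integral_hasStrictDerivAt p r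
  refine ⟨fun r => ∫ x in p..r, w (max x p), strictMono_of_deriv_pos fun r => ?_, fun r hr => ?_,
    fun r hr => intervalIntegral.integral_congr fun x hx => ?_⟩
  · rw [(hd r).hasDerivAt.deriv]
    exact hpos _ (hmem r)
  · simpa [max_eq_left (mem_Ici.1 hr)] using hd r
  · rw [uIcc_of_le hr] at hx
    simp [max_eq_left hx.1]

/-- For a positive integrand, a finite limit of the primitive already forces integrability. -/
theorem tendsto_primitive_iff_integral {w H : ℝ → ℝ} {p T : ℝ} (hw : ContinuousOn w (Ici p))
    (hpos : ∀ r ∈ Ici p, 0 < w r) (hH : ∀ r ∈ Ici p, H r = ∫ x in p..r, w x) :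
    Tendsto H atTop (𝓝 T) ↔ IntegrableOn w (Ioi p) ∧ T = ∫ x in Ioi p, w x := by
  have hev : ∀ᶠ r in atTop, ∫ x in p..r, w x = H r :=
    (eventually_ge_atTop p).mono fun r hr => (hH r hr).symm
  constructor
  · intro h
    have hint : IntegrableOn w (Ioi p) := by
      refine integrableOn_Ioi_of_intervalIntegral_norm_tendsto (b := id) (l := atTop) T p
        (fun r => ?_) tendsto_id (h.congr' ?_)
      · exact ((hw.mono Icc_subset_Ici_self).integrableOn_Icc).mono_set Ioc_subset_Icc_self
      · filter_upwards [eventually_ge_atTop p] with r hr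
        rw [hH r hr]
        refine intervalIntegral.integral_congr fun x hx => ?_
        rw [uIcc_of_le hr] at hx
        exact (Real.norm_of_nonneg (hpos x hx.1).le).symm
    exact ⟨hint, tendsto_nhds_unique h
      ((intervalIntegral_tendsto_integral_Ioi p hint tendsto_id).congr' hev)⟩
  · rintro ⟨hint, rfl⟩
    exact (intervalIntegral_tendsto_integral_Ioi p hint tendsto_id).congr' hev

/-- The blow-up time of the autonomous equation `q' = h(q)`. -/
theorem blowup_time_eq_integral {h q : ℝ → ℝ} {p T : ℝ} (hh : ContinuousOn h (Ici p))
    (hpos : ∀ α ∈ Ici p, 0 < h α) (hT : 0 < T) (hqm : MapsTo q (Ico 0 T) (Ici p)) (hq0 : q 0 = p)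
    (hqT : Tendsto q (𝓝[<] T) atTop)
    (hq : ∀ t ∈ Ico 0 T, HasDerivWithinAt q (h (q t)) (Ico 0 T) t) :
    IntegrableOn (fun α => (h α)⁻¹) (Ioi p) ∧ T = ∫ α in Ioi p, (h α)⁻¹ := by
  have hw : ContinuousOn (fun α => (h α)⁻¹) (Ici p) := hh.inv₀ fun α hα => (hpos α hα).ne'
  have hwpos : ∀ α ∈ Ici p, 0 < (h α)⁻¹ := fun α hα => inv_pos.2 (hpos α hα)
  obtain ⟨H, hmono, hd, hH⟩ := exists_strictMono_primitive hw hwpos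
  refine (tendsto_primitive_iff_integral hw hwpos hH).1 ?_
  have hp0 : H p = 0 := by rw [hH p self_mem_Ici]; simp
  -- `H ∘ q` has derivative `h(q)⁻¹ h(q) = 1` and starts at zero. As `q → ∞` when `t → T`, the limit
  -- of `H` at infinity must be `T`.
  have hHq : ∀ t ∈ Ico 0 T, H (q t) = t := by
    intro t ht
    have hsub : Icc 0 t ⊆ Ico 0 T := fun x hx => ⟨hx.1, hx.2.trans_lt ht.2⟩
    have hder : ∀ x ∈ Ico 0 T, HasDerivWithinAt (fun s => H (q s) - s) 0 (Ico 0 T) x := by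
      intro x hx
      have h1 := (hd (q x) (hqm hx)).hasDerivAt.comp_hasDerivWithinAt x (hq x hx)
      rw [inv_mul_cancel₀ (hpos _ (hqm hx)).ne'] at h1
      have h2 := h1.sub (hasDerivWithinAt_id x _)
      rwa [sub_self] at h2
    have h2 := constant_of_has_deriv_right_zero (f := fun s => H (q s) - s) (a := 0) (b := t)
      (fun x hx => (hder x (hsub hx)).continuousWithinAt.mono hsub)
      (fun x hx => (hder x (hsub (Ico_subset_Icc_self hx))).mono_of_mem_nhdsWithin
        (mem_of_superset (Ico_mem_nhdsGE (hx.2.trans ht.2)) (Ico_subset_Ico_left hx.1)))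
      t ⟨ht.1, le_rfl⟩
    simp only [hq0, hp0, sub_zero] at h2
    linarith
  have hnhds : ∀ᶠ t in 𝓝[<] T, t ∈ Ico 0 T := by
    filter_upwards [Ioo_mem_nhdsLT hT] with t ht using ⟨ht.1.le, ht.2⟩
  refine tendsto_order.2 ⟨fun b hb => ?_, fun b hb => Eventually.of_forall fun r => ?_⟩
  · obtain ⟨t, ht, hbt⟩ := (hnhds.and (Ioo_mem_nhdsLT hb)).exists
    filter_upwards [eventually_ge_atTop (q t)] with r hr
    have := hmono.monotone hr
    rw [hHq t ht] at this
    exact hbt.1.trans_le this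
  · obtain ⟨t, ht, hrt⟩ := (hnhds.and (hqT.eventually_ge_atTop r)).exists
    have := hmono.monotone hrt
    rw [hHq t ht] at this
    exact this.trans_lt (ht.2.trans hb)

/-- Inversion of the time change `t = H(q)`. -/
theorem exists_inverse_timeChange {w H : ℝ → ℝ} {p T : ℝ} (hmono : StrictMono H)
    (hpos : ∀ r ∈ Ici p, 0 < w r) (hd : ∀ r ∈ Ici p, HasStrictDerivAt H (w r) r) (hp0 : H p = 0)
    (hT : Tendsto H atTop (𝓝 T)) :
    0 < T ∧ ∃ q : ℝ → ℝ, q 0 = p ∧ MapsTo q (Ico 0 T) (Ici p) ∧ MonotoneOn q (Ico 0 T) ∧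
      Tendsto q (𝓝[<] T) atTop ∧ (∀ t ∈ Ico 0 T, H (q t) = t) ∧
      ∀ t ∈ Ico 0 T, HasDerivAt q (w (q t))⁻¹ t := by
  -- A strictly increasing function never attains its limit, so each exponent is reached strictly
  -- before `T` and the inverse tends to infinity at `T`.
  have hlt : ∀ r, H r < T := fun r =>
    (hmono (lt_add_one r)).trans_le (hmono.monotone.ge_of_tendsto hT _)
  have hT0 : 0 < T := hp0 ▸ hlt p
  have hsurj : ∀ t ∈ Ico 0 T, ∃ r ∈ Ici p, H r = t := by
    intro t ht
    obtain ⟨R, hR, hpR⟩ := ((hT.eventually (lt_mem_nhds ht.2)).and (eventually_ge_atTop p)).exists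
    have hc : ContinuousOn H (Icc p R) := fun r hr =>
      (hd r hr.1).hasDerivAt.continuousAt.continuousWithinAt
    obtain ⟨r, hr, hrt⟩ := intermediate_value_Icc hpR hc ⟨hp0 ▸ ht.1, hR.le⟩
    exact ⟨r, hr.1, hrt⟩
  have hinv : ∀ r, Function.invFun H (H r) = r := Function.leftInverse_invFun hmono.injective
  have hq : ∀ t ∈ Ico 0 T, Function.invFun H t ∈ Ici p ∧ H (Function.invFun H t) = t := by
    intro t ht
    obtain ⟨r, hr, rfl⟩ := hsurj t ht
    rw [hinv]
    exact ⟨hr, rfl⟩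
  have hmq : MonotoneOn (Function.invFun H) (Ico 0 T) := fun s hs t ht hst =>
    hmono.le_iff_le.1 (by rwa [(hq s hs).2, (hq t ht).2])
  refine ⟨hT0, Function.invFun H, hp0 ▸ hinv p, fun t ht => (hq t ht).1, hmq, ?_,
    fun t ht => (hq t ht).2, fun t ht => ?_⟩
  · refine tendsto_atTop.2 fun b => ?_
    filter_upwards [Ioo_mem_nhdsLT (hlt b), Ioo_mem_nhdsLT hT0] with t h1 h2
    refine (hmono.lt_iff_lt.1 ?_).le
    rw [(hq t ⟨h2.1.le, h2.2⟩).2]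
    exact h1.1
  · obtain ⟨r, hr, rfl⟩ := hsurj t ht
    rw [hinv]
    exact ((hd r hr).to_local_left_inverse (hpos r hr).ne'
      (Eventually.of_forall hinv)).hasDerivAt

end TimeChange

/-! ### Assembly of the two implications. -/

variable {N : ℕ} {J : RN N → RN N → ℝ}

/-- The family of logarithmic Sobolev inequalities implies strong hypercontractivity. -/
theorem hypercontractive_of_logSobolev {p T : ℝ} {C D : ℝ → ℝ} (hJ : IsLevyKernel J) (hp : 2 ≤ p)
    (hD : ContinuousOn D (Ici p)) (hC : ∀ R : ℝ, IntegrableOn C (Icc p R))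
    (hLS : ∀ r ∈ Ici p, LogSobolev J r (C r) (D r))
    (hint : IntegrableOn (fun α : ℝ => D α / α ^ 2) (Ioi p))
    (hT : T = ∫ α in Ioi p, D α / α ^ 2) :
    ∃ q A : ℝ → ℝ, IsStronglyHypercontractiveWith J p T q A ∧
      (∀ t ∈ Ico 0 T, HasDerivWithinAt q (q t ^ 2 / D (q t)) (Ico 0 T) t) ∧
      ∀ t ∈ Ico 0 T, A t = Real.exp (∫ α in p..q t, C α / α ^ 2) := by
  have hpos' : ∀ r ∈ Ici p, 0 < r := fun r hr => by linarith [mem_Ici.1 hr]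
  have hw : ContinuousOn (fun α : ℝ => D α / α ^ 2) (Ici p) :=
    hD.div (continuousOn_pow 2) fun r hr => (pow_pos (hpos' r hr) 2).ne'
  have hwpos : ∀ r ∈ Ici p, 0 < D r / r ^ 2 := fun r hr =>
    div_pos (hLS r hr).1 (pow_pos (hpos' r hr) 2)
  obtain ⟨H, hmono, hd, hH⟩ := exists_strictMono_primitive hw hwpos
  have hp0 : H p = 0 := by rw [hH p self_mem_Ici]; simp
  have hlim := (tendsto_primitive_iff_integral hw hwpos hH).2 ⟨hint, hT⟩
  obtain ⟨hT0, q, hq0, hqm, hqmono, hqT, hHq, hqd⟩ :=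
    exists_inverse_timeChange hmono hwpos hd hp0 hlim
  refine ⟨q, fun t => Real.exp (∫ α in p..q t, C α / α ^ 2),
    ⟨by linarith, hT0, hqm, hqmono, hq0, hqT, fun t _ => (Real.exp_pos _).le, ?_⟩,
    fun t ht => ?_, fun t _ => rfl⟩
  · intro f z hz t ht
    -- The exponent-parametrized bound at `s = q t` is a bound at time `H (q t) = t`.
    have ht' : t ∈ Ico 0 T := ⟨ht.1.le, ht.2⟩
    refine hz.eLpNorm_le hJ hp ht.1.le ENNReal.ofReal_ne_top fun M g v hM hg hv => ?_
    have hqt : p ≤ q t := hqm ht'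
    have h1 := hv.integral_rpow_le hJ hM hg hp hqt (hC _) hLS hp0 (hmono.strictMonoOn _)
      fun r hr => (hd r hr).hasDerivAt
    rw [hHq t ht'] at h1
    have hM0 : 0 ≤ M := by linarith
    rw [eLpNorm_eq_integral_abs_rpow (by linarith)
        (MemLp.ofReal_of_bounded (Lp.memLp (v t)) (by linarith) (hv.abs_le hJ hM0 hg ht.1.le)),
      eLpNorm_eq_integral_abs_rpow (by linarith) (MemLp.ofReal_of_bounded (Lp.memLp g) hp hg),
      ← ENNReal.ofReal_mul (Real.exp_pos _).le]
    exact ENNReal.ofReal_le_ofReal h1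
  · simpa [inv_div] using (hqd t ht).hasDerivWithinAt

end StrongHyper

theorem mainTheorem3 {N : ℕ} (J : StrongHyper.RN N → StrongHyper.RN N → ℝ)
    (hJ : StrongHyper.IsLevyKernel J) (p : ℝ) (hp : 2 ≤ p) :
    -- from hypercontractivity along an autonomous ODE to the logarithmic Sobolev inequality
    (∀ (h q A : ℝ → ℝ) (T : ℝ) (a : EReal),
      ContinuousOn h (Ici p) → (∀ α ∈ Ici p, 0 < h α) →
      StrongHyper.IsStronglyHypercontractiveWith J p T q A →
      (∀ t ∈ Ico 0 T, HasDerivWithinAt q (h (q t)) (Ico 0 T) t) →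
      A 0 = 1 → Tendsto A (𝓝[>] 0) (𝓝 1) →
      Tendsto (fun s : ℝ => (((A s - 1) / s : ℝ) : EReal)) (𝓝[>] 0) (𝓝 a) → a < ⊤ →
        (∀ C : ℝ, ((p ^ 2 / h p : ℝ) : EReal) * a ≤ (C : EReal) →
          StrongHyper.LogSobolev J p C (p ^ 2 / h p)) ∧
        IntegrableOn (fun α : ℝ => (α ^ 2 / h α) / α ^ 2) (Ioi p) ∧
        T = ∫ α in Ioi p, (α ^ 2 / h α) / α ^ 2) ∧
    -- from the family of logarithmic Sobolev inequalities to strong hypercontractivity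
    (∀ (C D : ℝ → ℝ) (T : ℝ),
      ContinuousOn D (Ici p) → (∀ R : ℝ, IntegrableOn C (Icc p R)) →
      (∀ r ∈ Ici p, StrongHyper.LogSobolev J r (C r) (D r)) →
      IntegrableOn (fun α : ℝ => D α / α ^ 2) (Ioi p) →
      T = ∫ α in Ioi p, D α / α ^ 2 →
        ∃ q A : ℝ → ℝ, StrongHyper.IsStronglyHypercontractiveWith J p T q A ∧
          (∀ t ∈ Ico 0 T, HasDerivWithinAt q (q t ^ 2 / D (q t)) (Ico 0 T) t) ∧
          ∀ t ∈ Ico 0 T, A t = Real.exp (∫ α in p..q t, C α / α ^ 2)) := by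
  refine ⟨fun h q A T a hh hpos hyp hq _ _ hA _ => ⟨fun C hC => ?_, ?_⟩,
    fun C D T hD hC hLS hint hT =>
      StrongHyper.hypercontractive_of_logSobolev hJ hp hD hC hLS hint hT⟩
  -- Only the right derivative `q'(0) = h(q(0)) = h(p)` enters the logarithmic Sobolev constants.
  · have h0 : HasDerivWithinAt q (h p) (Ici 0) 0 := by
      have := (hq 0 ⟨le_rfl, hyp.time_pos⟩).mono_of_mem_nhdsWithin (Ico_mem_nhdsGE hyp.time_pos)
      rwa [hyp.initial] at this
    exact StrongHyper.logSobolev_of_hypercontractive hJ hp hyp (hpos p self_mem_Ici) h0 hA hC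
  · have e : EqOn (fun α : ℝ => (h α)⁻¹) (fun α => (α ^ 2 / h α) / α ^ 2) (Ioi p) := by
      intro α hα
      have h1 : α ≠ 0 := by linarith [mem_Ioi.1 hα]
      have h2 := (hpos α (mem_Ioi.1 hα).le).ne'
      field_simp
    obtain ⟨h1, h2⟩ := StrongHyper.blowup_time_eq_integral hh hpos hyp.time_pos hyp.mapsTo
      hyp.initial hyp.tendsto hq
    exact ⟨h1.congr_fun e measurableSet_Ioi, h2.trans (setIntegral_congr_fun measurableSet_Ioi e)⟩
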